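/- Let $K$ be a field of characteristic $0$ and $X$ a smooth separated scheme over $K$. Let $\mathrm{Ch}^+(\mathcal O_X\text{-mod})$ be the category of bounded below complexes of sheaves of $\mathcal O_X$-modules, with its tensor product and the Koszul sign rule. For $n\ge 0$ let $D^n_{poly}(X)$ be the $\mathcal O_X$-module (by left multiplication) whose sections over an affine open $U=\operatorname{Spec}R$ are the $K$-multilinear maps $f\colon R^n\to R$ that are differential operators (of finite order, uniformly in the other arguments) in each argument, and put $D^n_{poly}(X)=0$ for $n<0$. With the Hochschild differential $$df(a_0,\dots,a_n)=a_0f(a_1,\dots,a_n)+\sum_{i=1}^n(-1)^if(\dots,a_{i-1}a_i,\dots)+(-1)^{n+1}f(a_0,\dots,a_{n-1})a_n$$ and the product $(f\cdot g)(a_1,\dots,a_{p+q})=f(a_1,\dots,a_p)\,g(a_{p+1},\dots,a_{p+q})$, the complex $D^\bullet_{poly}(X)$ is a unital associative algebra in $\mathrm{Ch}^+(\mathcal O_X\text{-mod})$. Let $L(D^1_{poly}(X))\subset D^\bullet_{poly}(X)$ be the graded Lie subalgebra over $\mathcal O_X$, for the graded commutator $[x,y]=xy-(-1)^{|x||y|}yx$,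 generated by $D^1_{poly}(X)$ (its sections are those that are locally $\mathcal O_X$-linear combinations of iterated brackets of sections of $D^1_{poly}(X)$). Then the Hochschild differential preserves $L(D^1_{poly}(X))$, so that $L(D^1_{poly}(X))$ is a Lie algebra in $\mathrm{Ch}^+(\mathcal O_X\text{-mod})$; as a graded Lie algebra over $\mathcal O_X$ it is free on $D^1_{poly}(X)$ placed in degree $1$; and $D^\bullet_{poly}(X)$, with the inclusion $i\colon L(D^1_{poly}(X))\to D^\bullet_{poly}(X)$, is its universal enveloping algebra in $\mathrm{Ch}^+(\mathcal O_X\text{-mod})$. That is, $i$ is a morphism of Lie algebras, and for every unital associative algebra $A$ in $\mathrm{Ch}^+(\mathcal O_X\text{-mod})$ and every morphism of Lie algebras $f\colon L(D^1_{poly}(X))\to A$ in $\mathrm{Ch}^+(\mathcal O_X\text{-mod})$ (for the graded commutator on $A$) there is a unique morphism $\bar f\colon D^\bullet_{poly}(X)\to A$ of unital algebras in $\mathrm{Ch}^+(\mathcal O_X\text{-mod})$ with $\bar f\circ i=f$. -/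

import Mathlib

open CategoryTheory AlgebraicGeometry TopologicalSpace Opposite

universe u

namespace PolyDiff

/-! ### Polydifferential operators on a commutative algebra -/

section Ring

variable {R : Type u} [CommRing R] {n : ℕ}

/-- `f` is `K`-multilinear, where `R` is a `K`-algebra through `κ`; so `f` is a `K`-linear map
`R ⊗_K ... ⊗_K R → R` with `n` tensor factors. -/
def IsMultilinear {K : Type u} [CommRing K] (κ : K →+* R) (f : (Fin n → R) → R) : Prop :=
  (∀ (x : Fin n → R) (i : Fin n) (a b : R), f (Function.update x i (a + b)) =
      f (Function.update x i a) + f (Function.update x i b)) ∧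
  ∀ (x : Fin n → R) (i : Fin n) (c : K) (a : R), f (Function.update x i (κ c * a)) =
      κ c * f (Function.update x i a)

/-- The commutator of `f`, as an operator in its `i`-th argument, with multiplication by `a`. -/
def comm (i : Fin n) (a : R) (f : (Fin n → R) → R) : (Fin n → R) → R :=
  fun x => f (Function.update x i (a * x i)) - a * f x

/-- `f` is a differential operator of order at most `N` in its `i`-th argument
(Grothendieck's definition; `N` does not depend on the other arguments). -/
def OrderLE (i : Fin n) : ℕ → ((Fin n → R) → R) → Prop
  | 0, f => ∀ a : R, comm i a f = 0
  | N + 1, f => ∀ a : R, OrderLE i N (comm i a f)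

/-- Polydifferential operators: `K`-multilinear maps that are differential operators (of finite
order) in each argument. -/
def IsPolyDiff {K : Type u} [CommRing K] (κ : K →+* R) (f : (Fin n → R) → R) : Prop :=
  IsMultilinear κ f ∧ ∃ N : ℕ, ∀ i : Fin n, OrderLE i N f

/-- The product `(f, g) ↦ f(a₁, …, a_p) g(a_{p+1}, …, a_{p+q})`. -/
def prod {p q n : ℕ} (h : p + q = n) (f : (Fin p → R) → R) (g : (Fin q → R) → R) :
    (Fin n → R) → R :=
  fun a => f (fun i => a (Fin.cast h (Fin.castAdd q i))) *
    g (fun j => a (Fin.cast h (Fin.natAdd p j)))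

/-- The Hochschild differential
`a₀ f(a₁,…,a_n) + ∑_{i=1}^{n} (-1)^i f(…,a_{i-1}a_i,…) + (-1)^{n+1} f(a₀,…,a_{n-1}) a_n`. -/
def hochschild (f : (Fin n → R) → R) : (Fin (n + 1) → R) → R :=
  fun a => a 0 * f (fun i => a i.succ)
    + ∑ j : Fin n, (-1) ^ (j.val + 1) * f (Fin.contractNth j.castSucc (· * ·) a)
    + (-1) ^ (n + 1) * (f (fun i => a i.castSucc) * a (Fin.last n))

/-- The arguments of `f` in the `i`-th term of the Hochschild differential. -/
def faceArg (i : ℕ) (a : Fin (n + 1) → R) : Fin n → R :=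
  fun k => if k.val + 1 < i then a k.castSucc else
    if k.val + 1 = i then a k.castSucc * a k.succ else a k.succ

/-- The coefficient of `f` in the `i`-th term of the Hochschild differential. -/
def faceCoef (i : ℕ) (a : Fin (n + 1) → R) : R :=
  if i = 0 then a 0 else if i = n + 1 then a (Fin.last n) else 1

/-- The `i`-th term of the Hochschild differential, without its sign. -/
def coface (i : ℕ) (f : (Fin n → R) → R) : (Fin (n + 1) → R) → R :=
  fun a => faceCoef i a * f (faceArg i a)

theorem faceArg_zero (a : Fin (n + 1) → R) : faceArg 0 a = fun i => a i.succ := by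
  funext k
  simp only [faceArg]
  rw [if_neg (by omega), if_neg (by omega)]

theorem faceArg_last (a : Fin (n + 1) → R) : faceArg (n + 1) a = fun i => a i.castSucc := by
  funext k
  simp only [faceArg]
  rw [if_pos (by omega)]

theorem faceCoef_last (a : Fin (n + 1) → R) : faceCoef (n + 1) a = a (Fin.last n) := by
  simp [faceCoef]

theorem faceCoef_zero (a : Fin (n + 1) → R) : faceCoef 0 a = a 0 := by
  simp [faceCoef]

theorem hochschild_eq (f : (Fin n → R) → R) (a : Fin (n + 1) → R) :
    hochschild f a = ∑ i ∈ Finset.range (n + 2), (-1) ^ i * coface i f a := by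
  rw [Finset.sum_range_succ, Finset.sum_range_succ', hochschild, Finset.sum_range]
  have h1 : coface 0 f a = a 0 * f (fun i => a i.succ) := by
    rw [coface, faceCoef_zero, faceArg_zero]
  have h2 : coface (n + 1) f a = f (fun i => a i.castSucc) * a (Fin.last n) := by
    rw [coface, faceCoef_last, faceArg_last, mul_comm]
  have h3 : ∀ j : Fin n, coface (j.val + 1) f a =
      f (Fin.contractNth j.castSucc (· * ·) a) := by
    intro j
    simp only [coface, faceCoef]
    rw [if_neg (by omega), if_neg (by omega), one_mul]
    congr 1
    funext k
    simp only [faceArg, Fin.contractNth, Fin.val_castSucc]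
    simp
  rw [h1, h2]
  simp only [h3]
  ring

theorem faceArg_comm (i j : ℕ) (hij : i ≤ j) (a : Fin (n + 2) → R) :
    faceArg i (faceArg (j + 1) a) = faceArg j (faceArg i a) := by
  funext k
  simp only [faceArg, Fin.val_castSucc, Fin.val_succ]
  have : k.castSucc.succ = k.succ.castSucc := rfl
  split_ifs <;> first | omega | rfl | skip
  all_goals simp only [this, mul_assoc]

theorem faceCoef_comm (i j : ℕ) (hij : i ≤ j) (hj : j ≤ n + 1) (a : Fin (n + 2) → R) :
    faceCoef (j + 1) a * faceCoef i (faceArg (j + 1) a) =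
      faceCoef i a * faceCoef j (faceArg i a) := by
  simp only [faceArg, faceCoef]
  rcases Nat.eq_zero_or_pos i with rfl | hi
  · rcases Nat.eq_zero_or_pos j with rfl | hj0
    · simp
    · by_cases hjn : j = n + 1
      · subst hjn
        simp [mul_comm]
      · simp [hjn, hj0.ne']
  · by_cases hjn : j = n + 1
    · subst hjn
      by_cases hin : i = n + 1
      · subst hin
        simp [mul_comm]
      · have : i < n + 1 := by omega
        have h2 : i ≠ n + 2 := by omega
        simp [hi.ne', hin, h2]
        grind
    · have h2 : i ≠ n + 2 := by omega
      have h3 : i ≠ n + 1 := by omega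
      have h4 : j ≠ 0 := by omega
      simp [hi.ne', hjn, h2, h3, h4]

theorem coface_coface (i j : ℕ) (hij : i ≤ j) (hj : j ≤ n + 1) (f : (Fin n → R) → R) :
    coface (j + 1) (coface i f) = coface i (coface j f) := by
  funext a
  simp only [coface]
  rw [← mul_assoc, ← mul_assoc, faceCoef_comm i j hij hj, faceArg_comm i j hij]

theorem alternating_sum_eq_zero (N : ℕ) (G : ℕ → ℕ → R)
    (h : ∀ i j, i ≤ j → j ≤ N → G (j + 1) i = G i j) :
    ∑ i ∈ Finset.range (N + 2), ∑ j ∈ Finset.range (N + 1), (-1) ^ (i + j) * G i j = 0 := by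
  rw [← Finset.sum_product']
  refine Finset.sum_involution
    (fun x _ => if x.1 ≤ x.2 then (x.2 + 1, x.1) else (x.2, x.1 - 1)) ?_ ?_ ?_ ?_
  · rintro ⟨i, j⟩ hx
    simp only [Finset.mem_product, Finset.mem_range] at hx
    by_cases hij : i ≤ j
    · simp only [hij, if_true]
      rw [h i j hij (by omega)]
      ring
    · simp only [hij, if_false]
      obtain ⟨k, rfl⟩ : ∃ k, i = k + 1 := ⟨i - 1, by omega⟩
      rw [Nat.add_sub_cancel, h j k (by omega) (by omega)]
      ring
  · rintro ⟨i, j⟩ hx - heq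
    by_cases hij : i ≤ j <;> simp [hij] at heq <;> omega
  · rintro ⟨i, j⟩ hx
    simp only [Finset.mem_product, Finset.mem_range] at hx ⊢
    by_cases hij : i ≤ j <;> simp [hij] <;> omega
  · rintro ⟨i, j⟩ hx
    simp only [Finset.mem_product, Finset.mem_range] at hx
    by_cases hij : i ≤ j
    · simp [hij]
    · have h1 : j ≤ i - 1 := by omega
      simp [hij, h1]
      omega

theorem hochschild_hochschild (f : (Fin n → R) → R) : hochschild (hochschild f) = 0 := by
  funext a
  have : hochschild (hochschild f) a = ∑ i ∈ Finset.range (n + 1 + 2),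
      ∑ j ∈ Finset.range (n + 1 + 1), (-1) ^ (i + j) * coface i (coface j f) a := by
    rw [hochschild_eq]
    refine Finset.sum_congr rfl fun i _ => ?_
    simp only [coface]
    rw [hochschild_eq, Finset.mul_sum, Finset.mul_sum]
    refine Finset.sum_congr rfl fun j _ => ?_
    simp only [coface]
    ring
  rw [this]
  exact alternating_sum_eq_zero (n + 1) (fun i j => coface i (coface j f) a)
    fun i j hij hj => congrFun (coface_coface i j hij hj f) a

theorem coface_prod_left {p q : ℕ} (f : (Fin p → R) → R) (g : (Fin q → R) → R) {n : ℕ}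
    (h : p + q = n) (h' : p + 1 + q = n + 1) (i : ℕ) (hi : i ≤ p) :
    coface i (prod h f g) = prod h' (coface i f) g := by
  subst h
  funext a
  simp only [coface, prod, faceCoef, faceArg]
  rw [← mul_assoc]
  congr 1
  · congr 1
    · by_cases h0 : i = 0
      · simp [h0]; rfl
      · rw [if_neg h0, if_neg h0, if_neg (by omega), if_neg (by omega)]
  · congr 1
    funext k
    simp only [Fin.cast_eq_self, Fin.val_natAdd]
    rw [if_neg (by omega), if_neg (by omega)]
    congr 1
    ext
    simp
    omega

theorem coface_prod_right {p q : ℕ} (f : (Fin p → R) → R) (g : (Fin q → R) → R) {n : ℕ}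
    (h : p + q = n) (h' : p + (q + 1) = n + 1) (i : ℕ) (hi : 0 < i) :
    coface (p + i) (prod h f g) = prod h' f (coface i g) := by
  subst h
  funext a
  simp only [coface, prod, faceCoef, faceArg]
  rw [mul_left_comm]
  congr 1
  · congr 1
    funext k
    simp only [Fin.cast_eq_self, Fin.val_castAdd]
    rw [if_pos (by omega)]
    rfl
  · congr 1
    · by_cases h1 : i = q + 1
      · simp only [h1]
        rw [if_neg (by omega), if_pos (by omega), if_neg (by omega), if_pos trivial]
        rfl
      · have h2 : ¬ (p + i = p + q + 1) := by omega
        have h3 : ¬ (p + i = 0) := by omega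
        have h4 : ¬ (i = 0) := by omega
        simp only [h1, h2, h3, h4, if_false]
    · congr 1
      funext k
      simp only [Fin.cast_eq_self, Fin.val_natAdd]
      have e1 : (p + k.val + 1 < p + i) ↔ (k.val + 1 < i) := by omega
      have e2 : (p + k.val + 1 = p + i) ↔ (k.val + 1 = i) := by omega
      simp only [e1, e2]
      rfl

theorem coface_middle {p q : ℕ} (f : (Fin p → R) → R) (g : (Fin q → R) → R) {n : ℕ}
    (h : p + 1 + q = n + 1) (h' : p + (q + 1) = n + 1) :
    prod h (coface (p + 1) f) g = prod h' f (coface 0 g) := by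
  obtain rfl : n = p + q := by omega
  funext a
  simp only [coface, prod, faceCoef_last, faceCoef_zero, faceArg_last, faceArg_zero]
  have e2 : (fun k : Fin q => a (Fin.cast h' (Fin.natAdd p k.succ))) =
      fun j => a (Fin.cast h (Fin.natAdd (p + 1) j)) := by
    funext k
    congr 1
    ext
    simp
    omega
  have e3 : a (Fin.cast h (Fin.castAdd q (Fin.last p))) =
      a (Fin.cast h' (Fin.natAdd p (0 : Fin (q + 1)))) := by
    congr 1
  rw [e2, e3, mul_assoc, mul_left_comm]
  rfl

theorem hochschild_prod {p q n : ℕ} (f : (Fin p → R) → R) (g : (Fin q → R) → R)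
    (h : p + q = n) (h' : p + 1 + q = n + 1) (h'' : p + (q + 1) = n + 1) :
    hochschild (prod h f g) =
      prod h' (hochschild f) g + fun a => (-1) ^ p * prod h'' f (hochschild g) a := by
  funext a
  have hl : prod h' (hochschild f) g a =
      ∑ i ∈ Finset.range (p + 2), (-1) ^ i * prod h' (coface i f) g a := by
    simp only [prod]
    rw [hochschild_eq, Finset.sum_mul]
    exact Finset.sum_congr rfl fun i _ => by ring
  have hr : prod h'' f (hochschild g) a =
      ∑ i ∈ Finset.range (q + 2), (-1) ^ i * prod h'' f (coface i g) a := by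
    simp only [prod]
    rw [hochschild_eq, Finset.mul_sum]
    exact Finset.sum_congr rfl fun i _ => by ring
  rw [Pi.add_apply, hl, hr, hochschild_eq]
  have e : n + 2 = (p + 1) + (q + 1) := by omega
  rw [e, Finset.sum_range_add, Finset.sum_range_succ _ (p + 1), Finset.sum_range_succ' _ (q + 1),
    coface_middle f g h' h'']
  have s1 : ∑ i ∈ Finset.range (p + 1), (-1) ^ i * coface i (prod h f g) a =
      ∑ i ∈ Finset.range (p + 1), (-1) ^ i * prod h' (coface i f) g a := by
    refine Finset.sum_congr rfl fun i hi => ?_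
    rw [coface_prod_left f g h h' i (by simpa [Nat.lt_succ_iff] using hi)]
  have s2 : ∑ i ∈ Finset.range (q + 1), (-1) ^ (p + 1 + i) * coface (p + 1 + i) (prod h f g) a =
      (-1) ^ p * ∑ i ∈ Finset.range (q + 1), (-1) ^ (i + 1) * prod h'' f (coface (i + 1) g) a := by
    rw [Finset.mul_sum]
    refine Finset.sum_congr rfl fun i hi => ?_
    rw [show p + 1 + i = p + (i + 1) by omega, coface_prod_right f g h h'' (i + 1) (by omega)]
    ring
  rw [s1, s2]
  ring

/-! Stability of polydifferential operators. -/

theorem comm_add (i : Fin n) (a : R) (f g : (Fin n → R) → R) :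
    comm i a (f + g) = comm i a f + comm i a g := by
  funext x; simp [comm]; ring

theorem comm_mul_const (i : Fin n) (a r : R) (f : (Fin n → R) → R) :
    comm i a (fun x => r * f x) = fun x => r * comm i a f x := by
  funext x; simp [comm]; ring

theorem OrderLE.zero (i : Fin n) (N : ℕ) : OrderLE i N (0 : (Fin n → R) → R) := by
  induction N with
  | zero => intro a; funext x; simp [comm]
  | succ N ih => intro a; rwa [show comm i a (0 : (Fin n → R) → R) = 0 by funext x; simp [comm]]

theorem OrderLE.succ {i : Fin n} {N : ℕ} {f : (Fin n → R) → R} (h : OrderLE i N f) :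
    OrderLE i (N + 1) f := by
  induction N generalizing f with
  | zero => intro a; rw [h a]; exact OrderLE.zero i 0
  | succ N ih => intro a; exact ih (h a)

theorem OrderLE.mono {i : Fin n} {N M : ℕ} (hNM : N ≤ M) {f : (Fin n → R) → R}
    (h : OrderLE i N f) : OrderLE i M f := by
  induction hNM with
  | refl => exact h
  | step _ ih => exact ih.succ

theorem OrderLE.add {i : Fin n} {N : ℕ} {f g : (Fin n → R) → R} (hf : OrderLE i N f)
    (hg : OrderLE i N g) : OrderLE i N (f + g) := by
  induction N generalizing f g with
  | zero => intro a; rw [comm_add, hf a, hg a, add_zero]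
  | succ N ih => intro a; rw [comm_add]; exact ih (hf a) (hg a)

theorem OrderLE.mul_const {i : Fin n} {N : ℕ} {f : (Fin n → R) → R} (r : R)
    (hf : OrderLE i N f) : OrderLE i N (fun x => r * f x) := by
  induction N generalizing f with
  | zero => intro a; rw [comm_mul_const, hf a]; funext x; simp
  | succ N ih => intro a; rw [comm_mul_const]; exact ih (hf a)

/-- Substitution into the `j`-th argument preserves the order. -/
theorem OrderLE.comp {m : ℕ} {i : Fin m} {j : Fin n} (c : (Fin m → R) → (Fin n → R))
    (w : (Fin m → R) → R)
    (hc : ∀ x a, c (Function.update x i (a * x i)) = Function.update (c x) j (a * c x j))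
    (hw : ∀ x a, w (Function.update x i (a * x i)) = w x)
    {N : ℕ} {f : (Fin n → R) → R} (hf : OrderLE j N f) :
    OrderLE i N (fun x => w x * f (c x)) := by
  have key : ∀ (a : R) (f : (Fin n → R) → R), comm i a (fun x => w x * f (c x)) =
      fun x => w x * comm j a f (c x) := by
    intro a f
    funext x
    simp only [comm]
    rw [hc, hw]
    ring
  induction N generalizing f with
  | zero => intro a; rw [key, hf a]; funext x; simp
  | succ N ih => intro a; rw [key]; exact ih (hf a)

theorem OrderLE.of_linear {m : ℕ} {i : Fin m} (F : (Fin m → R) → R)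
    (hF : ∀ x a, F (Function.update x i (a * x i)) = a * F x) : OrderLE i 0 F := by
  intro a
  funext x
  simp [comm, hF]

/-- The order may be checked after an injective family of ring homomorphisms. -/
theorem OrderLE.of_cover {ι : Type*} {S : ι → Type u} [∀ k, CommRing (S k)]
    (ρ : ∀ k, R →+* S k) (hρ : ∀ a b : R, (∀ k, ρ k a = ρ k b) → a = b) (i : Fin n) {N : ℕ}
    {f : (Fin n → R) → R} {g : ∀ k, (Fin n → S k) → S k}
    (hfg : ∀ k x, ρ k (f x) = g k (fun l => ρ k (x l))) (hg : ∀ k, OrderLE i N (g k)) :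
    OrderLE i N f := by
  have key : ∀ (a : R) (f : (Fin n → R) → R) (g : ∀ k, (Fin n → S k) → S k),
      (∀ k x, ρ k (f x) = g k (fun l => ρ k (x l))) →
      ∀ k x, ρ k (comm i a f x) = comm i (ρ k a) (g k) (fun l => ρ k (x l)) := by
    intro a f g hfg k x
    simp only [comm, map_sub, map_mul, hfg]
    congr 2
    funext l
    by_cases h : l = i
    · subst h; simp
    · simp [h]
  induction N generalizing f g with
  | zero =>
    intro a
    funext x
    refine hρ _ _ fun k => ?_
    rw [key a f g hfg, hg k]
    simp
  | succ N ih => intro a; exact ih (key a f g hfg) (fun k => hg k (ρ k a))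

section

variable {K : Type u} [CommRing K] {κ : K →+* R}

theorem IsMultilinear.add {f g : (Fin n → R) → R} (hf : IsMultilinear κ f)
    (hg : IsMultilinear κ g) : IsMultilinear κ (f + g) :=
  ⟨fun x i a b => by simp only [Pi.add_apply, hf.1, hg.1]; ring,
    fun x i c a => by simp only [Pi.add_apply, hf.2, hg.2]; ring⟩

theorem IsMultilinear.mul_const {f : (Fin n → R) → R} (r : R) (hf : IsMultilinear κ f) :
    IsMultilinear κ (fun x => r * f x) :=
  ⟨fun x i a b => by simp only [hf.1]; ring, fun x i c a => by simp only [hf.2]; ring⟩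

theorem IsPolyDiff.zero : IsPolyDiff κ (0 : (Fin n → R) → R) :=
  ⟨⟨fun _ _ _ _ => by simp, fun _ _ _ _ => by simp⟩, 0, fun i => OrderLE.zero i 0⟩

theorem IsPolyDiff.add {f g : (Fin n → R) → R} (hf : IsPolyDiff κ f) (hg : IsPolyDiff κ g) :
    IsPolyDiff κ (f + g) := by
  obtain ⟨hf, N, hN⟩ := hf
  obtain ⟨hg, M, hM⟩ := hg
  exact ⟨hf.add hg, max N M, fun i =>
    ((hN i).mono (le_max_left _ _)).add ((hM i).mono (le_max_right _ _))⟩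

theorem IsPolyDiff.mul_const {f : (Fin n → R) → R} (r : R) (hf : IsPolyDiff κ f) :
    IsPolyDiff κ (fun x => r * f x) := by
  obtain ⟨hf, N, hN⟩ := hf
  exact ⟨hf.mul_const r, N, fun i => (hN i).mul_const r⟩

theorem IsPolyDiff.neg {f : (Fin n → R) → R} (hf : IsPolyDiff κ f) : IsPolyDiff κ (-f) := by
  have := hf.mul_const (-1)
  rwa [show (fun x => -1 * f x) = -f by funext x; simp] at this

theorem IsPolyDiff.sum {ι : Type*} (s : Finset ι) (f : ι → (Fin n → R) → R)
    (hf : ∀ i ∈ s, IsPolyDiff κ (f i)) : IsPolyDiff κ (∑ i ∈ s, f i) := by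
  classical
  induction s using Finset.induction_on with
  | empty => simpa using IsPolyDiff.zero
  | insert a s ha ih =>
    rw [Finset.sum_insert ha]
    exact (hf a (by simp)).add (ih fun i hi => hf i (by simp [hi]))

theorem prod_update_left {R : Type u} {p q : ℕ} (x : Fin (p + q) → R) (i : Fin p) (v : R) :
    (fun k => Function.update x (Fin.castAdd q i) v (Fin.castAdd q k)) =
      Function.update (fun k => x (Fin.castAdd q k)) i v ∧
    (fun k => Function.update x (Fin.castAdd q i) v (Fin.natAdd p k)) =
      fun k => x (Fin.natAdd p k) := by
  constructor
  · funext k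
    by_cases h : k = i
    · subst h; simp
    · have : Fin.castAdd q k ≠ Fin.castAdd q i := fun e => h (Fin.castAdd_injective _ _ e)
      simp [h]
  · funext k
    have : Fin.natAdd p k ≠ Fin.castAdd q i := by
      intro e
      have := congrArg Fin.val e
      simp at this
      omega
    simp [this]

theorem prod_update_right {R : Type u} {p q : ℕ} (x : Fin (p + q) → R) (i : Fin q) (v : R) :
    (fun k => Function.update x (Fin.natAdd p i) v (Fin.natAdd p k)) =
      Function.update (fun k => x (Fin.natAdd p k)) i v ∧
    (fun k => Function.update x (Fin.natAdd p i) v (Fin.castAdd q k)) =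
      fun k => x (Fin.castAdd q k) := by
  constructor
  · funext k
    by_cases h : k = i
    · subst h; simp
    · have : Fin.natAdd p k ≠ Fin.natAdd p i := fun e => h (Fin.natAdd_injective _ _ e)
      simp [h]
  · funext k
    have : Fin.castAdd q k ≠ Fin.natAdd p i := by
      intro e
      have := congrArg Fin.val e
      simp at this
      omega
    simp [this]

theorem IsPolyDiff.prod {p q n : ℕ} (h : p + q = n) {f : (Fin p → R) → R}
    {g : (Fin q → R) → R} (hf : IsPolyDiff κ f) (hg : IsPolyDiff κ g) :
    IsPolyDiff κ (prod h f g) := by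
  subst h
  obtain ⟨hf, N, hN⟩ := hf
  obtain ⟨hg, M, hM⟩ := hg
  refine ⟨⟨fun x i a b => ?_, fun x i c a => ?_⟩, max N M, fun i => ?_⟩
  · simp only [PolyDiff.prod, Fin.cast_eq_self]
    refine Fin.addCases (fun i => ?_) (fun i => ?_) i
    · simp only [(prod_update_left x i _).1, (prod_update_left x i _).2, hf.1]; ring
    · simp only [(prod_update_right x i _).1, (prod_update_right x i _).2, hg.1]; ring
  · simp only [PolyDiff.prod, Fin.cast_eq_self]
    refine Fin.addCases (fun i => ?_) (fun i => ?_) i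
    · simp only [(prod_update_left x i _).1, (prod_update_left x i _).2, hf.2]; ring
    · simp only [(prod_update_right x i _).1, (prod_update_right x i _).2, hg.2]; ring
  · refine Fin.addCases (fun i => ?_) (fun i => ?_) i
    · have := OrderLE.comp (i := Fin.castAdd q i) (j := i)
        (fun x : Fin (p + q) → R => fun k => x (Fin.castAdd q k))
        (fun x => g fun k => x (Fin.natAdd p k)) (fun x a => (prod_update_left x i _).1)
        (fun x a => by simp only [(prod_update_left x i _).2])
        ((hN i).mono (le_max_left N M))
      convert this using 2
      exact mul_comm _ _
    · exact OrderLE.comp (i := Fin.natAdd p i) (j := i)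
        (fun x : Fin (p + q) → R => fun k => x (Fin.natAdd p k))
        (fun x => f fun k => x (Fin.castAdd q k)) (fun x a => (prod_update_right x i _).1)
        (fun x a => by simp only [(prod_update_right x i _).2])
        ((hM i).mono (le_max_right N M))

theorem isPolyDiff_id : IsPolyDiff κ (fun x : Fin 1 → R => x 0) := by
  refine ⟨⟨fun x i a b => ?_, fun x i c a => ?_⟩, 0, fun i => OrderLE.of_linear _ fun x a => ?_⟩
  all_goals
    obtain rfl : i = 0 := Subsingleton.elim _ _
    simp

/-- The argument of `f` in which the `i`-th variable occurs after two variables are merged. -/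
theorem faceArg_update (j : ℕ) (hj : 0 < j) (hjn : j ≤ n) (i : Fin (n + 1)) :
    ∃ k : Fin n, ∀ x : Fin (n + 1) → R, ∃ w : R, (∀ v : R,
      faceArg j (Function.update x i v) = Function.update (faceArg j x) k (v * w)) ∧
      faceArg j x k = x i * w := by
  rcases lt_trichotomy i.val j with h | h | h
  · by_cases h' : i.val + 1 = j
    · refine ⟨⟨i.val, by omega⟩, fun x => ⟨x ⟨j, by omega⟩, fun v => ?_, ?_⟩⟩
      · funext l
        simp only [faceArg, Function.update_apply, Fin.ext_iff, Fin.val_castSucc, Fin.val_succ]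
        split_ifs <;> first | omega | rfl | skip
        congr 2
        ext; simp; omega
      · simp only [faceArg]
        rw [if_neg (by omega), if_pos h']
        congr 2
        ext; simp; omega
    · refine ⟨⟨i.val, by omega⟩, fun x => ⟨1, fun v => ?_, ?_⟩⟩
      · funext l
        simp only [faceArg, Function.update_apply, Fin.ext_iff, Fin.val_castSucc, Fin.val_succ]
        split_ifs <;> first | omega | simp
      · simp only [faceArg]
        rw [if_pos (by omega), mul_one]
        rfl
  · refine ⟨⟨j - 1, by omega⟩, fun x => ⟨x ⟨j - 1, by omega⟩, fun v => ?_, ?_⟩⟩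
    · funext l
      simp only [faceArg, Function.update_apply, Fin.ext_iff, Fin.val_castSucc, Fin.val_succ]
      split_ifs <;> first | omega | rfl | skip
      rw [mul_comm]
      congr 2
      ext; simp; omega
    · simp only [faceArg]
      rw [if_neg (by omega), if_pos (by omega), mul_comm]
      congr 2
      ext; simp; omega
  · refine ⟨⟨i.val - 1, by omega⟩, fun x => ⟨1, fun v => ?_, ?_⟩⟩
    · funext l
      simp only [faceArg, Function.update_apply, Fin.ext_iff, Fin.val_castSucc, Fin.val_succ]
      split_ifs <;> first | omega | simp
    · simp only [faceArg]
      rw [if_neg (by omega), if_neg (by omega), mul_one]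
      congr 1
      ext; simp; omega

theorem IsPolyDiff.faceArg {f : (Fin n → R) → R} (hf : IsPolyDiff κ f) (j : ℕ) (hj : 0 < j)
    (hjn : j ≤ n) : IsPolyDiff κ (fun a => f (faceArg j a)) := by
  obtain ⟨hf, N, hN⟩ := hf
  refine ⟨⟨fun x i a b => ?_, fun x i c a => ?_⟩, N, fun i => ?_⟩
  · obtain ⟨k, hk⟩ := faceArg_update (R := R) j hj hjn i
    obtain ⟨w, hw, -⟩ := hk x
    simp only [hw, add_mul, hf.1]
  · obtain ⟨k, hk⟩ := faceArg_update (R := R) j hj hjn i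
    obtain ⟨w, hw, -⟩ := hk x
    simp only [hw, mul_assoc, hf.2]
  · obtain ⟨k, hk⟩ := faceArg_update (R := R) j hj hjn i
    have := OrderLE.comp (i := i) (j := k) (PolyDiff.faceArg j) (fun _ => 1) (fun x a => by
      obtain ⟨w, hw, hw'⟩ := hk x
      rw [hw, hw', mul_assoc]) (fun _ _ => rfl) (hN k)
    simpa using this

theorem IsPolyDiff.coface {f : (Fin n → R) → R} (hf : IsPolyDiff κ f) (j : ℕ) (hj : j ≤ n + 1) :
    IsPolyDiff κ (coface j f) := by
  by_cases h0 : j = 0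
  · subst h0
    have e : PolyDiff.coface 0 f =
        PolyDiff.prod (Nat.add_comm 1 n) (fun x : Fin 1 → R => x 0) f := by
      funext a
      simp only [PolyDiff.coface, PolyDiff.prod, faceCoef_zero, faceArg_zero]
      congr 2
      funext k
      congr 1
      ext; simp
    rw [e]
    exact isPolyDiff_id.prod _ hf
  · by_cases h1 : j = n + 1
    · subst h1
      have e : PolyDiff.coface (n + 1) f =
          PolyDiff.prod rfl f (fun x : Fin 1 → R => x 0) := by
        funext a
        simp only [PolyDiff.coface, PolyDiff.prod, faceCoef_last, faceArg_last]
        rw [mul_comm]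
        rfl
      rw [e]
      exact hf.prod _ isPolyDiff_id
    · have e : PolyDiff.coface j f = fun a => f (PolyDiff.faceArg j a) := by
        funext a
        simp [PolyDiff.coface, faceCoef, h0, h1]
      rw [e]
      exact hf.faceArg j (by omega) (by omega)

theorem IsPolyDiff.hochschild {f : (Fin n → R) → R} (hf : IsPolyDiff κ f) :
    IsPolyDiff κ (hochschild f) := by
  have e : PolyDiff.hochschild f =
      ∑ i ∈ Finset.range (n + 2), fun a => (-1) ^ i * PolyDiff.coface i f a := by
    funext a
    rw [hochschild_eq, Finset.sum_apply]
  rw [e]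
  refine IsPolyDiff.sum _ _ fun i hi => (hf.coface i ?_).mul_const _
  have := Finset.mem_range.1 hi
  omega

end

end Ring

section Ring

variable {R : Type u} [CommRing R] {n : ℕ}

theorem hochschild_add (f g : (Fin n → R) → R) (a : Fin (n + 1) → R) :
    hochschild (f + g) a = hochschild f a + hochschild g a := by
  simp only [hochschild, Pi.add_apply, mul_add, add_mul, Finset.sum_add_distrib]
  ring

theorem hochschild_mul_const (r : R) (f : (Fin n → R) → R) (a : Fin (n + 1) → R) :
    hochschild (fun x => r * f x) a = r * hochschild f a := by
  simp only [hochschild_eq, Finset.mul_sum, coface]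
  exact Finset.sum_congr rfl fun i _ => by ring

theorem prod_assoc {p q r s t n : ℕ} (h₁ : p + q = s) (h₂ : q + r = t) (h₃ : s + r = n)
    (h₄ : p + t = n) (f : (Fin p → R) → R) (g : (Fin q → R) → R) (k : (Fin r → R) → R) :
    prod h₃ (prod h₁ f g) k = prod h₄ f (prod h₂ g k) := by
  subst h₁ h₂ h₃
  funext a
  simp only [prod]
  rw [_root_.mul_assoc]
  congr 3
  funext i
  congr 1
  ext
  simp
  omega

theorem one_prod {p : ℕ} (h : 0 + p = p) (f : (Fin p → R) → R) :
    prod h (fun _ : Fin 0 → R => 1) f = f := by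
  funext a
  simp only [prod]
  rw [_root_.one_mul]
  congr 1
  funext i
  congr 1
  ext
  simp

theorem prod_one {p : ℕ} (f : (Fin p → R) → R) :
    prod (Nat.add_zero p) f (fun _ : Fin 0 → R => 1) = f := by
  funext a
  simp only [prod]
  rw [_root_.mul_one]
  rfl

end Ring

/-! ### Algebras and Lie algebras in complexes of sheaves of modules -/

section Graded

variable {X : Scheme.{u}}

/-- An `𝒪_X`-bilinear map of sheaves `M × N → P`. By the universal property of the tensor product
of sheaves of modules, this is the same as a morphism `M ⊗ N ⟶ P` of `𝒪_X`-modules. -/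
structure Bilin (M N P : X.Modules) where
  app (U : X.Opens) : Γ(M, U) →ₗ[Γ(X, U)] Γ(N, U) →ₗ[Γ(X, U)] Γ(P, U)
  map_app {U V : X.Opens} (i : V ⟶ U) (x : Γ(M, U)) (y : Γ(N, U)) :
    P.presheaf.map i.op (app U x y) = app V (M.presheaf.map i.op x) (N.presheaf.map i.op y)

/-- A graded (unital, associative) algebra in `𝒪_X`-modules. -/
structure GradedAlg (M : ℤ → X.Modules) where
  mul (p q n : ℤ) (h : p + q = n) : Bilin (M p) (M q) (M n)
  one : Γ(M 0, ⊤)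
  mul_assoc (p q r s t n : ℤ) (h₁ : p + q = s) (h₂ : q + r = t) (h₃ : s + r = n) (h₄ : p + t = n)
    (U : X.Opens) (x : Γ(M p, U)) (y : Γ(M q, U)) (z : Γ(M r, U)) :
    (mul s r n h₃).app U ((mul p q s h₁).app U x y) z =
      (mul p t n h₄).app U x ((mul q r t h₂).app U y z)
  one_mul (p : ℤ) (U : X.Opens) (x : Γ(M p, U)) :
    (mul 0 p p (zero_add p)).app U ((M 0).presheaf.map (homOfLE le_top).op one) x = x
  mul_one (p : ℤ) (U : X.Opens) (x : Γ(M p, U)) :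
    (mul p 0 p (add_zero p)).app U x ((M 0).presheaf.map (homOfLE le_top).op one) = x

/-- A graded Lie algebra in `𝒪_X`-modules, with the Koszul sign rule. -/
structure GradedLie (M : ℤ → X.Modules) where
  bracket (p q n : ℤ) (h : p + q = n) : Bilin (M p) (M q) (M n)
  skew (p q n : ℤ) (h : p + q = n) (h' : q + p = n) (U : X.Opens)
    (x : Γ(M p, U)) (y : Γ(M q, U)) :
    (bracket p q n h).app U x y = -((p * q).negOnePow • (bracket q p n h').app U y x)
  jacobi (p q r s t v n : ℤ) (h₁ : p + q = s) (h₂ : q + r = t) (h₃ : p + r = v)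
    (h₄ : s + r = n) (h₅ : p + t = n) (h₆ : q + v = n)
    (U : X.Opens) (x : Γ(M p, U)) (y : Γ(M q, U)) (z : Γ(M r, U)) :
    (bracket p t n h₅).app U x ((bracket q r t h₂).app U y z) =
      (bracket s r n h₄).app U ((bracket p q s h₁).app U x y) z +
        (p * q).negOnePow • (bracket q v n h₆).app U y ((bracket p r v h₃).app U x z)

/-- The graded commutator `[x, y] = x y - (-1)^{|x||y|} y x`. -/
noncomputable def GradedAlg.commutator {M : ℤ → X.Modules} (A : GradedAlg M) (p q n : ℤ) (h : p + q = n) :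
    Bilin (M p) (M q) (M n) where
  app U := (A.mul p q n h).app U -
    (p * q).negOnePow • ((A.mul q p n (by omega)).app U).flip
  map_app i x y := by
    simp [Units.smul_def, (A.mul _ _ _ _).map_app]

theorem GradedAlg.commutator_app {M : ℤ → X.Modules} (A : GradedAlg M) (p q n : ℤ)
    (h : p + q = n) (h' : q + p = n) (U : X.Opens) (x : Γ(M p, U)) (y : Γ(M q, U)) :
    (A.commutator p q n h).app U x y = (A.mul p q n h).app U x y -
      (p * q).negOnePow • (A.mul q p n h').app U y x := rfl

/-- The graded Lie algebra of a graded algebra, with the graded commutator as bracket. -/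
noncomputable def GradedAlg.toGradedLie {M : ℤ → X.Modules} (A : GradedAlg M) : GradedLie M where
  bracket := A.commutator
  skew p q n h h' U x y := by
    rw [A.commutator_app p q n h h', A.commutator_app q p n h' h, mul_comm q p]
    rcases Int.units_eq_one_or (p * q).negOnePow with e | e <;> simp [e]
  jacobi p q r s t v n h₁ h₂ h₃ h₄ h₅ h₆ U x y z := by
    have k1 : q + p = s := by omega
    have k2 : r + q = t := by omega
    have k3 : r + p = v := by omega
    have k4 : r + s = n := by omega
    have k5 : t + p = n := by omega
    have k6 : v + q = n := by omega
    rw [A.commutator_app p t n h₅ k5, A.commutator_app q r t h₂ k2,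
      A.commutator_app s r n h₄ k4, A.commutator_app p q s h₁ k1,
      A.commutator_app q v n h₆ k6, A.commutator_app p r v h₃ k3]
    have e1 : (p * t).negOnePow = (p * q).negOnePow * (p * r).negOnePow := by
      rw [← h₂, mul_add, Int.negOnePow_add]
    have e2 : (s * r).negOnePow = (p * r).negOnePow * (q * r).negOnePow := by
      rw [← h₁, add_mul, Int.negOnePow_add]
    have e3 : (q * v).negOnePow = (p * q).negOnePow * (q * r).negOnePow := by
      rw [← h₃, mul_add, Int.negOnePow_add, mul_comm q p]
    rw [e1, e2, e3]
    have a1 := A.mul_assoc p q r s t n h₁ h₂ h₄ h₅ U x y z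
    have a2 := A.mul_assoc p r q v t n h₃ k2 k6 h₅ U x z y
    have a3 := A.mul_assoc q r p t v n h₂ k3 k5 h₆ U y z x
    have a4 := A.mul_assoc r q p t s n k2 k1 k5 k4 U z y x
    have a5 := A.mul_assoc q p r s v n k1 h₃ h₄ h₆ U y x z
    have a6 := A.mul_assoc r p q v s n k3 h₁ k6 k4 U z x y
    rcases Int.units_eq_one_or (p * q).negOnePow with e | e <;>
    rcases Int.units_eq_one_or (p * r).negOnePow with e' | e' <;>
    rcases Int.units_eq_one_or (q * r).negOnePow with e'' | e'' <;>
    simp [e, e', e'', a1, a2, a3, a4, a5, a6] <;> abel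

/-- Morphisms of graded Lie algebras. -/
def IsGradedLieHom {M N : ℤ → X.Modules} (B : GradedLie M) (C : GradedLie N)
    (f : ∀ n, M n ⟶ N n) : Prop :=
  ∀ (p q n : ℤ) (h : p + q = n) (U : X.Opens) (x : Γ(M p, U)) (y : Γ(M q, U)),
    (f n).app U ((B.bracket p q n h).app U x y) =
      (C.bracket p q n h).app U ((f p).app U x) ((f q).app U y)

/-- `B` is the free graded Lie algebra over `𝒪_X` on the `𝒪_X`-module `E` placed in degree one,
with universal map `φ`. -/
def IsFreeGradedLie {M : ℤ → X.Modules} (B : GradedLie M) {E : X.Modules} (φ : E ⟶ M 1) : Prop :=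
  ∀ (N : ℤ → X.Modules) (C : GradedLie N) (ψ : E ⟶ N 1),
    ∃! f : ∀ n, M n ⟶ N n, IsGradedLieHom B C f ∧ φ ≫ f 1 = ψ

variable (X) in
/-- An algebra in the category of bounded below complexes of `𝒪_X`-modules: the multiplication
`A ⊗ A ⟶ A` is given by its components, and the Leibniz rule says that it is
a morphism of complexes. -/
structure DGAlg where
  cx : CochainComplex.Plus X.Modules
  alg : GradedAlg cx.obj.X
  d_one : (cx.obj.d 0 1).app ⊤ alg.one = 0
  leibniz (p q n p' q' n' : ℤ) (h : p + q = n) (hp : p + 1 = p') (hq : q + 1 = q') (hn : n + 1 = n')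
    (U : X.Opens) (x : Γ(cx.obj.X p, U)) (y : Γ(cx.obj.X q, U)) :
    (cx.obj.d n n').app U ((alg.mul p q n h).app U x y) =
      (alg.mul p' q n' (by omega)).app U ((cx.obj.d p p').app U x) y +
        p.negOnePow • (alg.mul p q' n' (by omega)).app U x ((cx.obj.d q q').app U y)

variable (X) in
/-- A Lie algebra in the category of bounded below complexes of `𝒪_X`-modules. -/
structure DGLie where
  cx : CochainComplex.Plus X.Modules
  lie : GradedLie cx.obj.X
  leibniz (p q n p' q' n' : ℤ) (h : p + q = n) (hp : p + 1 = p') (hq : q + 1 = q') (hn : n + 1 = n')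
    (U : X.Opens) (x : Γ(cx.obj.X p, U)) (y : Γ(cx.obj.X q, U)) :
    (cx.obj.d n n').app U ((lie.bracket p q n h).app U x y) =
      (lie.bracket p' q n' (by omega)).app U ((cx.obj.d p p').app U x) y +
        p.negOnePow • (lie.bracket p q' n' (by omega)).app U x ((cx.obj.d q q').app U y)

/-- The Lie algebra of an algebra in bounded below complexes. -/
noncomputable def DGAlg.toDGLie (A : DGAlg X) : DGLie X where
  cx := A.cx
  lie := A.alg.toGradedLie
  leibniz p q n p' q' n' h hp hq hn U x y := by
    change ((A.cx.obj.d n n').app U) ((A.alg.commutator p q n h).app U x y) =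
      (A.alg.commutator p' q n' _).app U _ y +
        p.negOnePow • (A.alg.commutator p q' n' _).app U x _
    rw [A.alg.commutator_app p q n h (by omega), A.alg.commutator_app p' q n' (by omega) (by omega),
      A.alg.commutator_app p q' n' (by omega) (by omega), map_sub, Units.smul_def, map_zsmul,
      ← Units.smul_def,
      A.leibniz p q n p' q' n' h hp hq hn, A.leibniz q p n q' p' n' (by omega) hq hp hn]
    have e1 : (p' * q).negOnePow = (p * q).negOnePow * q.negOnePow := by
      rw [← hp, add_mul, one_mul, Int.negOnePow_add]
    have e2 : (p * q').negOnePow = (p * q).negOnePow * p.negOnePow := by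
      rw [← hq, mul_add, mul_one, Int.negOnePow_add]
    rw [e1, e2]
    rcases Int.units_eq_one_or (p * q).negOnePow with e | e <;>
    rcases Int.units_eq_one_or p.negOnePow with e' | e' <;>
    rcases Int.units_eq_one_or q.negOnePow with e'' | e'' <;>
    simp [e, e', e''] <;> abel

/-- Morphisms of algebras in bounded below complexes. -/
def IsAlgHom (A B : DGAlg X) (f : A.cx ⟶ B.cx) : Prop :=
  (f.hom.f 0).app ⊤ A.alg.one = B.alg.one ∧
  ∀ (p q n : ℤ) (h : p + q = n) (U : X.Opens) (x : Γ(A.cx.obj.X p, U)) (y : Γ(A.cx.obj.X q, U)),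
    (f.hom.f n).app U ((A.alg.mul p q n h).app U x y) =
      (B.alg.mul p q n h).app U ((f.hom.f p).app U x) ((f.hom.f q).app U y)

/-- Morphisms of Lie algebras in bounded below complexes. -/
def IsLieHom (L L' : DGLie X) (f : L.cx ⟶ L'.cx) : Prop :=
  IsGradedLieHom L.lie L'.lie f.hom.f

/-- `A`, with the morphism `i`, is the universal enveloping algebra of the Lie algebra `L` in the
category of bounded below complexes of `𝒪_X`-modules. -/
def IsUniversalEnveloping (L : DGLie X) (A : DGAlg X) (i : L.cx ⟶ A.cx) : Prop :=
  IsLieHom L A.toDGLie i ∧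
  ∀ (B : DGAlg X) (f : L.cx ⟶ B.cx), IsLieHom L B.toDGLie f →
    ∃! g : A.cx ⟶ B.cx, IsAlgHom A B g ∧ i ≫ g = f

end Graded

/-! ### Construction of sheaves of modules, and generated Lie subalgebras -/

section Build

variable {X : Scheme.{u}}

/-- Data from which a sheaf of `𝒪_X`-modules is built. -/
structure ModData (X : Scheme.{u}) where
  sec : X.Opens → Type u
  [grp : ∀ U, AddCommGroup (sec U)]
  [mod : ∀ U, Module Γ(X, U) (sec U)]
  res {U V : X.Opens} : V ≤ U → (sec U →+ sec V)
  res_id (U : X.Opens) (x : sec U) : res le_rfl x = x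
  res_res {U V W : X.Opens} (h : V ≤ U) (h' : W ≤ V) (x : sec U) :
    res h' (res h x) = res (h'.trans h) x
  res_smul {U V : X.Opens} (h : V ≤ U) (r : Γ(X, U)) (x : sec U) :
    res h (r • x) = X.presheaf.map (homOfLE h).op r • res h x
  glue {ι : Type u} (U : ι → X.Opens) (s : ∀ i, sec (U i))
    (hs : ∀ i j, res (inf_le_left : U i ⊓ U j ≤ U i) (s i) =
      res (inf_le_right : U i ⊓ U j ≤ U j) (s j)) :
    ∃! t : sec (iSup U), ∀ i, res (le_iSup U i) t = s i

namespace ModData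

variable (D : ModData X)

instance (U : X.Opens) : AddCommGroup (D.sec U) := D.grp U
instance (U : X.Opens) : Module Γ(X, U) (D.sec U) := D.mod U

/-- The underlying presheaf of abelian groups. -/
def toPresheaf : X.Opensᵒᵖ ⥤ Ab.{u} where
  obj U := AddCommGrpCat.of (D.sec U.unop)
  map i := AddCommGrpCat.ofHom (D.res i.unop.le)
  map_id U := by ext x; exact D.res_id _ x
  map_comp i j := by ext x; exact (D.res_res i.unop.le j.unop.le x).symm

instance (U : X.Opensᵒᵖ) : Module (X.ringCatSheaf.obj.obj U) (D.toPresheaf.obj U) :=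
  D.mod U.unop

/-- The sheaf of `𝒪_X`-modules with the given sections. -/
noncomputable def toModules : X.Modules where
  val := PresheafOfModules.ofPresheaf (R := X.ringCatSheaf.obj) D.toPresheaf
    (fun _ _ i r m => D.res_smul i.unop.le r m)
  isSheaf := (TopCat.Presheaf.isSheaf_iff_isSheafUniqueGluing D.toPresheaf).2
    (fun _ U s hs => D.glue U s hs)

/-- The identification of the sections of `toModules`. -/
noncomputable def equiv (U : X.Opens) : Γ(D.toModules, U) ≃ₗ[Γ(X, U)] D.sec U :=
  LinearEquiv.refl Γ(X, U) (D.sec U)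

theorem equiv_res {U V : X.Opens} (i : V ⟶ U) (x : Γ(D.toModules, U)) :
    D.equiv V (D.toModules.presheaf.map i.op x) = D.res i.le (D.equiv U x) := rfl

end ModData

/-- A morphism of `𝒪_X`-modules from its action on sections. -/
noncomputable def homMk {M N : X.Modules} (f : ∀ U : X.Opens, Γ(M, U) →ₗ[Γ(X, U)] Γ(N, U))
    (hf : ∀ {U V : X.Opens} (i : V ⟶ U) (x : Γ(M, U)),
      N.presheaf.map i.op (f U x) = f V (M.presheaf.map i.op x)) : M ⟶ N :=
  ⟨PresheafOfModules.homMk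
    { app := fun U => AddCommGrpCat.ofHom (f U.unop).toAddMonoidHom
      naturality := fun U V i => by ext x; exact (hf i.unop x).symm }
    (fun U r m => (f U.unop).map_smul r m)⟩

theorem homMk_app {M N : X.Modules} (f : ∀ U : X.Opens, Γ(M, U) →ₗ[Γ(X, U)] Γ(N, U))
    (hf : ∀ {U V : X.Opens} (i : V ⟶ U) (x : Γ(M, U)),
      N.presheaf.map i.op (f U x) = f V (M.presheaf.map i.op x)) (U : X.Opens) (x : Γ(M, U)) :
    (homMk f hf).app U x = f U x := rfl

theorem isZero_of_sections (M : X.Modules) (h : ∀ (U : X.Opens) (x : Γ(M, U)), x = 0) :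
    Limits.IsZero M := by
  rw [Limits.IsZero.iff_id_eq_zero]
  refine Scheme.Modules.hom_ext _ _ fun U => ?_
  ext x
  rw [h U x]
  simp

theorem sections_eq_zero {M : X.Modules} (h : Limits.IsZero M) (U : X.Opens) (x : Γ(M, U)) :
    x = 0 := by
  have := (Limits.IsZero.iff_id_eq_zero M).1 h
  have h2 : (𝟙 M : M ⟶ M).app U x = (0 : M ⟶ M).app U x := by rw [this]
  simpa using h2

/-- The subsheaf of `M` given by a family of submodules that is stable under restriction and
local. -/
noncomputable def subData (M : X.Modules) (S : ∀ U : X.Opens, Submodule Γ(X, U) Γ(M, U))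
    (hres : ∀ {U V : X.Opens} (i : V ⟶ U) (x : Γ(M, U)), x ∈ S U → M.presheaf.map i.op x ∈ S V)
    (hloc : ∀ {U : X.Opens} (x : Γ(M, U)),
      (∀ P ∈ U, ∃ (V : X.Opens) (i : V ⟶ U), P ∈ V ∧ M.presheaf.map i.op x ∈ S V) → x ∈ S U) :
    ModData X where
  sec U := S U
  res {U V} h :=
    { toFun := fun x => ⟨M.presheaf.map (homOfLE h).op x.1, hres _ _ x.2⟩
      map_zero' := by ext; simp
      map_add' := fun x y => by ext; simp }
  res_id U x := by
    ext
    change M.presheaf.map (𝟙 (op U)) x.1 = x.1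
    simp
  res_res {U V W} h h' x := by
    ext
    change M.presheaf.map (homOfLE h').op (M.presheaf.map (homOfLE h).op x.1) =
      M.presheaf.map (homOfLE (h'.trans h)).op x.1
    rw [← ConcreteCategory.comp_apply, ← M.presheaf.map_comp]
    rfl
  res_smul {U V} h r x := by
    ext
    exact M.map_smul (homOfLE h) r x.1
  glue {ι} U s hs := by
    have hs' : TopCat.Presheaf.IsCompatible M.presheaf U (fun i => (s i).1) := fun i j =>
      congrArg Subtype.val (hs i j)
    obtain ⟨t, ht, htu⟩ := M.isSheaf.isSheafUniqueGluing U (fun i => (s i).1) hs'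
    refine ⟨⟨t, hloc t fun P hP => ?_⟩, fun i => Subtype.ext (ht i), fun t' ht' => ?_⟩
    · obtain ⟨i, hi⟩ := Opens.mem_iSup.1 hP
      refine ⟨U i, Opens.leSupr U i, hi, ?_⟩
      rw [ht i]
      exact (s i).2
    · exact Subtype.ext (htu t'.1 fun i => congrArg Subtype.val (ht' i))

end Build

section Lie

variable {X : Scheme.{u}} {M : ℤ → X.Modules} (B : GradedLie M)

/-- The sections of `M` over `U` that are obtained from sections of `M 1` over `U` by brackets and
`𝒪(U)`-linear combinations. -/
inductive LieGen (U : X.Opens) : (n : ℤ) → Γ(M n, U) → Prop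
  | gen (x : Γ(M 1, U)) : LieGen U 1 x
  | zero (n : ℤ) : LieGen U n 0
  | add {n : ℤ} {x y : Γ(M n, U)} : LieGen U n x → LieGen U n y → LieGen U n (x + y)
  | smul {n : ℤ} (r : Γ(X, U)) {x : Γ(M n, U)} : LieGen U n x → LieGen U n (r • x)
  | bracket {p q n : ℤ} (h : p + q = n) {x : Γ(M p, U)} {y : Γ(M q, U)} :
      LieGen U p x → LieGen U q y → LieGen U n ((B.bracket p q n h).app U x y)

variable {B} in
theorem LieGen.res {U V : X.Opens} (i : V ⟶ U) {n : ℤ} {x : Γ(M n, U)} (hx : LieGen B U n x) :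
    LieGen B V n ((M n).presheaf.map i.op x) := by
  induction hx with
  | gen x => exact .gen _
  | zero n => rw [map_zero]; exact .zero n
  | add _ _ h1 h2 => rw [map_add]; exact .add h1 h2
  | smul r _ h => rw [Scheme.Modules.map_smul]; exact .smul _ h
  | bracket h _ _ h1 h2 => rw [Bilin.map_app]; exact .bracket h h1 h2

theorem res_res_apply (N : X.Modules) {U V W : X.Opens} (i : V ⟶ U) (j : W ⟶ V) (x : Γ(N, U)) :
    N.presheaf.map j.op (N.presheaf.map i.op x) = N.presheaf.map (j ≫ i).op x := by
  rw [← ConcreteCategory.comp_apply, ← N.presheaf.map_comp]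
  rfl

/-- Any two local conditions at a point can be tested on a common neighbourhood. -/
theorem exists_common {U V W : X.Opens} (i : V ⟶ U) (j : W ⟶ U) {P : X} (hV : P ∈ V)
    (hW : P ∈ W) : ∃ (Z : X.Opens) (a : Z ⟶ V) (b : Z ⟶ W), P ∈ Z ∧ a ≫ i = b ≫ j :=
  ⟨V ⊓ W, homOfLE inf_le_left, homOfLE inf_le_right, ⟨hV, hW⟩, rfl⟩

/-- The degree `n` part of the graded Lie subalgebra generated by `M 1`: the sections of `M n` that
locally are `𝒪`-linear combinations of iterated brackets of sections of `M 1`. -/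
def lieSub (n : ℤ) (U : X.Opens) : Submodule Γ(X, U) Γ(M n, U) where
  carrier := {x | ∀ P ∈ U, ∃ (V : X.Opens) (i : V ⟶ U), P ∈ V ∧
    LieGen B V n ((M n).presheaf.map i.op x)}
  zero_mem' P hP := ⟨U, 𝟙 U, hP, by rw [map_zero]; exact .zero n⟩
  add_mem' {x y} hx hy P hP := by
    obtain ⟨V, i, hV, h1⟩ := hx P hP
    obtain ⟨W, j, hW, h2⟩ := hy P hP
    obtain ⟨Z, a, b, hZ, e⟩ := exists_common i j hV hW
    refine ⟨Z, a ≫ i, hZ, ?_⟩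
    rw [map_add]
    refine .add ?_ ?_
    · rw [← res_res_apply]; exact h1.res a
    · rw [e, ← res_res_apply]; exact h2.res b
  smul_mem' r x hx P hP := by
    obtain ⟨V, i, hV, h1⟩ := hx P hP
    refine ⟨V, i, hV, ?_⟩
    rw [Scheme.Modules.map_smul]
    exact .smul _ h1

theorem lieSub_res {n : ℤ} {U V : X.Opens} (i : V ⟶ U) (x : Γ(M n, U)) (hx : x ∈ lieSub B n U) :
    (M n).presheaf.map i.op x ∈ lieSub B n V := by
  intro P hP
  obtain ⟨W, j, hW, h⟩ := hx P (i.le hP)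
  obtain ⟨Z, a, b, hZ, e⟩ := exists_common i j hP hW
  refine ⟨Z, a, hZ, ?_⟩
  rw [res_res_apply, e, ← res_res_apply]
  exact h.res b

theorem lieSub_loc {n : ℤ} {U : X.Opens} (x : Γ(M n, U))
    (h : ∀ P ∈ U, ∃ (V : X.Opens) (i : V ⟶ U), P ∈ V ∧
      (M n).presheaf.map i.op x ∈ lieSub B n V) : x ∈ lieSub B n U := by
  intro P hP
  obtain ⟨V, i, hV, h1⟩ := h P hP
  obtain ⟨W, j, hW, h2⟩ := h1 P hV
  exact ⟨W, j ≫ i, hW, by rw [← res_res_apply]; exact h2⟩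

theorem lieSub_bracket {p q n : ℤ} (h : p + q = n) {U : X.Opens} {x : Γ(M p, U)} {y : Γ(M q, U)}
    (hx : x ∈ lieSub B p U) (hy : y ∈ lieSub B q U) :
    (B.bracket p q n h).app U x y ∈ lieSub B n U := by
  intro P hP
  obtain ⟨V, i, hV, h1⟩ := hx P hP
  obtain ⟨W, j, hW, h2⟩ := hy P hP
  obtain ⟨Z, a, b, hZ, e⟩ := exists_common i j hV hW
  refine ⟨Z, a ≫ i, hZ, ?_⟩
  rw [Bilin.map_app]
  refine .bracket h ?_ ?_
  · rw [← res_res_apply]; exact h1.res a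
  · rw [e, ← res_res_apply]; exact h2.res b

theorem mem_lieSub_one {U : X.Opens} (x : Γ(M 1, U)) : x ∈ lieSub B 1 U :=
  fun _ hP => ⟨U, 𝟙 U, hP, .gen _⟩

/-- The degree `n` part of the graded Lie subalgebra generated by `M 1`, as data of a sheaf. -/
noncomputable def lieData (n : ℤ) : ModData X :=
  subData (M n) (lieSub B n) (lieSub_res B) (lieSub_loc B)

/-- The degree `n` part of the graded Lie subalgebra generated by `M 1`. -/
noncomputable def lieObj (n : ℤ) : X.Modules := (lieData B n).toModules

/-- The sections of `lieObj`. -/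
noncomputable def lieEquiv (n : ℤ) (U : X.Opens) :
    Γ(lieObj B n, U) ≃ₗ[Γ(X, U)] lieSub B n U := (lieData B n).equiv U

/-- The inclusion of the graded Lie subalgebra generated by `M 1`. -/
noncomputable def lieIncl (n : ℤ) : lieObj B n ⟶ M n :=
  homMk (fun U => (lieSub B n U).subtype ∘ₗ (lieEquiv B n U).toLinearMap) (fun _ _ => rfl)

theorem lieIncl_apply {n : ℤ} {U : X.Opens} (x : Γ(lieObj B n, U)) :
    (lieIncl B n).app U x = (lieEquiv B n U x).1 := rfl

theorem lieIncl_injective {n : ℤ} {U : X.Opens} {x y : Γ(lieObj B n, U)}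
    (h : (lieIncl B n).app U x = (lieIncl B n).app U y) : x = y :=
  (lieEquiv B n U).injective (Subtype.ext h)

theorem lieIncl_mem {n : ℤ} {U : X.Opens} (x : Γ(lieObj B n, U)) :
    (lieIncl B n).app U x ∈ lieSub B n U := (lieEquiv B n U x).2

theorem lieIncl_res {n : ℤ} {U V : X.Opens} (i : V ⟶ U) (x : Γ(lieObj B n, U)) :
    (lieIncl B n).app V ((lieObj B n).presheaf.map i.op x) =
      (M n).presheaf.map i.op ((lieIncl B n).app U x) := rfl

theorem isZero_lieObj {n : ℤ} (h : Limits.IsZero (M n)) : Limits.IsZero (lieObj B n) :=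
  isZero_of_sections _ fun U _ => lieIncl_injective B
    ((sections_eq_zero h U _).trans (sections_eq_zero h U _).symm)

/-- A morphism into `M n` with values in the Lie subalgebra factors through it. -/
noncomputable def lieLift {N : X.Modules} {n : ℤ} (f : N ⟶ M n)
    (hf : ∀ (U : X.Opens) (x : Γ(N, U)), f.app U x ∈ lieSub B n U) : N ⟶ lieObj B n :=
  homMk (fun U => (lieEquiv B n U).symm.toLinearMap ∘ₗ LinearMap.codRestrict (lieSub B n U)
      { toFun := fun x => f.app U x
        map_add' := fun x y => map_add _ x y
        map_smul' := fun r x => Scheme.Modules.Hom.app_smul f r x } (hf U))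
    (fun {U V} i x => by
      apply lieIncl_injective B
      rw [lieIncl_res]
      exact (ConcreteCategory.congr_hom (f.mapPresheaf.naturality i.op) x).symm)

theorem lieIncl_lieLift {N : X.Modules} {n : ℤ} (f : N ⟶ M n)
    (hf : ∀ (U : X.Opens) (x : Γ(N, U)), f.app U x ∈ lieSub B n U) (U : X.Opens) (x : Γ(N, U)) :
    (lieIncl B n).app U ((lieLift B f hf).app U x) = f.app U x := rfl

/-- The map from `M 1` to the graded Lie algebra that it generates. -/
noncomputable def lieGenMap : M 1 ⟶ lieObj B 1 :=
  lieLift B (𝟙 (M 1)) (fun _ x => mem_lieSub_one B x)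

/-- The bracket on the graded Lie subalgebra generated by `M 1`. -/
noncomputable def lieBracket (p q n : ℤ) (h : p + q = n) :
    Bilin (lieObj B p) (lieObj B q) (lieObj B n) where
  app U := LinearMap.mk₂ Γ(X, U)
    (fun x y => (lieEquiv B n U).symm ⟨(B.bracket p q n h).app U ((lieIncl B p).app U x)
      ((lieIncl B q).app U y), lieSub_bracket B h (lieIncl_mem B x) (lieIncl_mem B y)⟩)
    (fun x x' y => by
      apply (lieEquiv B n U).injective; apply Subtype.ext; simp)
    (fun r x y => by
      apply (lieEquiv B n U).injective; apply Subtype.ext; simp)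
    (fun x y y' => by
      apply (lieEquiv B n U).injective; apply Subtype.ext; simp)
    (fun r x y => by
      apply (lieEquiv B n U).injective; apply Subtype.ext; simp)
  map_app i x y := by
    apply lieIncl_injective B
    exact (B.bracket p q n h).map_app i _ _

theorem lieIncl_bracket (p q n : ℤ) (h : p + q = n) (U : X.Opens) (x : Γ(lieObj B p, U))
    (y : Γ(lieObj B q, U)) : (lieIncl B n).app U ((lieBracket B p q n h).app U x y) =
      (B.bracket p q n h).app U ((lieIncl B p).app U x) ((lieIncl B q).app U y) := rfl

/-- The graded Lie subalgebra of `M` generated by `M 1`. -/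
noncomputable def generatedLie : GradedLie (lieObj B) where
  bracket := lieBracket B
  skew p q n h h' U x y := by
    apply lieIncl_injective B
    rw [map_neg, Units.smul_def, map_zsmul, ← Units.smul_def, lieIncl_bracket, lieIncl_bracket]
    exact B.skew p q n h h' U _ _
  jacobi p q r s t v n h₁ h₂ h₃ h₄ h₅ h₆ U x y z := by
    apply lieIncl_injective B
    rw [map_add, Units.smul_def, map_zsmul, ← Units.smul_def]
    simp only [lieIncl_bracket]
    exact B.jacobi p q r s t v n h₁ h₂ h₃ h₄ h₅ h₆ U _ _ _

end Lie

section DGLie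

variable {X : Scheme.{u}} (L : DGLie X)

/-- The differential preserves the graded Lie subalgebra generated by the part of degree one. -/
def DStable : Prop :=
  ∀ (n m : ℤ), n + 1 = m → ∀ (U : X.Opens), ∀ x ∈ lieSub L.lie n U,
    (L.cx.obj.d n m).app U x ∈ lieSub L.lie m U

variable {L} in
theorem DStable.mem (hd : DStable L) (n m : ℤ) (U : X.Opens) (x : Γ(lieObj L.lie n, U)) :
    (lieIncl L.lie n ≫ L.cx.obj.d n m).app U x ∈ lieSub L.lie m U := by
  by_cases h : n + 1 = m
  · exact hd n m h U _ (lieIncl_mem _ x)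
  · rw [L.cx.obj.shape n m (by simpa using h), Limits.comp_zero]
    exact (lieSub L.lie m U).zero_mem

/-- The restriction of the differential to the graded Lie subalgebra generated by the part of
degree one. -/
noncomputable def lieD (hd : DStable L) (n m : ℤ) : lieObj L.lie n ⟶ lieObj L.lie m :=
  lieLift L.lie (lieIncl L.lie n ≫ L.cx.obj.d n m) (hd.mem n m)

theorem lieIncl_lieD (hd : DStable L) (n m : ℤ) (U : X.Opens) (x : Γ(lieObj L.lie n, U)) :
    (lieIncl L.lie m).app U ((lieD L hd n m).app U x) =
      (L.cx.obj.d n m).app U ((lieIncl L.lie n).app U x) := rfl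

/-- The complex underlying the graded Lie subalgebra generated by the part of degree one. -/
noncomputable def generatedComplex (hd : DStable L) : CochainComplex X.Modules ℤ where
  X := lieObj L.lie
  d := lieD L hd
  shape n m h := by
    refine Scheme.Modules.hom_ext _ _ fun U => ?_
    ext x
    apply lieIncl_injective L.lie
    rw [lieIncl_lieD, L.cx.obj.shape n m h]
    exact (map_zero ((lieIncl L.lie m).app U).hom).symm
  d_comp_d' i j k _ _ := by
    refine Scheme.Modules.hom_ext _ _ fun U => ?_
    ext x
    apply lieIncl_injective L.lie
    change (L.cx.obj.d i j ≫ L.cx.obj.d j k).app U ((lieIncl L.lie i).app U x) = _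
    rw [L.cx.obj.d_comp_d]
    exact (map_zero ((lieIncl L.lie k).app U).hom).symm

theorem plus_generatedComplex (hd : DStable L) :
    CochainComplex.plus X.Modules (generatedComplex L hd) := by
  obtain ⟨n, hn⟩ := L.cx.property
  exact ⟨n, (CochainComplex.isStrictlyGE_iff _ _).2 fun i hi =>
    isZero_lieObj L.lie (L.cx.obj.isZero_of_isStrictlyGE n i hi)⟩

theorem lieD_leibniz (hd : DStable L) (p q n p' q' n' : ℤ) (h : p + q = n) (hp : p + 1 = p')
    (hq : q + 1 = q') (hn : n + 1 = n') (U : X.Opens) (x : Γ(lieObj L.lie p, U))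
    (y : Γ(lieObj L.lie q, U)) :
    (lieD L hd n n').app U ((lieBracket L.lie p q n h).app U x y) =
      (lieBracket L.lie p' q n' (by omega)).app U ((lieD L hd p p').app U x) y +
        p.negOnePow • (lieBracket L.lie p q' n' (by omega)).app U x ((lieD L hd q q').app U y) := by
  apply lieIncl_injective L.lie
  rw [map_add, Units.smul_def, map_zsmul, ← Units.smul_def]
  exact L.leibniz p q n p' q' n' h hp hq hn U _ _

/-- The Lie subalgebra, in bounded below complexes, generated by the part of degree one. -/
noncomputable def generatedDGLie (hd : DStable L) : DGLie X where
  cx := ⟨generatedComplex L hd, plus_generatedComplex L hd⟩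
  lie := generatedLie L.lie
  leibniz := lieD_leibniz L hd

/-- The inclusion of the generated Lie subalgebra. -/
noncomputable def generatedIncl (hd : DStable L) : (generatedDGLie L hd).cx ⟶ L.cx :=
  ⟨{ f := lieIncl L.lie
     comm' := fun _ _ _ => rfl }⟩

end DGLie

/-! ### The complex of polydifferential operators on a scheme -/

section DPoly

variable {K : Type u} [Field K] {X : Scheme.{u}} (π : X ⟶ Spec (.of K))

/-- The `K`-algebra structure on the sections over `V`. -/
noncomputable def constants (V : X.Opens) : K →+* Γ(X, V) :=
  ((Scheme.ΓSpecIso (.of K)).inv ≫ π.appTop ≫ X.presheaf.map (homOfLE le_top).op).hom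

/-- Restriction of functions. -/
noncomputable def fres {V W : X.Opens} (h : W ≤ V) : Γ(X, V) →+* Γ(X, W) :=
  (X.presheaf.map (homOfLE h).op).hom

theorem fres_fres {U V W : X.Opens} (h : V ≤ U) (h' : W ≤ V) (r : Γ(X, U)) :
    fres h' (fres h r) = fres (h'.trans h) r := by
  simp only [fres]
  rw [← ConcreteCategory.comp_apply, ← X.presheaf.map_comp]
  rfl

theorem fres_self {U : X.Opens} (r : Γ(X, U)) : fres le_rfl r = r := by
  change X.presheaf.map (𝟙 (op U)) r = r
  simp

theorem fres_constants {V W : X.Opens} (h : W ≤ V) (c : K) :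
    fres h (constants π V c) = constants π W c := by
  simp only [fres, constants]
  rw [← ConcreteCategory.comp_apply]
  simp only [Category.assoc, ← X.presheaf.map_comp]
  rfl

theorem exists_affine {O : X.Opens} {ι : Type u} {U : ι → X.Opens} (hO : O ≤ iSup U) {P : X}
    (hP : P ∈ O) : ∃ Z : X.affineOpens, P ∈ Z.1 ∧ Z.1 ≤ O ∧ ∃ i, Z.1 ≤ U i := by
  obtain ⟨i, hi⟩ := Opens.mem_iSup.1 (hO hP)
  obtain ⟨Z, hZ, hPZ, hle⟩ := X.isBasis_affineOpens.exists_subset_of_mem_open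
    (show P ∈ ((O ⊓ U i : X.Opens) : Set X) from ⟨hP, hi⟩) (O ⊓ U i).isOpen
  obtain ⟨Z, hZ', rfl⟩ := hZ
  exact ⟨⟨Z, hZ'⟩, hPZ, fun x hx => (hle hx).1, i, fun x hx => (hle hx).2⟩

theorem eq_of_cover {O : X.Opens} {ι : Type u} (Z : ι → X.Opens) (hZ : ∀ i, Z i ≤ O)
    (hc : ∀ P ∈ O, ∃ i, P ∈ Z i) (s t : Γ(X, O)) (h : ∀ i, fres (hZ i) s = fres (hZ i) t) :
    s = t :=
  X.sheaf.eq_of_locally_eq' Z O (fun i => homOfLE (hZ i))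
    (fun P hP => Opens.mem_iSup.2 (hc P hP)) s t h

theorem eq_of_affine {O : X.Opens} {ι : Type u} (U : ι → X.Opens) (hO : O ≤ iSup U)
    (s t : Γ(X, O))
    (h : ∀ (Z : X.affineOpens) (hZ : Z.1 ≤ O) (i : ι), Z.1 ≤ U i → fres hZ s = fres hZ t) :
    s = t := by
  refine eq_of_cover (ι := {Z : X.affineOpens // Z.1 ≤ O ∧ ∃ i, Z.1 ≤ U i}) (fun Z => Z.1.1)
    (fun Z => Z.2.1) (fun P hP => ?_) s t (fun Z => ?_)
  · obtain ⟨Z, h1, h2, h3⟩ := exists_affine hO hP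
    exact ⟨⟨Z, h2, h3⟩, h1⟩
  · obtain ⟨i, hi⟩ := Z.2.2
    exact h Z.1 Z.2.1 i hi

/-- The sections over `U` of the sheaf of polydifferential operators in `n` arguments:
families of polydifferential operators on `Γ(X, V)`, one for each affine open `V ⊆ U`, that are
compatible with restriction. A polydifferential operator extends uniquely to localizations, so that
for affine `U` these are the polydifferential operators on `Γ(X, U)`. -/
noncomputable def dSec (n : ℕ) (U : X.Opens) :
    AddSubgroup (∀ V : {V : X.affineOpens // V.1 ≤ U}, (Fin n → Γ(X, V.1.1)) → Γ(X, V.1.1)) where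
  carrier := {s | (∀ (V : X.affineOpens) (hV : V.1 ≤ U), IsPolyDiff (constants π V.1) (s ⟨V, hV⟩)) ∧
    ∀ (V W : X.affineOpens) (hV : V.1 ≤ U) (hW : W.1 ≤ V.1) (a : Fin n → Γ(X, V.1)),
      fres hW (s ⟨V, hV⟩ a) = s ⟨W, hW.trans hV⟩ (fun i => fres hW (a i))}
  zero_mem' := ⟨fun _ _ => IsPolyDiff.zero, fun _ _ _ _ _ => by simp⟩
  add_mem' hs ht := ⟨fun V hV => (hs.1 V hV).add (ht.1 V hV), fun V W hV hW a => by
    simp only [Pi.add_apply, map_add, hs.2 V W hV hW, ht.2 V W hV hW]⟩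
  neg_mem' hs := ⟨fun V hV => (hs.1 V hV).neg, fun V W hV hW a => by
    simp only [Pi.neg_apply, map_neg, hs.2 V W hV hW]⟩

variable {π} in
theorem dSec_ext {n : ℕ} {U : X.Opens} {s t : dSec π n U}
    (h : ∀ V hV a, s.1 ⟨V, hV⟩ a = t.1 ⟨V, hV⟩ a) : s = t :=
  Subtype.ext (funext fun V => funext fun a => h V.1 V.2 a)

noncomputable instance (n : ℕ) (U : X.Opens) : Module Γ(X, U) (dSec π n U) where
  smul r s := ⟨fun V a => fres V.2 r * s.1 V a,
    fun V hV => (s.2.1 V hV).mul_const _, fun V W hV hW a => by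
      rw [map_mul, fres_fres, s.2.2 V W hV hW]⟩
  one_smul s := dSec_ext fun V hV a =>
    show fres hV 1 * s.1 ⟨V, hV⟩ a = s.1 ⟨V, hV⟩ a by rw [map_one, _root_.one_mul]
  mul_smul r r' s := dSec_ext fun V hV a =>
    show fres hV (r * r') * s.1 ⟨V, hV⟩ a = fres hV r * (fres hV r' * s.1 ⟨V, hV⟩ a) by
      rw [map_mul, _root_.mul_assoc]
  smul_zero r := dSec_ext fun V hV a => show fres hV r * 0 = 0 by rw [mul_zero]
  smul_add r s t := dSec_ext fun V hV a =>
    show fres hV r * (s.1 ⟨V, hV⟩ a + t.1 ⟨V, hV⟩ a) = fres hV r * s.1 ⟨V, hV⟩ a + fres hV r * t.1 ⟨V, hV⟩ a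
    by rw [mul_add]
  add_smul r r' s := dSec_ext fun V hV a =>
    show fres hV (r + r') * s.1 ⟨V, hV⟩ a = fres hV r * s.1 ⟨V, hV⟩ a + fres hV r' * s.1 ⟨V, hV⟩ a
    by rw [map_add, add_mul]
  zero_smul s := dSec_ext fun V hV a => show fres hV 0 * s.1 ⟨V, hV⟩ a = 0 by rw [map_zero, zero_mul]

theorem dSec_smul {n : ℕ} {U : X.Opens} (r : Γ(X, U)) (s : dSec π n U) (V : X.affineOpens)
    (hV : V.1 ≤ U) (a : Fin n → Γ(X, V.1)) : (r • s).1 ⟨V, hV⟩ a = fres hV r * s.1 ⟨V, hV⟩ a := rfl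

theorem dSec_add {n : ℕ} {U : X.Opens} (s t : dSec π n U) (V : X.affineOpens)
    (hV : V.1 ≤ U) (a : Fin n → Γ(X, V.1)) : (s + t).1 ⟨V, hV⟩ a = s.1 ⟨V, hV⟩ a + t.1 ⟨V, hV⟩ a := rfl

/-- Gluing of polydifferential operators. -/
theorem dSec_glue (n : ℕ) {ι : Type u} (U : ι → X.Opens) (s : ∀ i, dSec π n (U i))
    (hs : ∀ (i j : ι) (V : X.affineOpens) (hi : V.1 ≤ U i) (hj : V.1 ≤ U j),
      (s i).1 ⟨V, hi⟩ = (s j).1 ⟨V, hj⟩) :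
    ∃ t : dSec π n (iSup U), ∀ (i : ι) (V : X.affineOpens) (hi : V.1 ≤ U i),
      t.1 ⟨V, (hi.trans (le_iSup U i))⟩ = (s i).1 ⟨V, hi⟩ := by
  have hex : ∀ (V : X.affineOpens) (hV : V.1 ≤ iSup U) (a : Fin n → Γ(X, V.1)),
      ∃ b : Γ(X, V.1), ∀ (Z : X.affineOpens) (hZ : Z.1 ≤ V.1) (i : ι) (hi : Z.1 ≤ U i),
        fres hZ b = (s i).1 ⟨Z, hi⟩ (fun l => fres hZ (a l)) := by
    intro V hV a
    let J := {Z : X.affineOpens // Z.1 ≤ V.1 ∧ ∃ i, Z.1 ≤ U i}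
    let idx : J → ι := fun Z => Z.2.2.choose
    have hidx : ∀ Z : J, Z.1.1 ≤ U (idx Z) := fun Z => Z.2.2.choose_spec
    obtain ⟨b, hb, -⟩ := X.sheaf.existsUnique_gluing' (fun Z : J => Z.1.1) V.1
      (fun Z => homOfLE Z.2.1) (fun P hP => by
        obtain ⟨Z, h1, h2, h3⟩ := exists_affine hV hP
        exact Opens.mem_iSup.2 ⟨⟨Z, h2, h3⟩, h1⟩)
      (fun Z => (s (idx Z)).1 ⟨Z.1, (hidx Z)⟩ (fun l => fres Z.2.1 (a l))) (by
        intro Z Z'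
        refine eq_of_affine U (inf_le_left.trans (Z.2.1.trans hV)) _ _ fun Y hY i hi => ?_
        change fres hY (fres inf_le_left _) = fres hY (fres inf_le_right _)
        rw [fres_fres, fres_fres, (s (idx Z)).2.2 Z.1 Y (hidx Z) (hY.trans inf_le_left),
          (s (idx Z')).2.2 Z'.1 Y (hidx Z') (hY.trans inf_le_right)]
        simp only [fres_fres]
        rw [hs (idx Z) (idx Z') Y _ ((hY.trans inf_le_right).trans (hidx Z'))])
    refine ⟨b, fun Z hZ i hi => ?_⟩
    have := hb ⟨Z, hZ, i, hi⟩
    rw [hs i (idx ⟨Z, hZ, i, hi⟩) Z hi (hidx ⟨Z, hZ, i, hi⟩)]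
    exact this
  choose t ht using hex
  refine ⟨⟨fun V => t V.1 V.2, fun V hV => ⟨⟨fun x i a b => ?_, fun x i c a => ?_⟩, ?_⟩,
    fun V W hV hW a => ?_⟩, fun i V hi => ?_⟩
  · refine eq_of_affine U hV _ _ fun Z hZ j hj => ?_
    rw [map_add, ht V hV _ Z hZ j hj, ht V hV _ Z hZ j hj, ht V hV _ Z hZ j hj]
    have e : ∀ c, (fun l => fres hZ (Function.update x i c l)) =
        Function.update (fun l => fres hZ (x l)) i (fres hZ c) := by
      intro c; funext l
      by_cases h : l = i
      · subst h; simp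
      · simp [h]
    rw [e, e, e, map_add, ((s j).2.1 Z hj).1.1]
  · refine eq_of_affine U hV _ _ fun Z hZ j hj => ?_
    rw [map_mul, ht V hV _ Z hZ j hj, ht V hV _ Z hZ j hj]
    have e : ∀ c, (fun l => fres hZ (Function.update x i c l)) =
        Function.update (fun l => fres hZ (x l)) i (fres hZ c) := by
      intro c; funext l
      by_cases h : l = i
      · subst h; simp
      · simp [h]
    rw [e, e, map_mul, fres_constants, ((s j).2.1 Z hj).1.2]
  · let J := {Z : X.affineOpens // Z.1 ≤ V.1 ∧ ∃ i, Z.1 ≤ U i}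
    obtain ⟨T, hT⟩ := V.2.isCompact.elim_finite_subcover (fun Z : J => (Z.1.1 : Set X))
      (fun Z => Z.1.1.isOpen) (fun P hP => by
        obtain ⟨Z, h1, h2, h3⟩ := exists_affine hV hP
        exact Set.mem_iUnion.2 ⟨⟨Z, h2, h3⟩, h1⟩)
    have hN : ∀ Z : J, ∃ N : ℕ, ∀ i, OrderLE i N ((s Z.2.2.choose).1 ⟨Z.1, Z.2.2.choose_spec⟩) :=
      fun Z => ((s Z.2.2.choose).2.1 Z.1 Z.2.2.choose_spec).2
    choose N hN using hN
    refine ⟨T.sup N, fun i => ?_⟩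
    refine OrderLE.of_cover (ι := T) (S := fun Z => Γ(X, Z.1.1.1)) (fun Z => fres Z.1.2.1) ?_ i
      (g := fun Z => (s Z.1.2.2.choose).1 ⟨Z.1.1, Z.1.2.2.choose_spec⟩) ?_ ?_
    · intro a b hab
      refine eq_of_cover (fun Z : T => Z.1.1.1) (fun Z => Z.1.2.1) (fun P hP => ?_) a b hab
      obtain ⟨Z, hZ⟩ := Set.mem_iUnion.1 (hT hP)
      obtain ⟨hZT, hPZ⟩ := Set.mem_iUnion.1 hZ
      exact ⟨⟨Z, hZT⟩, hPZ⟩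
    · intro Z x
      exact ht V hV x Z.1.1 Z.1.2.1 _ Z.1.2.2.choose_spec
    · intro Z
      exact (hN Z.1 i).mono (Finset.le_sup Z.2)
  · refine eq_of_affine U (hW.trans hV) _ _ fun Z hZ j hj => ?_
    rw [fres_fres, ht V hV a Z (hZ.trans hW) j hj, ht W (hW.trans hV) _ Z hZ j hj]
    simp only [fres_fres]
  · funext a
    have := ht V (hi.trans (le_iSup U i)) a V le_rfl i hi
    simpa only [fres_self] using this

/-- The data of the sheaf of polydifferential operators in `n` arguments. -/
noncomputable def dData (n : ℕ) : ModData X where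
  sec U := dSec π n U
  res {U V} h :=
    { toFun := fun s => ⟨fun W => s.1 ⟨W.1, W.2.trans h⟩, fun W hW => s.2.1 W (hW.trans h),
        fun W Y hW hY a => s.2.2 W Y (hW.trans h) hY a⟩
      map_zero' := rfl
      map_add' := fun _ _ => rfl }
  res_id _ _ := rfl
  res_res _ _ _ := rfl
  res_smul h r s := dSec_ext fun V hV a => by
    change fres (hV.trans h) r * s.1 ⟨V, _⟩ a = fres hV (fres h r) * s.1 ⟨V, _⟩ a
    rw [fres_fres]
  glue U s hs := by
    have hs' : ∀ i j (V : X.affineOpens) (hi : V.1 ≤ U i) (hj : V.1 ≤ U j),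
        (s i).1 ⟨V, hi⟩ = (s j).1 ⟨V, hj⟩ := fun i j V hi hj =>
      congrFun (congrArg Subtype.val (hs i j)) ⟨V, le_inf hi hj⟩
    obtain ⟨t, ht⟩ := dSec_glue π n U s hs'
    refine ⟨t, fun i => ?_, fun t' ht' => dSec_ext fun V hV a => ?_⟩
    · exact Subtype.ext (funext fun V => ht i V.1 V.2)
    · refine eq_of_affine U hV _ _ fun Z hZ i hi => ?_
      rw [t.2.2 V Z hV hZ, t'.2.2 V Z hV hZ, ht i Z hi]
      have := congrFun (congrArg Subtype.val (ht' i)) ⟨Z, hi⟩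
      exact congrFun this _

variable (X) in
/-- The zero sheaf. -/
def zeroData : ModData X where
  sec _ := PUnit
  res _ := 0
  res_id _ _ := rfl
  res_res _ _ _ := rfl
  res_smul _ _ _ := rfl
  glue _ _ _ := ⟨PUnit.unit, fun _ => rfl, fun _ _ => rfl⟩

/-- The sheaf `D_poly^n(X)` of polydifferential operators in `n` arguments; zero for `n < 0`. -/
noncomputable def dPolyData : ℤ → ModData X
  | .ofNat n => dData π n
  | .negSucc _ => zeroData X

/-- The sheaf `D_poly^n(X)`. -/
noncomputable def dPoly (n : ℤ) : X.Modules := (dPolyData π n).toModules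

/-- The product of sections. -/
noncomputable def dSecMul {p q n : ℕ} (h : p + q = n) (U : X.Opens) (s : dSec π p U)
    (t : dSec π q U) : dSec π n U :=
  ⟨fun V => prod h (s.1 V) (t.1 V), fun V hV => (s.2.1 V hV).prod h (t.2.1 V hV),
    fun V W hV hW a => by
      simp only [prod, map_mul]
      rw [s.2.2 V W hV hW, t.2.2 V W hV hW]⟩

/-- The Hochschild differential on sections. -/
noncomputable def dSecDiff (n : ℕ) (U : X.Opens) (s : dSec π n U) : dSec π (n + 1) U :=
  ⟨fun V => hochschild (s.1 V), fun V hV => (s.2.1 V hV).hochschild,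
    fun V W hV hW a => by
      simp only [hochschild, map_add, map_mul, map_sum, map_pow, map_neg, map_one]
      simp only [s.2.2 V W hV hW]
      congr 2
      refine Finset.sum_congr rfl fun j _ => ?_
      have e : (fun i => fres hW (Fin.contractNth j.castSucc (· * ·) a i)) =
          Fin.contractNth j.castSucc (· * ·) (fun i => fres hW (a i)) := by
        funext k
        simp only [Fin.contractNth]
        split_ifs <;> simp
      rw [e]⟩

/-- A bilinear map of sheaves from its action on sections. -/
noncomputable def bilinMk {D E F : ModData X}
    (f : ∀ U : X.Opens, D.sec U →ₗ[Γ(X, U)] E.sec U →ₗ[Γ(X, U)] F.sec U)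
    (hf : ∀ {U V : X.Opens} (h : V ≤ U) (x : D.sec U) (y : E.sec U),
      F.res h (f U x y) = f V (D.res h x) (E.res h y)) :
    Bilin D.toModules E.toModules F.toModules where
  app U := f U
  map_app i x y := hf i.le x y

/-- The product `D_poly^p × D_poly^q → D_poly^{p+q}`. -/
noncomputable def dMul : ∀ (p q n : ℤ), p + q = n → Bilin (dPoly π p) (dPoly π q) (dPoly π n)
  | .ofNat p, .ofNat q, .ofNat n, h =>
    bilinMk (D := dData π p) (E := dData π q) (F := dData π n)
      (fun U => LinearMap.mk₂ Γ(X, U) (dSecMul π (Int.ofNat.inj h) U)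
        (fun _ _ _ => dSec_ext fun _ _ _ => add_mul _ _ _)
        (fun _ _ _ => dSec_ext fun _ _ _ => _root_.mul_assoc _ _ _)
        (fun _ _ _ => dSec_ext fun _ _ _ => mul_add _ _ _)
        (fun _ _ _ => dSec_ext fun _ _ _ => mul_left_comm _ _ _))
      (fun _ _ _ => rfl)
  | .ofNat _, .ofNat _, .negSucc _, _ => bilinMk (fun _ => 0) (fun _ _ _ => map_zero _)
  | .ofNat _, .negSucc _, _, _ => bilinMk (fun _ => 0) (fun _ _ _ => map_zero _)
  | .negSucc _, _, _, _ => bilinMk (fun _ => 0) (fun _ _ _ => map_zero _)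

/-- The Hochschild differential as a morphism of sheaves. -/
noncomputable def dDiffNat (n : ℕ) : (dData π n).toModules ⟶ (dData π (n + 1)).toModules :=
  homMk (M := (dData π n).toModules) (N := (dData π (n + 1)).toModules)
    (fun U =>
      { toFun := fun s => dSecDiff π n U s
        map_add' := fun _ _ => dSec_ext fun _ _ a => hochschild_add _ _ a
        map_smul' := fun _ _ => dSec_ext fun _ _ a => hochschild_mul_const _ _ a })
    (fun _ _ => rfl)

/-- The Hochschild differential `D_poly^n → D_poly^m`, zero unless `m = n + 1`. -/
noncomputable def dDiff : ∀ (n m : ℤ), dPoly π n ⟶ dPoly π m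
  | .ofNat n, .ofNat m =>
    if h : n + 1 = m then
      dDiffNat π n ≫ eqToHom (congrArg (fun k => (dData π k).toModules) h)
    else 0
  | .ofNat _, .negSucc _ => 0
  | .negSucc _, _ => 0

theorem dDiff_succ (n : ℕ) : dDiff π (.ofNat n) (.ofNat (n + 1)) = dDiffNat π n :=
  (dif_pos rfl).trans (Category.comp_id _)

theorem dDiffNat_comp (n : ℕ) : dDiffNat π n ≫ dDiffNat π (n + 1) = 0 := by
  refine Scheme.Modules.hom_ext _ _ fun U => ?_
  ext x
  exact dSec_ext fun V hV a => congrFun (hochschild_hochschild (x.1 ⟨V, hV⟩)) a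

/-- The complex of polydifferential operators, with the Hochschild differential. -/
noncomputable def dPolyComplex : CochainComplex X.Modules ℤ where
  X := dPoly π
  d := dDiff π
  shape n m h := by
    have h : ¬ n + 1 = m := h
    rcases n with n | n <;> rcases m with m | m <;> try rfl
    exact dif_neg fun e => h (by subst e; rfl)
  d_comp_d' i j k hij hjk := by
    obtain rfl : i + 1 = j := hij
    obtain rfl : i + 1 + 1 = k := hjk
    rcases i with n | n
    · change dDiff π (.ofNat n) (.ofNat (n + 1)) ≫ dDiff π (.ofNat (n + 1)) (.ofNat (n + 1 + 1)) = 0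
      rw [dDiff_succ, dDiff_succ]
      exact dDiffNat_comp π n
    · exact Limits.zero_comp

theorem isZero_dPoly (n : ℕ) : Limits.IsZero (dPoly π (.negSucc n)) :=
  isZero_of_sections _ fun _ _ => rfl

theorem plus_dPolyComplex : CochainComplex.plus X.Modules (dPolyComplex π) := by
  refine ⟨0, (CochainComplex.isStrictlyGE_iff _ _).2 fun i hi => ?_⟩
  rcases i with n | n
  · exact absurd hi (by simp)
  · exact isZero_dPoly π n

theorem dPoly_negSucc {n : ℕ} {U : X.Opens} (x y : Γ(dPoly π (.negSucc n), U)) : x = y := rfl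

theorem negSucc_app {n : ℕ} {M N : X.Modules} (b : Bilin (dPoly π (.negSucc n)) M N)
    (U : X.Opens) (x : Γ(dPoly π (.negSucc n), U)) (y : Γ(M, U)) : b.app U x y = 0 := by
  rw [dPoly_negSucc π x 0, map_zero, LinearMap.zero_apply]

theorem app_negSucc {n : ℕ} {M N : X.Modules} (b : Bilin M (dPoly π (.negSucc n)) N)
    (U : X.Opens) (x : Γ(M, U)) (y : Γ(dPoly π (.negSucc n), U)) : b.app U x y = 0 := by
  rw [dPoly_negSucc π y 0, map_zero]

/-- The unit: the operator `1` without arguments. -/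
noncomputable def dOne : Γ(dPoly π 0, ⊤) :=
  show dSec π 0 ⊤ from ⟨fun _ _ => 1, fun _ _ =>
    ⟨⟨fun _ i => i.elim0, fun _ i => i.elim0⟩, 0, fun i => i.elim0⟩, fun _ _ _ _ _ => map_one _⟩

theorem ofNat_inj {p q n : ℕ} (h : Int.ofNat p + Int.ofNat q = Int.ofNat n) : p + q = n :=
  Int.ofNat.inj h

/-- The graded algebra of polydifferential operators. -/
noncomputable def dPolyAlg : GradedAlg (dPoly π) where
  mul := dMul π
  one := dOne π
  mul_assoc p q r s t n h₁ h₂ h₃ h₄ U x y z := by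
    rcases p with p | p
    swap; · rw [negSucc_app, negSucc_app, map_zero, LinearMap.zero_apply]
    rcases q with q | q
    swap; · rw [app_negSucc, negSucc_app, map_zero, map_zero, LinearMap.zero_apply]
    rcases r with r | r
    swap; · rw [app_negSucc, app_negSucc, map_zero]
    rcases s with s | s
    swap; · exact absurd h₁ (by simp; omega)
    rcases t with t | t
    swap; · exact absurd h₂ (by simp; omega)
    rcases n with n | n
    swap; · exact absurd h₃ (by simp; omega)
    exact dSec_ext fun V hV a => congrFun (prod_assoc (ofNat_inj h₁) (ofNat_inj h₂)
      (ofNat_inj h₃) (ofNat_inj h₄) (x.1 ⟨V, hV⟩) (y.1 ⟨V, hV⟩) (z.1 ⟨V, hV⟩)) a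
  one_mul p U x := by
    rcases p with p | p
    swap; · rfl
    exact dSec_ext fun V hV a => congrFun (one_prod (Nat.zero_add p) (x.1 ⟨V, hV⟩)) a
  mul_one p U x := by
    rcases p with p | p
    swap; · rfl
    exact dSec_ext fun V hV a => congrFun (prod_one (x.1 ⟨V, hV⟩)) a

theorem dPoly_d_one : (dDiff π 0 1).app ⊤ (dOne π) = 0 := by
  change (dDiff π (.ofNat 0) (.ofNat (0 + 1))).app ⊤ (dOne π) = 0
  rw [dDiff_succ]
  refine dSec_ext fun V hV a => ?_
  change hochschild (fun _ : Fin 0 → Γ(X, V.1) => 1) a = 0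
  simp [hochschild]

theorem dPoly_leibniz (p q n p' q' n' : ℤ) (h : p + q = n) (hp : p + 1 = p') (hq : q + 1 = q')
    (hn : n + 1 = n') (U : X.Opens) (x : Γ(dPoly π p, U)) (y : Γ(dPoly π q, U)) :
    (dDiff π n n').app U ((dMul π p q n h).app U x y) =
      (dMul π p' q n' (by omega)).app U ((dDiff π p p').app U x) y +
        p.negOnePow • (dMul π p q' n' (by omega)).app U x ((dDiff π q q').app U y) := by
  rcases p with p | p
  swap
  · rw [dPoly_negSucc π x 0]
    simp only [map_zero, LinearMap.zero_apply, smul_zero, add_zero]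
  rcases q with q | q
  swap
  · rw [dPoly_negSucc π y 0]
    simp only [map_zero, smul_zero, add_zero]
  obtain rfl : n = .ofNat (p + q) := h.symm
  obtain rfl : p' = .ofNat (p + 1) := hp.symm
  obtain rfl : q' = .ofNat (q + 1) := hq.symm
  obtain rfl : n' = .ofNat (p + q + 1) := hn.symm
  rw [dDiff_succ, dDiff_succ, dDiff_succ]
  have key : ∀ (V : X.affineOpens) (f : (Fin p → Γ(X, V.1)) → Γ(X, V.1))
      (g : (Fin q → Γ(X, V.1)) → Γ(X, V.1)) (a : Fin (p + q + 1) → Γ(X, V.1)),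
      hochschild (prod rfl f g) a =
        prod (Nat.add_right_comm p 1 q) (hochschild f) g a +
          (-1) ^ p * prod (Nat.add_assoc p q 1).symm f (hochschild g) a := fun V f g a =>
    congrFun (hochschild_prod f g rfl (Nat.add_right_comm p 1 q) (Nat.add_assoc p q 1).symm) a
  have e : (Int.negOnePow (Int.ofNat p)) = (-1 : ℤˣ) ^ p := by
    simp [Int.negOnePow_def]
  rw [e]
  rcases Nat.even_or_odd p with hp | hp
  · rw [hp.neg_one_pow, one_smul]
    refine dSec_ext fun V hV a => (key V (x.1 ⟨V, hV⟩) (y.1 ⟨V, hV⟩) a).trans ?_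
    rw [hp.neg_one_pow, _root_.one_mul]
    rfl
  · rw [hp.neg_one_pow, Units.neg_smul, one_smul]
    refine dSec_ext fun V hV a => (key V (x.1 ⟨V, hV⟩) (y.1 ⟨V, hV⟩) a).trans ?_
    rw [hp.neg_one_pow, neg_mul, _root_.one_mul]
    rfl

/-- `D_poly(X)` as an algebra in bounded below complexes of `𝒪_X`-modules. -/
noncomputable def dPolyDG : DGAlg X where
  cx := ⟨dPolyComplex π, plus_dPolyComplex π⟩
  alg := dPolyAlg π
  d_one := dPoly_d_one π
  leibniz := dPoly_leibniz π

/-- The Lie algebra, with the graded commutator as bracket, of the algebra `D_poly(X)`. -/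
noncomputable abbrev dPolyLie : DGLie X := (dPolyDG π).toDGLie

end DPoly

end PolyDiff

/-! The graded algebra of polydifferential operators is the tensor algebra of D^1 over O_X, and in
characteristic zero the Lie subalgebra generated by the degree one part of a tensor algebra is free,
with the tensor algebra as its enveloping algebra. It remains to match the differentials.

Tensor algebra. A smooth scheme is covered by affine opens with étale coordinates x_i. There an
operator is determined by its Taylor coefficients in the first argument, that is, by its values at
the powers (y - x)^α, where y is the argument and x stays outside the operator
(`IsCoordinates.eq_zero_of_taylor`). Finite order leaves finitely many coefficients. The operators
D_α = ∂^α/α! are dual to these powers, so D^{n+1} is the direct sum of the D_α · D^n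
(`exists_expansion`). Gluing gives the universal property of a tensor product for D^1 × D^n →
D^{n+1} (`exists_lift`), hence that of the tensor algebra for D (`exists_mulHom`, `mulHom_ext`).

Differential. For f in D^1 the cochain df(a, b) = a f(b) - f(ab) + f(a) b is symmetric. If locally
df = ∑ e·g, then also df = ∑ g·e, so df = (1/2) ∑ [e, g], since the graded commutator in degree one
is eg + ge. The Leibniz rule extends this from D^1 to all of L (`dStable`).

Enveloping algebra. A Lie morphism f : L → A restricts to D^1, extends to an algebra map g, and
agrees with g on L because D^1 generates L. On D^1 the map g commutes with d because d D^1 lies in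
L, where g = f; the Leibniz rule does the rest (`mulHom_comm_d`).

Freeness. This is the Dynkin–Specht–Wever argument, which needs no Poincaré–Birkhoff–Witt theorem.
Given ψ : D^1 → N, let H send a product of degree one sections to the right-normed bracket of their
images. For x in L^p one has H(x t) = [H(x)/p, H(t)] (`isAdjointCompatible`), and it follows that
H/n on L^n is a morphism of Lie algebras extending ψ. -/

namespace PolyDiff

/-! ### Étale coordinates on a smooth algebra -/

section Coordinates

/-- A derivation along the ring homomorphism `σ` that vanishes on the constants. -/
structure IsDerivationAlong {K S T : Type u} [CommRing K] [CommRing S] [CommRing T]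
    (κ : K →+* S) (σ : S →+* T) (δ : S → T) : Prop where
  add (a b : S) : δ (a + b) = δ a + δ b
  const (c : K) : δ (κ c) = 0
  mul (a b : S) : δ (a * b) = σ a * δ b + σ b * δ a

/-- A finite family of functions on a smooth algebra is a system of étale coordinates. The partial
derivatives are required after every étale extension. -/
def IsCoordinates {K R : Type u} [CommRing K] [CommRing R] (κ : K →+* R) {ι : Type}
    (x : ι → R) : Prop :=
  ∀ (S : Type u) [CommRing S] (ρ : R →+* S), ρ.Etale →
    (∃ δ : ι → S → S, ∀ i, IsDerivationAlong (ρ.comp κ) (RingHom.id S) (δ i) ∧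
      δ i (ρ (x i)) = 1 ∧ ∀ j, j ≠ i → δ i (ρ (x j)) = 0) ∧
    ∀ (T : Type u) [CommRing T] (σ : S →+* T) (δ : S → T),
      IsDerivationAlong (ρ.comp κ) σ δ → (∀ i, δ (ρ (x i)) = 0) → δ = 0

/-- A standard smooth algebra has Kähler differentials free on the differentials of some of its
generators. Dual functionals give the partial derivatives, and a derivation killing the coordinates
kills a basis. -/
theorem exists_isCoordinates {K R : Type u} [CommRing K] [CommRing R] (κ : K →+* R)
    (h : κ.IsStandardSmooth) : ∃ (ι : Type) (_ : Finite ι) (x : ι → R), IsCoordinates κ x := by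
  classical
  algebraize [κ]
  obtain ⟨ι, σ, hσ, hι, ⟨P⟩⟩ := Algebra.IsStandardSmooth.out (R := K) (S := R)
  -- The coordinates are the generators that the presentation does not pair with a relation.
  refine ⟨((Set.range P.map)ᶜ : Set _), inferInstance, fun k => P.val k, ?_⟩
  intro S _ ρ hρ
  algebraize [ρ, ρ.comp κ]
  have : Algebra.FormallyEtale R S := inferInstance
  -- As `ρ` is étale, the differentials of `S` are the base change of those of `R`, so the same
  -- differentials stay a basis.
  let b : Module.Basis ((Set.range P.map)ᶜ : Set _) S Ω[S⁄K] :=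
    (P.basisKaehler.baseChange S).map (KaehlerDifferential.tensorKaehlerEquivOfFormallyEtale K R S)
  have hb : ∀ k, b k = KaehlerDifferential.D K S (ρ (P.val k)) := by
    intro k
    simp only [b, Module.Basis.map_apply, Module.Basis.baseChange_apply,
      Algebra.SubmersivePresentation.basisKaehler_apply]
    rw [← KaehlerDifferential.tensorKaehlerEquivOfFormallyEtale_symm_D_algebraMap,
      LinearEquiv.apply_symm_apply]
    rfl
  constructor
  · let δ := fun i => (b.constr S (Pi.single (M := fun _ => S) i 1)).compDer (KaehlerDifferential.D K S)
    refine ⟨fun i => δ i, fun i => ⟨⟨fun a b => map_add _ _ _, fun c => (δ i).map_algebraMap c,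
      fun a b => (δ i).leibniz a b⟩, ?_, fun j hj => ?_⟩⟩
    all_goals
      change b.constr S (Pi.single (M := fun _ => S) i 1) (KaehlerDifferential.D K S (ρ (P.val _))) = _
      rw [← hb, Module.Basis.constr_basis]
    · simp
    · simp [hj]
  · intro T _ τ δ hδ h0
    algebraize [τ, τ.comp (ρ.comp κ)]
    let δ' : Derivation K S T := Derivation.mk'
      { toFun := δ
        map_add' := hδ.add
        map_smul' := fun c a => by
          rw [Algebra.smul_def, Algebra.smul_def]
          change δ ((ρ.comp κ) c * a) = τ ((ρ.comp κ) c) * δ a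
          rw [hδ.mul, hδ.const, mul_zero, add_zero] } (fun a b => by
            rw [Algebra.smul_def, Algebra.smul_def]
            exact hδ.mul a b)
    have : δ'.liftKaehlerDifferential = 0 := by
      refine b.ext fun k => ?_
      rw [hb, Derivation.liftKaehlerDifferential_comp_D, LinearMap.zero_apply]
      exact h0 k
    funext a
    have h2 := congrArg (fun f => f (KaehlerDifferential.D K S a)) this
    rwa [Derivation.liftKaehlerDifferential_comp_D] at h2

end Coordinates

/-! ### Affine opens with coordinates form a basis -/

section Local

variable {K : Type u} [Field K] {X : Scheme.{u}} (π : X ⟶ Spec (.of K))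

/-- Restriction is the map on sections induced by the identity of X, which is an étale morphism. -/
theorem fres_etale {V W : X.Opens} (hV : IsAffineOpen V) (hW : IsAffineOpen W) (h : W ≤ V) :
    (fres h).Etale := by
  have := Scheme.Hom.etale_appLE (𝟙 X) hV hW (by simpa using h)
  have e : (𝟙 X : X ⟶ X).appLE V W (by simpa using h) = X.presheaf.map (homOfLE h).op := by
    rw [Scheme.Hom.appLE]
    exact Category.id_comp _
  rwa [e] at this

/-- An affine open subset with étale coordinates. -/
def HasCoordinates (V : X.affineOpens) : Prop :=
  ∃ (ι : Type) (_ : Finite ι) (x : ι → Γ(X, V.1)), IsCoordinates (constants π V.1) x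

/-- An étale extension of the functions on W is one of the functions on V. This is why
`IsCoordinates` quantifies over étale extensions. -/
theorem HasCoordinates.mono {V W : X.affineOpens} (hW : W.1 ≤ V.1) (h : HasCoordinates π V) :
    HasCoordinates π W := by
  obtain ⟨ι, hι, x, hx⟩ := h
  refine ⟨ι, hι, fun i => fres hW (x i), fun S _ ρ hρ => ?_⟩
  have := hx S (ρ.comp (fres hW)) (RingHom.Etale.stableUnderComposition _ _
    (fres_etale V.2 W.2 hW) hρ)
  have e : (ρ.comp (fres hW)).comp (constants π V.1) = ρ.comp (constants π W.1) := by
    ext c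
    simp [fres_constants]
  rwa [e] at this

theorem exists_hasCoordinates [Smooth π] (U : X.Opens) {P : X} (hP : P ∈ U) :
    ∃ V : X.affineOpens, HasCoordinates π V ∧ P ∈ V.1 ∧ V.1 ≤ U := by
  obtain ⟨O, hO, V, hV, hPV, e, hs⟩ := Smooth.exists_isStandardSmooth π P
  -- The spectrum of a field is a point, so the chart of the base is everything.
  have hO' : O = ⊤ := by
    have : Subsingleton (Spec (CommRingCat.of K)) := 
      inferInstanceAs (Subsingleton (PrimeSpectrum K))
    exact top_le_iff.1 fun Q _ => Subsingleton.elim (π P) Q ▸ e hPV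
  subst hO'
  have hc : (constants π V).IsStandardSmooth := by
    have e2 : constants π V = (π.appLE ⊤ V e).hom.comp
        (Scheme.ΓSpecIso (.of K)).symm.commRingCatIsoToRingEquiv.toRingHom := by
      rfl
    rw [e2]
    exact RingHom.isStandardSmooth_respectsIso.2 _ _ hs
  obtain ⟨ι, hι, x, hx⟩ := exists_isCoordinates _ hc
  obtain ⟨Z, hZ, hPZ, hle⟩ := X.isBasis_affineOpens.exists_subset_of_mem_open
    (show P ∈ ((U ⊓ V : X.Opens) : Set X) from ⟨hP, hPV⟩) (U ⊓ V).isOpen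
  obtain ⟨Z, hZ', rfl⟩ := hZ
  exact ⟨⟨Z, hZ'⟩, HasCoordinates.mono π (V := ⟨V, hV⟩) (W := ⟨Z, hZ'⟩) (fun x hx => (hle hx).2)
    ⟨ι, hι, x, hx⟩, hPZ, fun x hx => (hle hx).1⟩

end Local

/-! ### Differential operators on a ring: commutators, derivations, monomials -/

section RingOperators

variable {R : Type u} [CommRing R] {n : ℕ} {K : Type u} [CommRing K] {κ : K →+* R}

theorem update_update_mul (i j : Fin n) (a b : R) (x : Fin n → R) :
    Function.update (Function.update x i (b * x i)) j (a * Function.update x i (b * x i) j) =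
      Function.update (Function.update x j (a * x j)) i (b * Function.update x j (a * x j) i) := by
  by_cases h : i = j
  · subst h
    simp [mul_left_comm]
  · rw [Function.update_of_ne (Ne.symm h), Function.update_of_ne h, Function.update_comm h]

theorem comm_comm (i j : Fin n) (a b : R) (f : (Fin n → R) → R) :
    comm i a (comm j b f) = comm j b (comm i a f) := by
  funext x
  simp only [comm]
  rw [update_update_mul]
  ring

theorem IsPolyDiff.comm {f : (Fin n → R) → R} (hf : IsPolyDiff κ f) (i : Fin n) (a : R) :
    IsPolyDiff κ (comm i a f) := by
  have e : PolyDiff.comm i a f =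
      (fun x => f (Function.update x i (a * x i))) + fun x => (-a) * f x := by
    funext x; simp [PolyDiff.comm]; ring
  rw [e]
  refine IsPolyDiff.add ?_ (hf.mul_const _)
  obtain ⟨hf, N, hN⟩ := hf
  have key : ∀ (x : Fin n → R) (j : Fin n), ∃ w : R, ∀ v : R,
      Function.update (Function.update x j v) i (a * Function.update x j v i) =
        Function.update (Function.update x i (a * x i)) j (w * v) := by
    intro x j
    by_cases h : j = i
    · subst h
      exact ⟨a, fun v => by simp⟩
    · exact ⟨1, fun v => by
        rw [Function.update_of_ne (Ne.symm h), Function.update_comm h, one_mul]⟩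
  refine ⟨⟨fun x j b c => ?_, fun x j k b => ?_⟩, N, fun j => ?_⟩
  · obtain ⟨w, hw⟩ := key x j
    simp only [hw, mul_add, hf.1]
  · obtain ⟨w, hw⟩ := key x j
    simp only [hw, mul_left_comm w, hf.2]
  · have := OrderLE.comp (i := j) (j := j) (fun x => Function.update x i (a * x i)) (fun _ => 1)
      (fun x b => update_update_mul j i a b x) (fun _ _ => rfl) (hN j)
    simpa using this

theorem IsPolyDiff.cons {f : (Fin (n + 1) → R) → R} (hf : IsPolyDiff κ f) (a : R) :
    IsPolyDiff κ (fun x : Fin n → R => f (Fin.cons (α := fun _ => R) a x)) := by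
  obtain ⟨hf, N, hN⟩ := hf
  refine ⟨⟨fun x j b c => ?_, fun x j k b => ?_⟩, N, fun j => ?_⟩
  · simp only [Fin.cons_update, hf.1]
  · simp only [Fin.cons_update, hf.2]
  · have := OrderLE.comp (i := j) (j := j.succ)
      (fun x : Fin n → R => Fin.cons (α := fun _ => R) a x) (fun _ => 1)
      (fun x b => by rw [Fin.cons_update, Fin.cons_succ]) (fun _ _ => rfl) (hN j.succ)
    simpa using this

theorem OrderLE.map_mul {f : (Fin n → R) → R} {i : Fin n}
    (hf : OrderLE i 0 f) (x : Fin n → R) (a : R) :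
    f (Function.update x i (a * x i)) = a * f x := by
  have := congrFun (hf a) x
  simpa [comm, sub_eq_zero] using this

/-- A differential operator that commutes with étale coordinates is linear over functions. -/
theorem OrderLE.of_comm_eq_zero {ι : Type} {x : ι → R}
    (hx : ∀ δ : R → R, IsDerivationAlong κ (RingHom.id R) δ → (∀ i, δ (x i) = 0) → δ = 0)
    {i : Fin n} {N : ℕ} {f : (Fin n → R) → R} (hf : IsPolyDiff κ f) (hN : OrderLE i N f)
    (h : ∀ j, comm i (x j) f = 0) : OrderLE i 0 f := by
  -- In order at most one, a ↦ f(…, a, …) - a f(…, 1, …) is a derivation. It kills the coordinates,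
  -- hence vanishes, which is linearity in the i-th argument.
  have base : ∀ f : (Fin n → R) → R, IsPolyDiff κ f → OrderLE i 1 f →
      (∀ j, comm i (x j) f = 0) → OrderLE i 0 f := by
    intro f hf hN h
    have e1 : ∀ (y : Fin n → R) (a : R), f (Function.update y i a) -
        a * f (Function.update y i 1) = comm i a f (Function.update y i 1) := by
      intro y a; simp [comm]
    have key : ∀ y : Fin n → R, (fun a => f (Function.update y i a) -
        a * f (Function.update y i 1)) = 0 := by
      intro y
      refine hx _ ⟨fun a b => ?_, fun c => ?_, fun a b => ?_⟩ fun j => ?_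
      · rw [hf.1.1]; ring
      · have := hf.1.2 y i c 1
        rw [mul_one] at this
        rw [this, sub_self]
      · have := congrFun (hN a b) (Function.update y i 1)
        simp only [comm, Function.update_idem, Function.update_self, mul_one, Pi.zero_apply] at this
        simp only [RingHom.id_apply]
        linear_combination this
      · rw [e1, h j, Pi.zero_apply]
    intro a
    funext y
    have h1 := congrFun (key y) (a * y i)
    have h2 := congrFun (key y) (y i)
    simp only [Pi.zero_apply, Function.update_eq_self] at h1 h2
    simp only [comm, Pi.zero_apply]
    linear_combination h1 - a * h2
  induction N generalizing f with
  | zero => exact hN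
  | succ N ih =>
    cases N with
    | zero => exact base f hf hN h
    | succ N =>
      -- Commutators with functions commute, so `comm i a f` again commutes with the coordinates. By
      -- induction it is linear for every `a`, so `f` has order at most one.
      refine base f hf (fun a => ih (hf.comm i a) (hN a) fun j => ?_) h
      rw [comm_comm, h j]
      funext y
      simp [comm]

/-- By the Leibniz rule, [f ∘ δ, a] = [f, a] ∘ δ + f ∘ (δ a), where δ a acts by multiplication. The
first term is handled by induction and the second has the order of `f`. -/
theorem OrderLE.comp_derivation {δ : R → R} (hδ : IsDerivationAlong κ (RingHom.id R) δ) {N : ℕ}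
    {f : (Fin 1 → R) → R} (hf : IsPolyDiff κ f) (hN : OrderLE 0 N f) :
    OrderLE 0 (N + 1) (fun x : Fin 1 → R => f (fun _ => δ (x 0))) := by
  have e : ∀ (f : (Fin 1 → R) → R), IsPolyDiff κ f → ∀ (a : R),
      comm 0 a (fun x : Fin 1 → R => f (fun _ => δ (x 0))) = (fun x => comm 0 a f (fun _ => δ (x 0))) +
        fun x => f (fun _ => δ a * x 0) := by
    intro f hf a
    funext x
    have h0 : ∀ (y : Fin 1 → R) (v : R), Function.update y 0 v = fun _ => v := by
      intro y v; funext k; obtain rfl : k = 0 := Subsingleton.elim _ _; simp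
    have h1 := hf.1.1 x 0 (a * δ (x 0)) (δ a * x 0)
    simp only [comm, h0, Pi.add_apply, hδ.mul, RingHom.id_apply] at h1 ⊢
    rw [mul_comm (x 0), h1]
    ring
  have h2 : ∀ (a : R) (N : ℕ) (f : (Fin 1 → R) → R), OrderLE 0 N f →
      OrderLE 0 N (fun x : Fin 1 → R => f (fun _ => δ a * x 0)) := by
    intro a N f hf
    have := OrderLE.comp (i := (0 : Fin 1)) (j := (0 : Fin 1))
      (fun x : Fin 1 → R => fun _ => δ a * x 0) (fun _ => 1) (fun x b => by
        funext k; obtain rfl : k = 0 := Subsingleton.elim _ _; simp [mul_left_comm])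
        (fun _ _ => rfl) hf
    simpa using this
  induction N generalizing f with
  | zero =>
    intro a
    rw [e f hf a, hN a]
    refine OrderLE.add ?_ (h2 a 0 f hN)
    exact OrderLE.zero 0 0
  | succ N ih =>
    intro a
    rw [e f hf a]
    exact (ih (hf.comm 0 a) (hN a)).add (h2 a (N + 1) f hN)

theorem IsPolyDiff.comp_derivation {δ : R → R} (hδ : IsDerivationAlong κ (RingHom.id R) δ)
    {f : (Fin 1 → R) → R} (hf : IsPolyDiff κ f) :
    IsPolyDiff κ (fun x : Fin 1 → R => f (fun _ => δ (x 0))) := by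
  have h0 : ∀ (y : Fin 1 → R) (v : R), Function.update y 0 v = fun _ => v := by
    intro y v; funext k; obtain rfl : k = 0 := Subsingleton.elim _ _; simp
  have hf' := hf
  obtain ⟨hf, N, hN⟩ := hf
  refine ⟨⟨fun x j b c => ?_, fun x j k b => ?_⟩, N + 1, fun j => ?_⟩ <;>
    obtain rfl : j = 0 := Subsingleton.elim _ _
  · have := hf.1 x 0 (δ b) (δ c)
    simpa only [h0, hδ.add] using this
  · have := hf.2 x 0 k (δ b)
    simpa only [h0, hδ.mul, hδ.const, mul_zero, add_zero, RingHom.id_apply] using this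
  · exact OrderLE.comp_derivation hδ hf' (hN 0)

/-- The monomial with exponents `α` in the functions `x`. -/
def monom {ι : Type} (x : ι → R) (α : ι →₀ ℕ) : R := α.prod fun i k => x i ^ k

theorem monom_single_add {ι : Type} (x : ι → R) (i : ι) (α : ι →₀ ℕ) :
    monom x (Finsupp.single i 1 + α) = x i * monom x α := by
  classical
  rw [monom, Finsupp.prod_add_index' (fun _ => pow_zero _) (fun _ _ _ => pow_add _ _ _),
    Finsupp.prod_single_index (h := fun i k => x i ^ k) (pow_zero _), pow_one, monom]

theorem map_monom {S : Type u} [CommRing S] (ρ : R →+* S) {ι : Type} (x : ι → R) (α : ι →₀ ℕ) :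
    ρ (monom x α) = monom (fun i => ρ (x i)) α := by
  simp [monom, Finsupp.prod, map_prod]

/-- Evaluating polynomials with constant coefficients at `x` intertwines the formal partial
derivative with `δ`; monomials are a special case. -/
theorem IsDerivationAlong.monom {δ : R → R} (hδ : IsDerivationAlong κ (RingHom.id R) δ) {ι : Type}
    {x : ι → R} {i : ι} (hi : δ (x i) = 1) (hj : ∀ j, j ≠ i → δ (x j) = 0) (α : ι →₀ ℕ) :
    δ (monom x α) = κ (α i) * monom x (α - Finsupp.single i 1) := by
  classical
  have key : ∀ p : MvPolynomial ι K, δ (p.eval₂ κ x) = (MvPolynomial.pderiv i p).eval₂ κ x := by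
    intro p
    induction p using MvPolynomial.induction_on with
    | C a => simp [hδ.const]
    | add p q hp hq => simp [hδ.add, hp, hq]
    | mul_X p j hp =>
      simp only [MvPolynomial.eval₂_mul, hδ.mul, hp, MvPolynomial.eval₂_X, Derivation.leibniz,
        smul_eq_mul, MvPolynomial.eval₂_add, RingHom.id_apply, MvPolynomial.pderiv_X]
      congr 2
      by_cases h : j = i
      · subst h; simp [hi]
      · rw [hj j h]; simp [h]
  have := key (MvPolynomial.monomial α 1)
  rw [MvPolynomial.pderiv_monomial, MvPolynomial.eval₂_monomial, MvPolynomial.eval₂_monomial] at this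
  simpa [PolyDiff.monom] using this

end RingOperators

/-! ### Taylor coefficients of sections in their first argument -/

section SectionOperators

variable {K : Type u} [Field K] {X : Scheme.{u}} {π : X ⟶ Spec (.of K)} {n : ℕ} {U : X.Opens}

noncomputable instance : AddCommGroup (dSec π n U) :=
  AddSubgroup.toAddCommGroup (dSec π n U)

noncomputable instance : AddCommMonoid (dSec π n U) :=
  (AddSubgroup.toAddCommGroup (dSec π n U)).toAddCommMonoid

theorem fres_cons {V W : X.Opens} (h : W ≤ V) (r : Γ(X, V)) (a : Fin n → Γ(X, V)) :
    (fun i => fres h (Fin.cons (α := fun _ => Γ(X, V)) r a i)) =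
      Fin.cons (α := fun _ => Γ(X, W)) (fres h r) (fun i => fres h (a i)) := by
  funext i
  refine Fin.cases ?_ (fun i => ?_) i <;> simp

theorem fres_update {V W : X.Opens} (h : W ≤ V) (a : Fin n → Γ(X, V)) (i : Fin n) (r : Γ(X, V)) :
    (fun k => fres h (Function.update a i r k)) =
      Function.update (fun k => fres h (a k)) i (fres h r) := by
  funext k
  by_cases hk : k = i
  · subst hk; simp
  · simp [hk]

/-- The sections of a polydifferential operator, with a function substituted for the first
argument. -/
noncomputable def dPlug (r : Γ(X, U)) : dSec π (n + 1) U →ₗ[Γ(X, U)] dSec π n U where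
  toFun s := ⟨fun W a => s.1 W (Fin.cons (α := fun _ => Γ(X, W.1.1)) (fres W.2 r) a),
    fun W hW => (s.2.1 W hW).cons _, fun V W hV hW a => by
      rw [s.2.2 V W hV hW, fres_cons, fres_fres]⟩
  map_add' _ _ := rfl
  map_smul' _ _ := rfl

/-- The commutator of a polydifferential operator in its first argument with a function. -/
noncomputable def dComm (r : Γ(X, U)) : dSec π (n + 1) U →ₗ[Γ(X, U)] dSec π (n + 1) U where
  toFun s := ⟨fun W => comm 0 (fres W.2 r) (s.1 W),
    fun W hW => (s.2.1 W hW).comm _ _, fun V W hV hW a => by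
      simp only [comm, map_sub, map_mul]
      rw [s.2.2 V W hV hW, s.2.2 V W hV hW, fres_update, map_mul, fres_fres]⟩
  map_add' s t := dSec_ext fun W hW a => congrFun (comm_add 0 (fres hW r) _ _) a
  map_smul' r' s := dSec_ext fun W hW a => congrFun (comm_mul_const 0 (fres hW r) _ _) a

theorem dPlug_dComm (r r' : Γ(X, U)) (s : dSec π (n + 1) U) :
    dPlug r (dComm r' s) = dPlug (r' * r) s - r' • dPlug r s := by
  refine dSec_ext fun W hW a => ?_
  change comm 0 (fres hW r') (s.1 ⟨W, hW⟩) _ = s.1 ⟨W, hW⟩ _ - fres hW r' * s.1 ⟨W, hW⟩ _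
  simp only [comm, Fin.cons_zero, map_mul, Fin.update_cons_zero]

/-- The value of a polydifferential operator at a polynomial, in formal variables with values `x`,
as first argument; it is linear over functions. -/
noncomputable def dEval {ι : Type} (x : ι → Γ(X, U)) :
    dSec π (n + 1) U →ₗ[Γ(X, U)] MvPolynomial ι Γ(X, U) →ₗ[Γ(X, U)] dSec π n U :=
  ((MvPolynomial.basisMonomials ι Γ(X, U)).constr Γ(X, U)).toLinearMap ∘ₗ
    LinearMap.pi fun α => dPlug (monom x α)

theorem dEval_monomial {ι : Type} (x : ι → Γ(X, U)) (s : dSec π (n + 1) U) (α : ι →₀ ℕ)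
    (r : Γ(X, U)) : dEval x s (MvPolynomial.monomial α r) = r • dPlug (monom x α) s := by
  have : MvPolynomial.monomial α r = r • MvPolynomial.basisMonomials ι Γ(X, U) α := by
    rw [MvPolynomial.coe_basisMonomials, MvPolynomial.smul_monomial, smul_eq_mul, mul_one]
  rw [this, map_smul]
  congr 1
  exact Module.Basis.constr_basis _ Γ(X, U) _ _

/-- A coordinate inside the operator is the formal variable, and outside it is a coefficient. The
commutator is therefore multiplication by their difference. -/
theorem dEval_dComm {ι : Type} (x : ι → Γ(X, U)) (s : dSec π (n + 1) U) (i : ι)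
    (p : MvPolynomial ι Γ(X, U)) : dEval x (dComm (x i) s) p =
      dEval x s ((MvPolynomial.X i - MvPolynomial.C (x i)) * p) := by
  induction p using MvPolynomial.induction_on' with
  | add p q hp hq => rw [map_add, hp, hq, mul_add, map_add]
  | monomial α r =>
    rw [sub_mul, MvPolynomial.X, MvPolynomial.monomial_mul, MvPolynomial.C_mul_monomial, map_sub,
      dEval_monomial, dEval_monomial, dEval_monomial, dPlug_dComm, one_mul, monom_single_add,
      smul_sub, smul_smul, mul_comm r]

/-- The translation of formal variables by the functions `x`. -/
noncomputable def translate {R : Type u} [CommRing R] {ι : Type} (x : ι → R) :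
    MvPolynomial ι R →ₐ[R] MvPolynomial ι R :=
  MvPolynomial.aeval fun i => MvPolynomial.X i - MvPolynomial.C (x i)

theorem translate_X_mul {R : Type u} [CommRing R] {ι : Type} (x : ι → R) (i : ι)
    (p : MvPolynomial ι R) : translate x (MvPolynomial.X i * p) =
      (MvPolynomial.X i - MvPolynomial.C (x i)) * translate x p := by
  simp [translate]

theorem pderiv_translate {R : Type u} [CommRing R] {ι : Type} (x : ι → R) (i : ι)
    (p : MvPolynomial ι R) :
    MvPolynomial.pderiv i (translate x p) = translate x (MvPolynomial.pderiv i p) := by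
  classical
  induction p using MvPolynomial.induction_on with
  | C a => simp [translate]
  | add p q hp hq => simp [hp, hq]
  | mul_X p j hp =>
    have hX : translate x (MvPolynomial.X j) = MvPolynomial.X j - MvPolynomial.C (x j) := by
      simp [translate]
    rw [map_mul, Derivation.leibniz, Derivation.leibniz, hp, hX]
    simp only [smul_eq_mul, map_add, map_mul, map_sub, hX, MvPolynomial.pderiv_C, sub_zero]
    congr 2
    by_cases h : j = i
    · subst h; simp
    · simp [MvPolynomial.pderiv_X, h]

theorem eval_translate {R : Type u} [CommRing R] {ι : Type} (x : ι → R) (p : MvPolynomial ι R) :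
    MvPolynomial.eval x (translate x p) = MvPolynomial.constantCoeff p := by
  induction p using MvPolynomial.induction_on with
  | C a => simp [translate]
  | add p q hp hq => simp [hp, hq]
  | mul_X p j hp => rw [mul_comm, translate_X_mul]; simp

/-- The Taylor coefficients of a polydifferential operator in its first argument: the coefficient
with exponent `α` is the value at the monomial with exponent `α`. -/
noncomputable def taylor {ι : Type} (x : ι → Γ(X, U)) :
    dSec π (n + 1) U →ₗ[Γ(X, U)] MvPolynomial ι Γ(X, U) →ₗ[Γ(X, U)] dSec π n U :=
  LinearMap.lcomp _ _ (translate x).toLinearMap ∘ₗ dEval x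

theorem taylor_apply {ι : Type} (x : ι → Γ(X, U)) (s : dSec π (n + 1) U)
    (p : MvPolynomial ι Γ(X, U)) : taylor x s p = dEval x s (translate x p) := rfl

/-- After the translation, taking a commutator with a coordinate just shifts the Taylor
coefficients. This drives every induction on the order below. -/
theorem taylor_dComm {ι : Type} (x : ι → Γ(X, U)) (s : dSec π (n + 1) U) (i : ι)
    (p : MvPolynomial ι Γ(X, U)) :
    taylor x (dComm (x i) s) p = taylor x s (MvPolynomial.X i * p) := by
  rw [taylor_apply, taylor_apply, dEval_dComm, translate_X_mul]

theorem taylor_one {ι : Type} (x : ι → Γ(X, U)) (s : dSec π (n + 1) U) :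
    taylor x s 1 = dPlug 1 s := by
  rw [taylor_apply, map_one, ← MvPolynomial.C_1, ← MvPolynomial.monomial_zero', dEval_monomial,
    one_smul]
  simp [monom]

variable (π) in
/-- A compatible family of derivations. -/
structure DerivationFamily (U : X.Opens) where
  app (W : X.affineOpens) (hW : W.1 ≤ U) : Γ(X, W.1) → Γ(X, W.1)
  isDerivation (W : X.affineOpens) (hW : W.1 ≤ U) :
    IsDerivationAlong (constants π W.1) (RingHom.id _) (app W hW)
  res (V W : X.affineOpens) (hV : V.1 ≤ U) (hW : W.1 ≤ V.1) (a : Γ(X, V.1)) :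
    fres hW (app V hV a) = app W (hW.trans hV) (fres hW a)

/-- The composite of a differential operator with a derivation. -/
noncomputable def DerivationFamily.comp (δ : DerivationFamily π U) (s : dSec π 1 U) : dSec π 1 U :=
  ⟨fun W a => s.1 W fun _ => δ.app W.1 W.2 (a 0),
    fun W hW => (s.2.1 W hW).comp_derivation (δ.isDerivation W hW), fun V W hV hW a => by
      rw [s.2.2 V W hV hW, δ.res]⟩

/-- Precomposing with the i-th partial derivative is the formal derivative on monomials. Both sides
are linear in the coefficients, which never enter the operator. -/
theorem dEval_comp {ι : Type} (x : ι → Γ(X, U)) (i : ι) (δ : DerivationFamily π U)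
    (hi : ∀ W hW, δ.app W hW (fres hW (x i)) = 1)
    (hj : ∀ W hW j, j ≠ i → δ.app W hW (fres hW (x j)) = 0) (s : dSec π 1 U)
    (p : MvPolynomial ι Γ(X, U)) : dEval x (δ.comp s) p =
      dEval x s (MvPolynomial.pderiv i p) := by
  induction p using MvPolynomial.induction_on' with
  | add p q hp hq => rw [map_add, hp, hq, map_add, map_add]
  | monomial α r =>
    rw [MvPolynomial.pderiv_monomial, dEval_monomial, dEval_monomial, mul_smul]
    congr 1
    refine dSec_ext fun W hW a => ?_
    change s.1 ⟨W, hW⟩ (fun _ => δ.app W hW (fres hW (monom x α))) =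
      fres hW (α i : Γ(X, U)) * s.1 ⟨W, hW⟩ _
    rw [map_monom, (δ.isDerivation W hW).monom (hi W hW) (hj W hW)]
    have h0 : ∀ v : Γ(X, W.1), (fun _ => v) =
        Function.update (0 : Fin 1 → Γ(X, W.1)) 0 v := by
      intro v; funext k; obtain rfl : k = 0 := Subsingleton.elim _ _; simp
    -- The exponent is a constant of `K`, so multilinearity moves it out of the operator.
    rw [h0, (s.2.1 W hW).1.2, ← h0, map_natCast, map_natCast]
    refine congrArg (_ * ·) (congrArg (s.1 ⟨W, hW⟩) (funext fun k => ?_))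
    obtain rfl : k = 0 := Subsingleton.elim _ _
    rw [Fin.cons_zero, map_monom]

theorem taylor_comp {ι : Type} (x : ι → Γ(X, U)) (i : ι) (δ : DerivationFamily π U)
    (hi : ∀ W hW, δ.app W hW (fres hW (x i)) = 1)
    (hj : ∀ W hW j, j ≠ i → δ.app W hW (fres hW (x j)) = 0) (s : dSec π 1 U)
    (p : MvPolynomial ι Γ(X, U)) : taylor x (δ.comp s) p =
      taylor x s (MvPolynomial.pderiv i p) := by
  rw [taylor_apply, taylor_apply, dEval_comp x i δ hi hj, pderiv_translate]

variable (π U) in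
/-- The unit section in degree zero. -/
noncomputable def dSecOne : dSec π 0 U :=
  ⟨fun _ _ => 1, fun _ _ =>
    ⟨⟨fun _ i => i.elim0, fun _ i => i.elim0⟩, 0, fun i => i.elim0⟩, fun _ _ _ _ _ => map_one _⟩

variable (π U) in
/-- The identity as a differential operator. -/
noncomputable def dSecId : dSec π 1 U :=
  ⟨fun _ a => a 0, fun _ _ => isPolyDiff_id, fun _ _ _ _ _ => rfl⟩

/-- For the identity operator `dEval` is evaluation at `x`, which undoes the translation up to the
constant term. So the identity is the dual operator of exponent zero. -/
theorem taylor_dSecId {ι : Type} (x : ι → Γ(X, U)) (p : MvPolynomial ι Γ(X, U)) :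
    taylor x (dSecId π U) p = MvPolynomial.constantCoeff p • dSecOne π U := by
  rw [← eval_translate x, taylor_apply]
  generalize translate x p = p
  induction p using MvPolynomial.induction_on' with
  | add p q hp hq => rw [map_add, hp, hq, map_add, add_smul]
  | monomial α r =>
    rw [dEval_monomial, MvPolynomial.eval_monomial, mul_smul]
    congr 1
    refine dSec_ext fun W hW a => ?_
    exact (mul_one _).symm

/-- The product of sections as a bilinear map. -/
noncomputable def dSecMulₗ (π : X ⟶ Spec (.of K)) (U : X.Opens) {p q n : ℕ} (h : p + q = n) :
    dSec π p U →ₗ[Γ(X, U)] dSec π q U →ₗ[Γ(X, U)] dSec π n U :=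
  LinearMap.mk₂ Γ(X, U) (dSecMul π h U)
    (fun _ _ _ => dSec_ext fun _ _ _ => add_mul _ _ _)
    (fun _ _ _ => dSec_ext fun _ _ _ => mul_assoc _ _ _)
    (fun _ _ _ => dSec_ext fun _ _ _ => mul_add _ _ _)
    (fun _ _ _ => dSec_ext fun _ _ _ => mul_left_comm _ _ _)

theorem dSecMulₗ_one (g : dSec π n U) : dSecMulₗ π U (Nat.zero_add n) (dSecOne π U) g = g :=
  dSec_ext fun W hW a => congrFun (one_prod (Nat.zero_add n) (g.1 ⟨W, hW⟩)) a

/-- The first argument of the product is seen by `e` only, so `g` is carried along as a factor. -/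
theorem taylor_mul {ι : Type} (x : ι → Γ(X, U)) (e : dSec π 1 U) (g : dSec π n U)
    (p : MvPolynomial ι Γ(X, U)) : taylor x (dSecMulₗ π U (Nat.add_comm 1 n) e g) p =
      dSecMulₗ π U (Nat.zero_add n) (taylor x e p) g := by
  rw [taylor_apply, taylor_apply]
  generalize translate x p = p
  induction p using MvPolynomial.induction_on' with
  | add p q hp hq => rw [map_add, hp, hq, map_add, map_add]; rfl
  | monomial α r =>
    rw [dEval_monomial, dEval_monomial, map_smul]
    change _ = r • dSecMulₗ π U (Nat.zero_add n) _ g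
    congr 1
    refine dSec_ext fun W hW a => ?_
    change prod (Nat.add_comm 1 n) (e.1 ⟨W, hW⟩) (g.1 ⟨W, hW⟩) _ =
      prod (Nat.zero_add n) (fun b => e.1 ⟨W, hW⟩ (Fin.cons _ b)) (g.1 ⟨W, hW⟩) a
    simp only [prod]
    refine congrArg₂ (· * ·) (congrArg (e.1 ⟨W, hW⟩) (funext fun k => ?_))
      (congrArg (g.1 ⟨W, hW⟩) (funext fun k => ?_))
    · obtain rfl : k = 0 := Subsingleton.elim _ _
      rfl
    · have : Fin.cast (Nat.add_comm 1 n) (Fin.natAdd 1 k) = k.succ := by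
        ext; simp
      rw [this, Fin.cons_succ]
      congr 1
      ext; simp

end SectionOperators

/-! ### Taylor expansion on a coordinate open -/

section TaylorExpansion

variable {K : Type u} [Field K] {X : Scheme.{u}} {π : X ⟶ Spec (.of K)} {n : ℕ}
  {V : X.affineOpens} {ι : Type} {x : ι → Γ(X, V.1)}

theorem IsCoordinates.vanish (hx : IsCoordinates (constants π V.1) x) (W Z : X.affineOpens)
    (hW : W.1 ≤ V.1) (hZ : Z.1 ≤ W.1) (δ : Γ(X, W.1) → Γ(X, Z.1))
    (hδ : IsDerivationAlong (constants π W.1) (fres hZ) δ) (h : ∀ i, δ (fres hW (x i)) = 0) :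
    δ = 0 := by
  refine (hx _ (fres hW) (fres_etale V.2 W.2 hW)).2 _ (fres hZ) δ ?_ h
  convert hδ using 1
  ext c
  exact fres_constants π hW c

theorem IsCoordinates.exists_derivationFamily (hx : IsCoordinates (constants π V.1) x) (i : ι) :
    ∃ δ : DerivationFamily π V.1, (∀ W hW, δ.app W hW (fres hW (x i)) = 1) ∧
      ∀ W hW j, j ≠ i → δ.app W hW (fres hW (x j)) = 0 := by
  have h : ∀ (W : X.affineOpens) (hW : W.1 ≤ V.1), ∃ δ : Γ(X, W.1) → Γ(X, W.1),
      IsDerivationAlong (constants π W.1) (RingHom.id _) δ ∧ δ (fres hW (x i)) = 1 ∧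
      ∀ j, j ≠ i → δ (fres hW (x j)) = 0 := by
    intro W hW
    obtain ⟨δ, hδ⟩ := (hx _ (fres hW) (fres_etale V.2 W.2 hW)).1
    refine ⟨δ i, ?_, (hδ i).2⟩
    convert (hδ i).1 using 1
    ext c
    exact (fres_constants π hW c).symm
  choose δ h1 h2 h3 using h
  refine ⟨⟨δ, h1, fun W Z hW hZ a => ?_⟩, h2, h3⟩
  -- The failure of compatibility with restriction is a derivation along the restriction that kills
  -- all coordinates.
  have := hx.vanish W Z hW hZ (fun a => fres hZ (δ W hW a) - δ Z (hZ.trans hW) (fres hZ a))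
    ⟨fun a b => ?_, fun c => ?_, fun a b => ?_⟩ fun j => ?_
  · exact sub_eq_zero.1 (congrFun this a)
  · simp only [map_add, (h1 _ _).add]; ring
  · simp only [(h1 _ _).const, fres_constants, map_zero, sub_zero]
  · simp only [map_mul, (h1 _ _).mul, map_add, RingHom.id_apply]; ring
  · rw [fres_fres]
    by_cases hj : j = i
    · subst hj
      rw [h2, h2, map_one, sub_self]
    · rw [h3 _ _ _ hj, h3 _ _ _ hj, map_zero, sub_self]

/-- Induction on the order over each smaller affine open. Commutators with coordinates have
vanishing Taylor coefficients and lower order, hence vanish there. The operator is then linear in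
its first argument, so it is determined by its value at 1, the constant Taylor coefficient. -/
theorem IsCoordinates.eq_zero_of_taylor (hx : IsCoordinates (constants π V.1) x)
    (s : dSec π (n + 1) V.1) (hs : ∀ p, taylor x s p = 0) : s = 0 := by
  refine Subtype.ext (funext fun W => ?_)
  obtain ⟨W, hW⟩ := W
  have lin : ∀ s : dSec π (n + 1) V.1, (∀ p, taylor x s p = 0) →
      OrderLE 0 0 (s.1 ⟨W, hW⟩) → s.1 ⟨W, hW⟩ = 0 := by
    intro s hs h0
    funext a
    have h1 := OrderLE.map_mul h0 (Function.update a 0 1) (a 0)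
    simp only [Function.update_self, mul_one, Function.update_idem, Function.update_eq_self] at h1
    have h2 := hs 1
    rw [taylor_one] at h2
    have h3 : s.1 ⟨W, hW⟩ (Fin.cons (fres hW 1) (Fin.tail a)) = 0 :=
      congrFun (congrFun (congrArg Subtype.val h2) ⟨W, hW⟩) (Fin.tail a)
    rw [h1]
    rw [map_one] at h3
    have h4 : Function.update a 0 1 = Fin.cons (α := fun _ => Γ(X, W.1)) 1 (Fin.tail a) := by
      conv_lhs => rw [← Fin.cons_self_tail a, Fin.update_cons_zero]
    rw [h4, h3, mul_zero]
    rfl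
  have key : ∀ (N : ℕ) (s : dSec π (n + 1) V.1), (∀ p, taylor x s p = 0) →
      OrderLE 0 N (s.1 ⟨W, hW⟩) → s.1 ⟨W, hW⟩ = 0 := by
    intro N
    induction N with
    | zero => exact lin
    | succ N ih =>
      intro s hs hN
      refine lin s hs (OrderLE.of_comm_eq_zero (x := fun i => fres hW (x i))
        (hx.vanish W W hW le_rfl · <| by convert · using 1; ext; exact fres_self _)
        (s.2.1 W hW) hN fun j => ?_)
      exact ih (dComm (x j) s) (fun p => by rw [taylor_dComm, hs]) (hN _)
  obtain ⟨N, hN⟩ := (s.2.1 W hW).2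
  exact key N s hs (hN 0)

/-- The Taylor coefficients come from arguments defined on all of `V`. So an operator vanishing on
the functions of `V` has vanishing coefficients, by induction on the number of arguments, and
vanishes on every smaller affine open. -/
theorem IsCoordinates.eq_zero_of_self (hx : IsCoordinates (constants π V.1) x)
    (s : dSec π n V.1) (hs : s.1 ⟨V, le_rfl⟩ = 0) : s = 0 := by
  induction n with
  | zero =>
    refine dSec_ext fun W hW a => ?_
    have := s.2.2 V W le_rfl hW (fun i => i.elim0)
    rw [hs, Pi.zero_apply, map_zero] at this
    rw [Subsingleton.elim a fun i => fres hW (i.elim0)]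
    exact this.symm
  | succ n ih =>
    refine hx.eq_zero_of_taylor s fun p => ?_
    rw [taylor_apply]
    generalize translate x p = p
    induction p using MvPolynomial.induction_on' with
    | add p q hp hq => rw [map_add, hp, hq, add_zero]
    | monomial α r =>
      rw [dEval_monomial, ih (dPlug (monom x α) s), smul_zero]
      funext a
      exact congrFun hs _

/-- A coefficient of degree above the order is a coefficient of an iterated commutator with more
coordinates than the order allows, which is zero. The order bound is taken over `V` alone, so
`IsCoordinates.eq_zero_of_self` is needed to kill the whole family. -/
theorem IsCoordinates.finite_taylor [Finite ι] (hx : IsCoordinates (constants π V.1) x)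
    (s : dSec π (n + 1) V.1) :
    (Function.support fun α => taylor x s (MvPolynomial.monomial α 1)).Finite := by
  have key : ∀ (N : ℕ) (s : dSec π (n + 1) V.1), OrderLE 0 N (s.1 ⟨V, le_rfl⟩) →
      ∀ α : ι →₀ ℕ, N < α.degree → taylor x s (MvPolynomial.monomial α 1) = 0 := by
    have step : ∀ α : ι →₀ ℕ, α ≠ 0 → ∃ i β, α = Finsupp.single i 1 + β ∧ 
        β.degree + 1 = α.degree ∧ ∀ s : dSec π (n + 1) V.1, taylor x s (MvPolynomial.monomial α 1) =
          taylor x (dComm (x i) s) (MvPolynomial.monomial β 1) := by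
      intro α hα
      obtain ⟨i, hi⟩ := Finsupp.ne_iff.1 hα
      have e : α = Finsupp.single i 1 + (α - Finsupp.single i 1) := by
        rw [add_tsub_cancel_of_le]
        rw [Finsupp.single_le_iff]
        exact Nat.one_le_iff_ne_zero.2 hi
      refine ⟨i, α - Finsupp.single i 1, e, ?_, fun s => ?_⟩
      · conv_rhs => rw [e, map_add, Finsupp.degree_single]
        rw [add_comm]
      · rw [taylor_dComm, MvPolynomial.X, MvPolynomial.monomial_mul, one_mul, ← e]
    intro N
    induction N with
    | zero =>
      intro s hs α hα
      obtain ⟨i, β, -, -, h⟩ := step α (by rintro rfl; simp at hα)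
      rw [h, hx.eq_zero_of_self (dComm (x i) s), map_zero, LinearMap.zero_apply]
      exact hs _
    | succ N ih =>
      intro s hs α hα
      obtain ⟨i, β, -, hβ, h⟩ := step α (by rintro rfl; simp at hα)
      rw [h, ih _ (hs _) β (by omega)]
  obtain ⟨N, hN⟩ := (s.2.1 V le_rfl).2
  refine (Finsupp.finite_of_degree_le N).subset fun α hα => ?_
  by_contra h
  exact hα (key N s (hN 0) α (not_le.1 h))

/-- The dual operators are the divided powers ∂^α/α!, built one partial derivative at a time. -/
theorem IsCoordinates.exists_dual [CharZero K] (hx : IsCoordinates (constants π V.1) x) :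
    ∃ D : (ι →₀ ℕ) → dSec π 1 V.1, ∀ α p,
      taylor x (D α) p = MvPolynomial.coeff α p • dSecOne π V.1 := by
  suffices h : ∀ α : ι →₀ ℕ, ∃ D : dSec π 1 V.1, ∀ p,
      taylor x D p = MvPolynomial.coeff α p • dSecOne π V.1 by
    choose D hD using h
    exact ⟨D, hD⟩
  intro α
  generalize hN : α.degree = N
  induction N generalizing α with
  | zero =>
    rw [Finsupp.degree_eq_zero_iff] at hN
    subst hN
    exact ⟨dSecId π V.1, fun p => taylor_dSecId x p⟩
  | succ N ih =>
    obtain ⟨i, hi⟩ := Finsupp.ne_iff.1 (show α ≠ 0 by rintro rfl; simp at hN)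
    have e : (α - Finsupp.single i 1) + Finsupp.single i 1 = α := by
      rw [tsub_add_cancel_of_le]
      rw [Finsupp.single_le_iff]
      exact Nat.one_le_iff_ne_zero.2 hi
    obtain ⟨D, hD⟩ := ih (α - Finsupp.single i 1) (by
      rw [← e, map_add, Finsupp.degree_single] at hN
      omega)
    obtain ⟨δ, h1, h2⟩ := hx.exists_derivationFamily i
    -- The formal derivative multiplies the coefficient of exponent α by α_i, whence the inverse;
    -- characteristic zero enters here.
    refine ⟨constants π V.1 (α i : K)⁻¹ • δ.comp D, fun p => ?_⟩
    rw [map_smul, LinearMap.smul_apply, taylor_comp x i δ h1 h2, hD, MvPolynomial.coeff_pderiv, e,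
      smul_smul]
    congr 1
    have h3 : (((α - Finsupp.single i 1 : ι →₀ ℕ) i : ℕ) : Γ(X, V.1)) + 1 = constants π V.1 (α i : K) := by
      rw [map_natCast]
      have : (α - Finsupp.single i 1 : ι →₀ ℕ) i + 1 = α i := by
        conv_rhs => rw [← e]
        simp
      rw [← this, Nat.cast_add, Nat.cast_one]
    have h4 : (α i : K) ≠ 0 := Nat.cast_ne_zero.2 hi
    rw [h3, mul_left_comm, ← map_mul, inv_mul_cancel₀ h4, map_one, mul_one]

/-- On an affine open subset with étale coordinates the sections in degree `n + 1` are a direct sum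
of copies of the sections in degree `n`, through the products with certain sections in degree
one. -/
theorem exists_expansion [CharZero K] (hV : HasCoordinates π V) :
    ∃ (A : Type) (D : A → dSec π 1 V.1),
      ∀ n, ∃ c : dSec π (n + 1) V.1 →ₗ[Γ(X, V.1)] A →₀ dSec π n V.1,
        (∀ s, ((c s).sum fun α g => dSecMulₗ π V.1 (Nat.add_comm 1 n) (D α) g) = s) ∧
        ∀ α g, c (dSecMulₗ π V.1 (Nat.add_comm 1 n) (D α) g) = Finsupp.single α g := by
  classical
  obtain ⟨ι, hι, x, hx⟩ := hV
  obtain ⟨D, hD⟩ := hx.exists_dual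
  refine ⟨ι →₀ ℕ, D, fun n => ?_⟩
  let c : dSec π (n + 1) V.1 →ₗ[Γ(X, V.1)] (ι →₀ ℕ) →₀ dSec π n V.1 :=
    { toFun := fun s => Finsupp.ofSupportFinite (fun α => taylor x s (MvPolynomial.monomial α 1))
        (hx.finite_taylor s)
      map_add' := fun s t => Finsupp.ext fun α => by
        change taylor x (s + t) _ = taylor x s _ + taylor x t _
        rw [map_add, LinearMap.add_apply]
      map_smul' := fun r s => Finsupp.ext fun α => by
        change taylor x (r • s) _ = r • taylor x s _
        rw [map_smul, LinearMap.smul_apply] }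
  have hc : ∀ s α, c s α = taylor x s (MvPolynomial.monomial α 1) := fun _ _ => rfl
  have hDg : ∀ α (g : dSec π n V.1) p, taylor x (dSecMulₗ π V.1 (Nat.add_comm 1 n) (D α) g) p =
      MvPolynomial.coeff α p • g := by
    intro α g p
    rw [taylor_mul, hD, map_smul, LinearMap.smul_apply, dSecMulₗ_one]
  refine ⟨c, fun s => ?_, fun α g => ?_⟩
  -- A section and its expansion have the same Taylor coefficients, because the product of D_α with
  -- g has g as its only coefficient, at α.
  · have h : taylor x ((c s).sum fun α g => dSecMulₗ π V.1 (Nat.add_comm 1 n) (D α) g) =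
        taylor x s := by
      refine (MvPolynomial.basisMonomials ι Γ(X, V.1)).ext fun β => ?_
      rw [MvPolynomial.coe_basisMonomials, Finsupp.sum, map_sum, LinearMap.sum_apply]
      simp only [hDg, MvPolynomial.coeff_monomial, ite_smul, one_smul, zero_smul]
      rw [Finset.sum_ite_eq, hc]
      split_ifs with h
      · rfl
      · rw [← hc]
        exact (Finsupp.notMem_support_iff.1 h).symm
    rw [← sub_eq_zero]
    refine hx.eq_zero_of_taylor _ fun p => ?_
    rw [map_sub, h, sub_self, LinearMap.zero_apply]
  · ext1 β
    rw [hc, hDg, MvPolynomial.coeff_monomial, Finsupp.single_apply]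
    by_cases h : α = β
    · subst h
      simp only [if_true]
      exact one_smul Γ(X, V.1) g
    · have h' : ¬ β = α := fun e => h e.symm
      simp only [h, h', if_false]
      exact zero_smul Γ(X, V.1) g

end TaylorExpansion

/-! ### Sections and morphisms of sheaves of modules from local data -/

section Sheaves

variable {X : Scheme.{u}}

theorem section_ext (M : X.Modules) {U : X.Opens} {x y : Γ(M, U)}
    (h : ∀ P ∈ U, ∃ (V : X.Opens) (i : V ⟶ U), P ∈ V ∧
      M.presheaf.map i.op x = M.presheaf.map i.op y) : x = y := by
  choose V i hV hi using h
  exact TopCat.Sheaf.eq_of_locally_eq' (⟨M.presheaf, M.isSheaf⟩ : TopCat.Sheaf Ab X)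
    (fun P : U => V P.1 P.2) U (fun P => i P.1 P.2)
    (fun P hP => Opens.mem_iSup.2 ⟨⟨P, hP⟩, hV P hP⟩) x y (fun P => hi P.1 P.2)

theorem hom_res {M N : X.Modules} (f : M ⟶ N) {U V : X.Opens} (i : V ⟶ U) (x : Γ(M, U)) :
    N.presheaf.map i.op (f.app U x) = f.app V (M.presheaf.map i.op x) :=
  (ConcreteCategory.congr_hom (f.mapPresheaf.naturality i.op) x).symm

/-- Sections over the members of a basis glue. -/
theorem exists_glue (M : X.Modules) {B : X.Opens → Prop}
    (hB : ∀ (U : X.Opens), ∀ P ∈ U, ∃ V, B V ∧ P ∈ V ∧ V ≤ U) (U : X.Opens)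
    (s : ∀ V, B V → V ≤ U → Γ(M, V))
    (hs : ∀ V W hV hW hVU hWU (i : W ⟶ V), M.presheaf.map i.op (s V hV hVU) = s W hW hWU) :
    ∃ t : Γ(M, U), ∀ V hV (i : V ⟶ U), M.presheaf.map i.op t = s V hV i.le := by
  let J := {V : X.Opens // B V ∧ V ≤ U}
  obtain ⟨t, ht, -⟩ := TopCat.Sheaf.existsUnique_gluing'
    (⟨M.presheaf, M.isSheaf⟩ : TopCat.Sheaf Ab X) (fun V : J => V.1) U (fun V => homOfLE V.2.2)
    (fun P hP => by
      obtain ⟨V, hV, hPV, hVU⟩ := hB U P hP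
      exact Opens.mem_iSup.2 ⟨⟨V, hV, hVU⟩, hPV⟩)
    (fun V => s V.1 V.2.1 V.2.2) (by
      intro V W
      refine section_ext M fun P hP => ?_
      obtain ⟨Z, hZ, hPZ, hZV⟩ := hB _ P hP
      refine ⟨Z, homOfLE hZV, hPZ, ?_⟩
      rw [res_res_apply, res_res_apply]
      exact (hs V.1 Z V.2.1 hZ V.2.2 ((hZV.trans inf_le_left).trans V.2.2) _).trans
        (hs W.1 Z W.2.1 hZ W.2.2 ((hZV.trans inf_le_right).trans W.2.2) _).symm)
  exact ⟨t, fun V hV i => ht ⟨V, hV, i.le⟩⟩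

/-- A morphism of sheaves of modules may be defined on a basis. -/
theorem exists_hom {M N : X.Modules} {B : X.Opens → Prop}
    (hB : ∀ (U : X.Opens), ∀ P ∈ U, ∃ V, B V ∧ P ∈ V ∧ V ≤ U)
    (h : ∀ V, B V → (Γ(M, V) →ₗ[Γ(X, V)] Γ(N, V)))
    (hh : ∀ V W hV hW (i : W ⟶ V) x,
      N.presheaf.map i.op (h V hV x) = h W hW (M.presheaf.map i.op x)) :
    ∃ f : M ⟶ N, ∀ V hV x, f.app V x = h V hV x := by
  have key : ∀ (U : X.Opens) (x : Γ(M, U)), ∃ t : Γ(N, U), ∀ V hV (i : V ⟶ U),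
      N.presheaf.map i.op t = h V hV (M.presheaf.map i.op x) := by
    intro U x
    refine exists_glue N hB U (fun V hV hVU => h V hV (M.presheaf.map (homOfLE hVU).op x)) ?_
    intro V W hV hW hVU hWU i
    rw [hh V W hV hW, res_res_apply]
    rfl
  choose f hf using key
  have ext : ∀ {U : X.Opens} {s t : Γ(N, U)},
      (∀ V, B V → ∀ i : V ⟶ U, N.presheaf.map i.op s = N.presheaf.map i.op t) → s = t := by
    intro U s t hst
    refine section_ext N fun P hP => ?_
    obtain ⟨V, hV, hPV, hVU⟩ := hB U P hP
    exact ⟨V, homOfLE hVU, hPV, hst V hV _⟩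
  refine ⟨homMk (fun U => { toFun := f U, map_add' := fun x y => ?_, map_smul' := fun r x => ?_ })
    fun i x => ?_, fun V hV x => ?_⟩
  · refine ext fun V hV i => ?_
    rw [map_add, hf _ _ V hV, hf _ _ V hV, hf _ _ V hV, map_add, map_add]
  · refine ext fun V hV i => ?_
    rw [RingHom.id_apply, Scheme.Modules.map_smul, hf _ _ V hV, hf _ _ V hV,
      Scheme.Modules.map_smul, map_smul]
  · refine ext fun V hV j => ?_
    change N.presheaf.map j.op (N.presheaf.map i.op (f _ x)) =
      N.presheaf.map j.op (f _ (M.presheaf.map i.op x))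
    rw [res_res_apply, hf _ _ V hV, hf _ _ V hV, res_res_apply]
  · refine (homMk_app _ _ V x).trans ?_
    change f V x = _
    have := hf V x V hV (𝟙 V)
    rw [op_id, CategoryTheory.Functor.map_id, CategoryTheory.Functor.map_id] at this
    exact this

theorem app_smul {M N : X.Modules} (f : M ⟶ N) {U : X.Opens} (r : Γ(X, U)) (x : Γ(M, U)) :
    f.app U (r • x) = r • f.app U x := Scheme.Modules.Hom.app_smul f r x

theorem hom_ext_sections {M N : X.Modules} {f g : M ⟶ N}
    (h : ∀ (U : X.Opens) (x : Γ(M, U)), f.app U x = g.app U x) : f = g := by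
  refine Scheme.Modules.hom_ext _ _ fun U => ?_
  ext x
  exact h U x

end Sheaves

/-! ### The product as a tensor product over a coordinate open -/

section LocalStructure

variable {K : Type u} [Field K] {X : Scheme.{u}} {π : X ⟶ Spec (.of K)} {n : ℕ}
  {V : X.affineOpens}

/-- An operator without arguments is a function; compatibility with restriction makes its value on
`V` determine the family. -/
theorem dSec_zero_eq (s : dSec π 0 V.1) :
    ∃ r : Γ(X, V.1), s = r • dSecOne π V.1 := by
  refine ⟨s.1 ⟨V, le_rfl⟩ (fun i => i.elim0), dSec_ext fun W hW a => ?_⟩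
  rw [dSec_smul, s.2.2 V W le_rfl hW]
  refine Eq.trans ?_ (mul_one _).symm
  exact congrArg (s.1 ⟨W, hW⟩) (funext fun i => i.elim0)

theorem dSecMulₗ_dSecOne (e : dSec π 1 V.1) :
    dSecMulₗ π V.1 (Nat.add_comm 1 0) e (dSecOne π V.1) = e :=
  dSec_ext fun W hW a => congrFun (prod_one (e.1 ⟨W, hW⟩)) a

theorem dSecMulₗ_smul_one (e : dSec π 1 V.1) (r : Γ(X, V.1)) :
    dSecMulₗ π V.1 (Nat.add_comm 1 0) e (r • dSecOne π V.1) = r • e := by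
  rw [map_smul, dSecMulₗ_dSecOne]

theorem exists_local_decomposition [CharZero K] (hV : HasCoordinates π V) (s : dSec π (n + 1) V.1) :
    ∃ (A : Type) (t : Finset A) (e : A → dSec π 1 V.1) (g : A → dSec π n V.1),
      s = ∑ α ∈ t, dSecMulₗ π V.1 (Nat.add_comm 1 n) (e α) (g α) := by
  obtain ⟨A, D, h⟩ := exists_expansion hV
  obtain ⟨c, hc, -⟩ := h n
  exact ⟨A, (c s).support, D, c s, (hc s).symm⟩

/-- The universal property of the product `D¹ × Dⁿ → Dⁿ⁺¹` on an affine open subset with étale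
coordinates. -/
theorem exists_local_lift [CharZero K] (hV : HasCoordinates π V) {N : Type u} [AddCommGroup N]
    [Module Γ(X, V.1) N] (b : dSec π 1 V.1 →ₗ[Γ(X, V.1)] dSec π n V.1 →ₗ[Γ(X, V.1)] N) :
    ∃ h : dSec π (n + 1) V.1 →ₗ[Γ(X, V.1)] N,
      ∀ e g, h (dSecMulₗ π V.1 (Nat.add_comm 1 n) e g) = b e g := by
  obtain ⟨A, D, hD⟩ := exists_expansion hV
  obtain ⟨c, -, hc2⟩ := hD n
  obtain ⟨c0, hc0, -⟩ := hD 0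
  let h : dSec π (n + 1) V.1 →ₗ[Γ(X, V.1)] N := Finsupp.lsum Γ(X, V.1) (fun α => b (D α)) ∘ₗ c
  have h1 : ∀ α g, h (dSecMulₗ π V.1 (Nat.add_comm 1 n) (D α) g) = b (D α) g := by
    intro α g
    change Finsupp.lsum Γ(X, V.1) (fun α => b (D α)) (c _) = _
    rw [hc2]
    exact Finsupp.lsum_single _ _ _ _
  refine ⟨h, fun e g => ?_⟩
  -- The degree zero expansion writes `e` as a combination of the D_α with functions as
  -- coefficients, so linearity in `e` reduces to the case `h1`.
  have h2 : h ∘ₗ (dSecMulₗ π V.1 (Nat.add_comm 1 n)).flip g = b.flip g := by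
    refine LinearMap.ext fun e => ?_
    rw [← hc0 e, Finsupp.sum, map_sum, map_sum]
    refine Finset.sum_congr rfl fun α _ => ?_
    obtain ⟨r, hr⟩ := dSec_zero_eq (c0 e α)
    rw [hr, dSecMulₗ_smul_one, map_smul, map_smul]
    exact congrArg (r • ·) (h1 α g)
  exact LinearMap.congr_fun h2 e

end LocalStructure

/-! ### Global universal properties of the product and of the unit -/

section UniversalProperty

variable {K : Type u} [Field K] {X : Scheme.{u}} {π : X ⟶ Spec (.of K)} {n : ℕ}

variable (π) in
/-- An affine open subset with étale coordinates, as a property of open subsets. -/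
def IsCoordinateOpen (V : X.Opens) : Prop := ∃ hV : IsAffineOpen V, HasCoordinates π ⟨V, hV⟩

theorem exists_isCoordinateOpen [Smooth π] (U : X.Opens) (P : X) (hP : P ∈ U) :
    ∃ V, IsCoordinateOpen π V ∧ P ∈ V ∧ V ≤ U := by
  obtain ⟨V, h1, h2, h3⟩ := exists_hasCoordinates π U hP
  exact ⟨V.1, ⟨V.2, h1⟩, h2, h3⟩

theorem IsCoordinateOpen.decomposition [CharZero K] {V : X.Opens} (hV : IsCoordinateOpen π V)
    (hn : (1 : ℤ) + .ofNat n = .ofNat (n + 1)) (z : Γ(dPoly π (.ofNat (n + 1)), V)) :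
    ∃ (A : Type) (t : Finset A) (e : A → Γ(dPoly π 1, V)) (g : A → Γ(dPoly π (.ofNat n), V)),
      z = ∑ α ∈ t, (dMul π 1 (.ofNat n) (.ofNat (n + 1)) hn).app V (e α) (g α) := by
  obtain ⟨hV, hc⟩ := hV
  exact exists_local_decomposition hc z

theorem IsCoordinateOpen.exists_lift [CharZero K] {V : X.Opens} (hV : IsCoordinateOpen π V)
    (hn : (1 : ℤ) + .ofNat n = .ofNat (n + 1)) {N : Type u} [AddCommGroup N] [Module Γ(X, V) N]
    (b : Γ(dPoly π 1, V) →ₗ[Γ(X, V)] Γ(dPoly π (.ofNat n), V) →ₗ[Γ(X, V)] N) :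
    ∃ h : Γ(dPoly π (.ofNat (n + 1)), V) →ₗ[Γ(X, V)] N,
      ∀ e g, h ((dMul π 1 (.ofNat n) (.ofNat (n + 1)) hn).app V e g) = b e g := by
  obtain ⟨hV, hc⟩ := hV
  exact exists_local_lift hc b

/-- Sections in positive degree are local sums of products. -/
theorem dPoly_induction [Smooth π] [CharZero K] (hn : (1 : ℤ) + .ofNat n = .ofNat (n + 1))
    {motive : ∀ U, Γ(dPoly π (.ofNat (n + 1)), U) → Prop}
    (mul : ∀ U x y, motive U ((dMul π 1 (.ofNat n) (.ofNat (n + 1)) hn).app U x y))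
    (add : ∀ U x y, motive U x → motive U y → motive U (x + y))
    (loc : ∀ U z, (∀ P ∈ U, ∃ (V : X.Opens) (i : V ⟶ U), P ∈ V ∧
      motive V ((dPoly π (.ofNat (n + 1))).presheaf.map i.op z)) → motive U z)
    (U : X.Opens) (z : Γ(dPoly π (.ofNat (n + 1)), U)) : motive U z := by
  classical
  refine loc U z fun P hP => ?_
  obtain ⟨V, hV, hPV, hVU⟩ := exists_isCoordinateOpen (π := π) U P hP
  refine ⟨V, homOfLE hVU, hPV, ?_⟩
  generalize (dPoly π (.ofNat (n + 1))).presheaf.map (homOfLE hVU).op z = z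
  obtain ⟨A, t, e, g, rfl⟩ := hV.decomposition hn z
  induction t using Finset.induction_on with
  | empty =>
    have := mul V 0 0
    rw [map_zero] at this
    rwa [Finset.sum_empty]
  | insert a s ha ih =>
    rw [Finset.sum_insert ha]
    exact add _ _ _ (mul _ _ _) ih

/-- The product `D¹ × Dⁿ → Dⁿ⁺¹` is a tensor product of sheaves of modules. -/
theorem exists_lift [Smooth π] [CharZero K] (hn : (1 : ℤ) + .ofNat n = .ofNat (n + 1))
    {N : X.Modules} (b : Bilin (dPoly π 1) (dPoly π (.ofNat n)) N) :
    ∃ h : dPoly π (.ofNat (n + 1)) ⟶ N, ∀ U x y,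
      h.app U ((dMul π 1 (.ofNat n) (.ofNat (n + 1)) hn).app U x y) = b.app U x y := by
  have key : ∀ V, IsCoordinateOpen π V → _ := fun V hV => hV.exists_lift hn (b.app V)
  choose h hh using key
  obtain ⟨f, hf⟩ := exists_hom (M := dPoly π (.ofNat (n + 1))) (N := N)
    (exists_isCoordinateOpen (π := π)) h (by
      intro V W hV hW i x
      -- The local lifts commute with restriction: products span the sections over a coordinate
      -- open, and both sides are prescribed on products.
      obtain ⟨A, t, e, g, rfl⟩ := hV.decomposition hn x
      simp only [map_sum, hh, Bilin.map_app])
  refine ⟨f, fun U x y => ?_⟩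
  refine section_ext N fun P hP => ?_
  obtain ⟨V, hV, hPV, hVU⟩ := exists_isCoordinateOpen (π := π) U P hP
  refine ⟨V, homOfLE hVU, hPV, ?_⟩
  rw [hom_res, Bilin.map_app, Bilin.map_app, hf V hV, hh]

/-- The unit over an open subset. -/
noncomputable def dOneOn (π : X ⟶ Spec (.of K)) (U : X.Opens) : Γ(dPoly π 0, U) :=
  (dPoly π 0).presheaf.map (homOfLE le_top).op (dOne π)

theorem res_dOneOn {U V : X.Opens} (i : V ⟶ U) :
    (dPoly π 0).presheaf.map i.op (dOneOn π U) = dOneOn π V := res_res_apply _ _ _ _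

theorem dOneOn_generates {V : X.Opens} (hV : IsAffineOpen V) (z : Γ(dPoly π 0, V)) :
    ∃ r : Γ(X, V), z = r • dOneOn π V := dSec_zero_eq (V := ⟨V, hV⟩) z

theorem exists_isAffineOpen (U : X.Opens) (P : X) (hP : P ∈ U) :
    ∃ V, IsAffineOpen V ∧ P ∈ V ∧ V ≤ U := by
  obtain ⟨Z, hZ, hPZ, hle⟩ := X.isBasis_affineOpens.exists_subset_of_mem_open hP U.isOpen
  obtain ⟨Z, hZ', rfl⟩ := hZ
  exact ⟨Z, hZ', hPZ, hle⟩

/-- The sheaf in degree zero is free on the unit. -/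
theorem exists_lift_zero {N : X.Modules} (y : Γ(N, ⊤)) :
    ∃ h : dPoly π 0 ⟶ N, h.app ⊤ (dOne π) = y := by
  have key : ∀ V, IsAffineOpen V → ∃ h : Γ(dPoly π 0, V) →ₗ[Γ(X, V)] Γ(N, V), 
      ∀ r : Γ(X, V), h (r • dOneOn π V) = r • N.presheaf.map (homOfLE le_top).op y := by
    intro V hV
    let W : {W : X.affineOpens // W.1 ≤ V} := ⟨⟨V, hV⟩, le_rfl⟩
    let ev : dSec π 0 V →ₗ[Γ(X, V)] Γ(X, V) :=
      { toFun := fun s => s.1 W (fun i => i.elim0)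
        map_add' := fun _ _ => rfl
        map_smul' := fun r s => by
          change fres le_rfl r * _ = r * _
          rw [fres_self] }
    refine ⟨(LinearMap.toSpanSingleton Γ(X, V) Γ(N, V) (N.presheaf.map (homOfLE le_top).op y)) ∘ₗ ev,
      fun r => ?_⟩
    change (fres le_rfl r * 1) • (N.presheaf.map (homOfLE (le_top : V ≤ ⊤)).op y : Γ(N, V)) = _
    rw [fres_self, mul_one]
  choose h hh using key
  obtain ⟨f, hf⟩ := exists_hom (M := dPoly π 0) (N := N) exists_isAffineOpen h (by
    intro V W hV hW i x
    obtain ⟨r, rfl⟩ := dOneOn_generates hV x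
    rw [hh, Scheme.Modules.map_smul, Scheme.Modules.map_smul, res_dOneOn, hh, res_res_apply]
    rfl)
  refine ⟨f, section_ext N fun P hP => ?_⟩
  obtain ⟨V, hV, hPV, hVU⟩ := exists_isAffineOpen ⊤ P hP
  refine ⟨V, homOfLE hVU, hPV, ?_⟩
  have := hh V hV 1
  rw [one_smul, one_smul] at this
  rw [hom_res, hf V hV]
  exact this

theorem dPoly_zero_induction {motive : ∀ U, Γ(dPoly π 0, U) → Prop}
    (smul : ∀ U (r : Γ(X, U)), motive U (r • dOneOn π U))
    (loc : ∀ U z, (∀ P ∈ U, ∃ (V : X.Opens) (i : V ⟶ U), P ∈ V ∧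
      motive V ((dPoly π 0).presheaf.map i.op z)) → motive U z)
    (U : X.Opens) (z : Γ(dPoly π 0, U)) : motive U z := by
  refine loc U z fun P hP => ?_
  obtain ⟨V, hV, hPV, hVU⟩ := exists_isAffineOpen U P hP
  refine ⟨V, homOfLE hVU, hPV, ?_⟩
  obtain ⟨r, hr⟩ := dOneOn_generates hV ((dPoly π 0).presheaf.map (homOfLE hVU).op z)
  rw [hr]
  exact smul V r

end UniversalProperty

/-! ### Induction on the generated Lie algebra -/

section GeneratedLie

variable {X : Scheme.{u}} {M : ℤ → X.Modules} {B : GradedLie M}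

theorem LieGen.mem_lieSub {U : X.Opens} {n : ℤ} {x : Γ(M n, U)} (h : LieGen B U n x) :
    x ∈ lieSub B n U :=
  fun _ hP => ⟨U, 𝟙 U, hP, h.res _⟩

/-- The sections are only locally generated by brackets, so a local property is exactly what can be
proved by induction. The auxiliary claim transports the induction on `LieGen`, which lives in the
ambient sheaf, along the injective inclusion. -/
theorem lieObj_induction {motive : ∀ (n : ℤ) (U : X.Opens), Γ(lieObj B n, U) → Prop}
    (gen : ∀ U x, motive 1 U ((lieGenMap B).app U x))
    (zero : ∀ n U, motive n U 0)
    (add : ∀ n U x y, motive n U x → motive n U y → motive n U (x + y))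
    (smul : ∀ n U (r : Γ(X, U)) x, motive n U x → motive n U (r • x))
    (bracket : ∀ p q n (h : p + q = n) U x y, motive p U x → motive q U y →
      motive n U ((lieBracket B p q n h).app U x y))
    (loc : ∀ n U z, (∀ P ∈ U, ∃ (V : X.Opens) (i : V ⟶ U), P ∈ V ∧
      motive n V ((lieObj B n).presheaf.map i.op z)) → motive n U z)
    (n : ℤ) (U : X.Opens) (z : Γ(lieObj B n, U)) : motive n U z := by
  have key : ∀ (U : X.Opens) (n : ℤ) (x : Γ(M n, U)), LieGen B U n x →
      ∀ z : Γ(lieObj B n, U), (lieIncl B n).app U z = x → motive n U z := by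
    intro U n x hx
    induction hx with
    | gen x =>
      intro z hz
      rw [lieIncl_injective B (hz.trans (lieIncl_lieLift B (𝟙 (M 1)) _ U x).symm)]
      exact gen U x
    | zero n =>
      intro z hz
      rw [lieIncl_injective B (hz.trans (map_zero ((lieIncl B n).app U).hom).symm)]
      exact zero n U
    | @add n x y h1 h2 ih1 ih2 =>
      intro z hz
      have e : z = (lieEquiv B n U).symm ⟨x, h1.mem_lieSub⟩ +
          (lieEquiv B n U).symm ⟨y, h2.mem_lieSub⟩ :=
        lieIncl_injective B (hz.trans (by rw [map_add]; rfl))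
      rw [e]
      exact add _ _ _ _ (ih1 _ rfl) (ih2 _ rfl)
    | @smul n r x h1 ih =>
      intro z hz
      have e : z = r • (lieEquiv B n U).symm ⟨x, h1.mem_lieSub⟩ :=
        lieIncl_injective B (hz.trans (by rw [app_smul]; rfl))
      rw [e]
      exact smul _ _ _ _ (ih _ rfl)
    | @bracket p q n h x y h1 h2 ih1 ih2 =>
      intro z hz
      have e : z = (lieBracket B p q n h).app U ((lieEquiv B p U).symm ⟨x, h1.mem_lieSub⟩)
          ((lieEquiv B q U).symm ⟨y, h2.mem_lieSub⟩) :=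
        lieIncl_injective B (hz.trans rfl)
      rw [e]
      exact bracket _ _ _ _ _ _ _ (ih1 _ rfl) (ih2 _ rfl)
  refine loc n U z fun P hP => ?_
  obtain ⟨V, i, hPV, hx⟩ := lieIncl_mem B z P hP
  exact ⟨V, i, hPV, key V n _ hx _ (lieIncl_res B i z)⟩

/-- The generators have degree one, and a bracket of nonpositive degree has an entry of nonpositive
degree. -/
theorem lieObj_eq_zero {n : ℤ} (hn : n ≤ 0) {U : X.Opens} (z : Γ(lieObj B n, U)) : z = 0 := by
  revert hn
  refine lieObj_induction (B := B) (motive := fun n U z => n ≤ 0 → z = 0) ?_ ?_ ?_ ?_ ?_ ?_ n U z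
  · intro U x h
    omega
  · intro n U _
    rfl
  · intro n U x y hx hy h
    rw [hx h, hy h, add_zero]
  · intro n U r x hx h
    rw [hx h, smul_zero]
  · intro p q n h U x y hx hy hn
    by_cases hp : p ≤ 0
    · rw [hx hp, map_zero, LinearMap.zero_apply]
    · rw [hy (by omega), map_zero]
  · intro n U z h hn
    refine section_ext _ fun P hP => ?_
    obtain ⟨V, i, hPV, hz⟩ := h P hP
    exact ⟨V, i, hPV, by rw [hz hn, map_zero]⟩

/-- Morphisms from a generated graded Lie algebra are determined by the generators. -/
theorem IsGradedLieHom.ext_gen {N : ℤ → X.Modules} {C : GradedLie N}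
    {f g : ∀ n, lieObj B n ⟶ N n} (hf : IsGradedLieHom (generatedLie B) C f)
    (hg : IsGradedLieHom (generatedLie B) C g)
    (h : ∀ U x, (f 1).app U ((lieGenMap B).app U x) = (g 1).app U ((lieGenMap B).app U x)) :
    f = g := by
  funext n
  refine hom_ext_sections fun U x => ?_
  refine lieObj_induction (B := B) (motive := fun n U z => (f n).app U z = (g n).app U z)
    h ?_ ?_ ?_ ?_ ?_ n U x
  · intro n U
    rw [map_zero, map_zero]
  · intro n U x y hx hy
    rw [map_add, map_add, hx, hy]
  · intro n U r x hx
    rw [app_smul, app_smul, hx]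
  · intro p q n h U x y hx hy
    exact (hf p q n h U x y).trans (((congrArg₂ (fun a b => (C.bracket p q n h).app U a b) hx hy)).trans
      (hg p q n h U x y).symm)
  · intro n U z hz
    refine section_ext _ fun P hP => ?_
    obtain ⟨V, i, hPV, hz⟩ := hz P hP
    exact ⟨V, i, hPV, by rw [hom_res, hom_res, hz]⟩

end GeneratedLie

/-! ### The Hochschild differential preserves the Lie subalgebra -/

section Stability

variable {K : Type u} [Field K] {X : Scheme.{u}} {π : X ⟶ Spec (.of K)}

/-- The value of a section over an affine open subset at given arguments. -/
noncomputable def dSecValue {n : ℕ} {U : X.Opens} (W : {W : X.affineOpens // W.1 ≤ U})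
    (a : Fin n → Γ(X, W.1.1)) : dSec π n U →+ Γ(X, W.1.1) where
  toFun s := s.1 W a
  map_zero' := rfl
  map_add' _ _ := rfl

theorem dSecValue_mul_swap {U : X.Opens} (W : {W : X.affineOpens // W.1 ≤ U})
    (a b : Γ(X, W.1.1)) (e g : dSec π 1 U) :
    dSecValue W ![a, b] (dSecMul π (n := 2) rfl U g e) =
      dSecValue W ![b, a] (dSecMul π (n := 2) rfl U e g) := by
  change g.1 W _ * e.1 W _ = e.1 W _ * g.1 W _
  rw [mul_comm]
  refine congrArg₂ (· * ·) (congrArg (e.1 W) (funext fun i => ?_))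
    (congrArg (g.1 W) (funext fun i => ?_))
  all_goals
    obtain rfl : i = 0 := Subsingleton.elim _ _
    rfl

/-- The value a f(b) - f(ab) + f(a) b is visibly symmetric over a commutative ring. -/
theorem hochschild_one_symm {R : Type u} [CommRing R] (f : (Fin 1 → R) → R) (a b : R) :
    hochschild f ![a, b] = hochschild f ![b, a] := by
  have h : ∀ v : Fin 1 → R, v = fun _ => v 0 := fun v => by
    funext i; obtain rfl : i = 0 := Subsingleton.elim _ _; rfl
  simp only [hochschild]
  rw [h fun i : Fin 1 => (![a, b] : Fin 2 → R) i.succ, h fun i : Fin 1 => (![b, a] : Fin 2 → R) i.succ,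
    h fun i : Fin 1 => (![a, b] : Fin 2 → R) i.castSucc,
    h fun i : Fin 1 => (![b, a] : Fin 2 → R) i.castSucc, Fin.sum_univ_one, Fin.sum_univ_one,
    h (Fin.contractNth _ _ ![a, b]), h (Fin.contractNth _ _ ![b, a])]
  simp [Fin.contractNth, mul_comm b a]
  ring

/-- Locally dx is a sum of products of degree one sections, and its symmetry allows the factors to
be swapped. Averaging the two sums gives half a sum of graded commutators. -/
theorem dDiff_mem_lieSub [Smooth π] [CharZero K] (U : X.Opens) (x : Γ(dPoly π 1, U)) :
    (dDiff π 1 2).app U x ∈ lieSub (dPolyAlg π).toGradedLie 2 U := by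
  refine lieSub_loc _ _ fun P hP => ?_
  obtain ⟨V, hV, hPV, hVU⟩ := exists_isCoordinateOpen (π := π) U P hP
  refine ⟨V, homOfLE hVU, hPV, ?_⟩
  rw [hom_res]
  generalize (dPoly π 1).presheaf.map (homOfLE hVU).op x = x
  obtain ⟨A, t, e, g, h⟩ := hV.decomposition (n := 1) rfl ((dDiff π 1 2).app V x)
  have key : (dDiff π 1 2).app V x = constants π V (2⁻¹ : K) •
      ∑ α ∈ t, ((dPolyAlg π).commutator 1 1 2 rfl).app V (e α) (g α) := by
    have e1 : ∀ α, ((dPolyAlg π).commutator 1 1 2 rfl).app V (e α) (g α) =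
        (dMul π 1 1 2 rfl).app V (e α) (g α) + (dMul π 1 1 2 rfl).app V (g α) (e α) := by
      intro α
      refine (GradedAlg.commutator_app (dPolyAlg π) 1 1 2 rfl rfl V (e α) (g α)).trans ?_
      have : ((1 : ℤ) * 1).negOnePow = -1 := by simp
      rw [this, Units.neg_smul, one_smul, sub_neg_eq_add]
      rfl
    -- Swapping the factors amounts to swapping the two arguments, under which dx is invariant.
    have e2 : ∑ α ∈ t, (dMul π 1 1 2 rfl).app V (g α) (e α) = (dDiff π 1 2).app V x := by
      refine dSec_ext fun W hW a => ?_
      obtain ⟨b, c, rfl⟩ : ∃ b c, a = ![b, c] := ⟨a 0, a 1, by ext i; fin_cases i <;> rfl⟩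
      have h1 : dSecValue (π := π) ⟨W, hW⟩ ![b, c] (∑ α ∈ t, dSecMul π (n := 2) rfl V (g α) (e α)) =
          dSecValue ⟨W, hW⟩ ![c, b] (∑ α ∈ t, dSecMul π (n := 2) rfl V (e α) (g α)) := by
        rw [map_sum, map_sum]
        exact Finset.sum_congr rfl fun α _ => dSecValue_mul_swap _ _ _ _ _
      have h2 : ∀ a : Fin 2 → Γ(X, W.1), dSecValue (π := π) (n := 2) ⟨W, hW⟩ a
          (show dSec π 2 V from (dDiff π 1 2).app V x) =
            hochschild ((show dSec π 1 V from x).1 ⟨W, hW⟩) a := by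
        intro a
        change dSecValue (π := π) (n := 2) ⟨W, hW⟩ a
          (show dSec π 2 V from (dDiff π (.ofNat 1) (.ofNat (1 + 1))).app V x) = _
        rw [dDiff_succ]
        rfl
      refine Eq.trans h1 (Eq.trans ?_ ((hochschild_one_symm _ _ _).trans (h2 _).symm))
      rw [← h2]
      exact congrArg (fun s : dSec π 2 V => dSecValue ⟨W, hW⟩ ![c, b] s) h.symm
    simp only [e1]
    rw [Finset.sum_add_distrib, e2]
    have e3 : ∑ α ∈ t, (dMul π 1 1 2 rfl).app V (e α) (g α) = (dDiff π 1 2).app V x := h.symm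
    rw [e3, ← two_smul Γ(X, V), smul_smul, ← map_ofNat (constants π V) 2, ← map_mul,
      inv_mul_cancel₀ two_ne_zero, map_one, one_smul]
  rw [key]
  exact Submodule.smul_mem _ _ (Submodule.sum_mem _ fun α _ =>
    lieSub_bracket (dPolyAlg π).toGradedLie (p := 1) (q := 1) rfl (mem_lieSub_one _ _)
      (mem_lieSub_one _ _))

/-- Generators are covered by `dDiff_mem_lieSub`; the Leibniz rule for the bracket carries the claim
to iterated brackets. -/
theorem dStable [Smooth π] [CharZero K] : DStable (dPolyLie π) := by
  have key : ∀ (n : ℤ) (U : X.Opens) (z : Γ(lieObj (dPolyLie π).lie n, U)), ∀ m, n + 1 = m →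
      ((dPolyLie π).cx.obj.d n m).app U ((lieIncl (dPolyLie π).lie n).app U z) ∈
        lieSub (dPolyLie π).lie m U := by
    refine lieObj_induction (B := (dPolyLie π).lie) ?_ ?_ ?_ ?_ ?_ ?_
    · rintro U x m rfl
      exact dDiff_mem_lieSub U x
    · intro n U m _
      rw [map_zero, map_zero]
      exact Submodule.zero_mem _
    · intro n U x y hx hy m hm
      rw [map_add, map_add]
      exact Submodule.add_mem _ (hx m hm) (hy m hm)
    · intro n U r x hx m hm
      rw [app_smul, app_smul]
      exact Submodule.smul_mem _ _ (hx m hm)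
    · intro p q n h U x y hx hy m hm
      rw [lieIncl_bracket, (dPolyLie π).leibniz p q n (p + 1) (q + 1) m h rfl rfl hm]
      refine Submodule.add_mem _
        (lieSub_bracket _ _ (hx _ rfl) (lieIncl_mem _ y)) ?_
      have := lieSub_bracket (dPolyLie π).lie (n := m) (by omega) (lieIncl_mem _ x) (hy _ rfl)
      rcases Int.units_eq_one_or p.negOnePow with e | e <;> rw [e]
      · rwa [one_smul]
      · rw [Units.neg_smul, one_smul]
        exact Submodule.neg_mem _ this
    · intro n U z h m hm
      refine lieSub_loc _ _ fun P hP => ?_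
      obtain ⟨V, i, hPV, hz⟩ := h P hP
      refine ⟨V, i, hPV, ?_⟩
      rw [hom_res, hom_res]
      exact hz m hm
  intro n m h U x hx
  exact key n U ((lieEquiv (dPolyLie π).lie n U).symm ⟨x, hx⟩) m h

end Stability

/-! ### The tensor algebra property and the enveloping algebra -/

section UniversalEnveloping

theorem app_units_smul {X : Scheme.{u}} {M N : X.Modules} (f : M ⟶ N) {U : X.Opens} (r : ℤˣ)
    (x : Γ(M, U)) : f.app U (r • x) = r • f.app U x := by
  rw [Units.smul_def, map_zsmul, Units.smul_def]

/-- The linear map on sections given by a morphism. -/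
noncomputable def homLin {X : Scheme.{u}} {M N : X.Modules} (f : M ⟶ N) (U : X.Opens) :
    Γ(M, U) →ₗ[Γ(X, U)] Γ(N, U) where
  toFun x := f.app U x
  map_add' x y := map_add _ x y
  map_smul' r x := app_smul f r x

/-- The composite of a bilinear map with morphisms. -/
noncomputable def Bilin.comp {X : Scheme.{u}} {M N P M' N' : X.Modules} (b : Bilin M' N' P)
    (f : M ⟶ M') (g : N ⟶ N') : Bilin M N P where
  app U := (b.app U).compl₁₂ (homLin f U) (homLin g U)
  map_app i x y := by
    change P.presheaf.map i.op (b.app _ (f.app _ x) (g.app _ y)) = b.app _ (f.app _ _) (g.app _ _)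
    rw [b.map_app, hom_res, hom_res]

variable {K : Type u} [Field K] {X : Scheme.{u}} {π : X ⟶ Spec (.of K)}

/-- Multiplicative families of morphisms, as morphisms of graded algebras without unit. -/
def IsMulHom {M N : ℤ → X.Modules} (A : GradedAlg M) (B : GradedAlg N) (g : ∀ n, M n ⟶ N n) :
    Prop :=
  ∀ (p q n : ℤ) (h : p + q = n) (U : X.Opens) (x : Γ(M p, U)) (y : Γ(M q, U)),
    (g n).app U ((A.mul p q n h).app U x y) = (B.mul p q n h).app U ((g p).app U x) ((g q).app U y)

/-- The existence half of the universal property of the tensor algebra. The map is defined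
recursively by x·y ↦ ψ(x) g(y) for x of degree one; multiplicativity follows by associativity and
induction on the degree of the first factor. -/
theorem exists_mulHom [Smooth π] [CharZero K] {N : ℤ → X.Modules} (A : GradedAlg N)
    (ψ : dPoly π 1 ⟶ N 1) : ∃ g : ∀ n, dPoly π n ⟶ N n,
      (g 0).app ⊤ (dOne π) = A.one ∧ IsMulHom (dPolyAlg π) A g ∧ g 1 = ψ := by
  obtain ⟨g0, hg0⟩ := exists_lift_zero (π := π) A.one
  have hn : ∀ n : ℕ, (1 : ℤ) + .ofNat n = .ofNat (n + 1) := fun n => by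
    simp [add_comm]
  let G : ∀ n : ℕ, dPoly π (.ofNat n) ⟶ N (.ofNat n) := fun n => n.rec g0 fun n g =>
    (exists_lift (π := π) (hn n) ((A.mul 1 (.ofNat n) (.ofNat (n + 1)) (hn n)).comp ψ g)).choose
  have hG : ∀ (n : ℕ) U x y, (G (n + 1)).app U ((dMul π 1 (.ofNat n) (.ofNat (n + 1)) (hn n)).app U x y)
      = (A.mul 1 (.ofNat n) (.ofNat (n + 1)) (hn n)).app U (ψ.app U x) ((G n).app U y) := fun n =>
    (exists_lift (π := π) (hn n) ((A.mul 1 (.ofNat n) (.ofNat (n + 1)) (hn n)).comp ψ (G n))).choose_spec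
  have h0 : ∀ U, (G 0).app U (dOneOn π U) = (N 0).presheaf.map (homOfLE le_top).op A.one := by
    intro U
    change g0.app U (dOneOn π U) = _
    rw [dOneOn, ← hom_res, hg0]
  let g : ∀ n : ℤ, dPoly π n ⟶ N n := fun n => match n with
    | .ofNat n => G n
    | .negSucc _ => 0
  refine ⟨g, hg0, ?_, ?_⟩
  · intro p q n h U x y
    rcases p with p | p
    swap
    · rw [dPoly_negSucc π x 0]
      simp only [map_zero, LinearMap.zero_apply]
    rcases q with q | q
    swap
    · rw [dPoly_negSucc π y 0]
      simp only [map_zero]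
    induction p generalizing n U with
    | zero =>
      obtain rfl : n = .ofNat q := h.symm.trans (zero_add (Int.ofNat q))
      -- The induction on the first factor shrinks the open set, so the second factor must be
      -- universally quantified.
      revert y
      refine dPoly_zero_induction (π := π) (motive := fun U x => ∀ y : Γ(dPoly π (.ofNat q), U),
        (G q).app U ((dMul π 0 (.ofNat q) (.ofNat q) h).app U x y) =
          (A.mul 0 (.ofNat q) (.ofNat q) h).app U ((G 0).app U x) ((G q).app U y)) ?_ ?_ U x
      · intro U r y
        have e : (dMul π 0 (.ofNat q) (.ofNat q) h).app U (dOneOn π U) y = y :=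
          (dPolyAlg π).one_mul (.ofNat q) U y
        rw [app_smul, map_smul, map_smul, LinearMap.smul_apply, LinearMap.smul_apply, app_smul, e, h0]
        congr 1
        exact (A.one_mul (.ofNat q) U _).symm
      · intro U x hx y
        refine section_ext _ fun P hP => ?_
        obtain ⟨V, i, hPV, hz⟩ := hx P hP
        refine ⟨V, i, hPV, ?_⟩
        rw [hom_res, Bilin.map_app, Bilin.map_app, hz, hom_res, hom_res]
        rfl
    | succ p ih =>
      obtain rfl : n = .ofNat (p + 1 + q) := by rw [← h]; rfl
      revert y
      refine dPoly_induction (π := π) (hn p) (motive := fun U x => ∀ y : Γ(dPoly π (.ofNat q), U),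
        (G (p + 1 + q)).app U ((dMul π (.ofNat (p + 1)) (.ofNat q) (.ofNat (p + 1 + q)) h).app U x y) =
          (A.mul (.ofNat (p + 1)) (.ofNat q) (.ofNat (p + 1 + q)) h).app U ((G (p + 1)).app U x)
            ((G q).app U y)) ?_ ?_ ?_ U x
      · intro U x t y
        rw [hG]
        have h2 : Int.ofNat p + Int.ofNat q = Int.ofNat (p + q) := rfl
        have h3 : (1 : ℤ) + Int.ofNat (p + q) = Int.ofNat (p + 1 + q) := by
          simp; omega
        have e1 := (dPolyAlg π).mul_assoc 1 (.ofNat p) (.ofNat q) (.ofNat (p + 1)) (.ofNat (p + q))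
          (.ofNat (p + 1 + q)) (hn p) h2 h h3 U x t y
        have e2 := A.mul_assoc 1 (.ofNat p) (.ofNat q) (.ofNat (p + 1)) (.ofNat (p + q))
          (.ofNat (p + 1 + q)) (hn p) h2 h h3 U (ψ.app U x) ((G p).app U t) ((G q).app U y)
        refine (congrArg (fun z => (G (p + 1 + q)).app U z) e1).trans (Eq.trans ?_ e2.symm)
        refine Eq.trans ?_ (congrArg (fun z => (A.mul 1 (.ofNat (p + q)) (.ofNat (p + 1 + q))
          h3).app U (ψ.app U x) z) (ih (.ofNat (p + q)) U t y h2))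
        have e3 : p + 1 + q = p + q + 1 := by omega
        -- The degrees p + 1 + q and p + q + 1 are equal but not definitionally so; a free index `m`
        -- avoids a transport between sheaves.
        have e4 : ∀ (m : ℕ) (hm : m = p + q + 1) (h3 : (1 : ℤ) + Int.ofNat (p + q) = Int.ofNat m)
            (w : Γ(dPoly π (.ofNat (p + q)), U)),
            (G m).app U ((dMul π 1 (.ofNat (p + q)) (.ofNat m) h3).app U x w) =
              (A.mul 1 (.ofNat (p + q)) (.ofNat m) h3).app U (ψ.app U x) ((G (p + q)).app U w) := by
          rintro m rfl h3 w
          exact hG (p + q) U x w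
        exact e4 _ e3 h3 _
      · intro U x x' hx hx' y
        rw [map_add, map_add, map_add, LinearMap.add_apply, LinearMap.add_apply, map_add, hx, hx']
      · intro U x hx y
        refine section_ext _ fun P hP => ?_
        obtain ⟨V, i, hPV, hz⟩ := hx P hP
        refine ⟨V, i, hPV, ?_⟩
        rw [hom_res, Bilin.map_app, Bilin.map_app, hz, hom_res, hom_res]
  · refine hom_ext_sections fun U x => ?_
    change (G 1).app U x = _
    have e1 : (dMul π 1 (.ofNat 0) (.ofNat (0 + 1)) (hn 0)).app U x (dOneOn π U) = x :=
      (dPolyAlg π).mul_one 1 U x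
    have e2 := hG 0 U x (dOneOn π U)
    rw [h0] at e2
    refine (congrArg (fun z => (G 1).app U z) e1.symm).trans (e2.trans ?_)
    exact A.mul_one 1 U _

/-- The uniqueness half: the unit and the degree one part generate the algebra locally. -/
theorem mulHom_ext [Smooth π] [CharZero K] {N : ℤ → X.Modules} {A : GradedAlg N}
    {g g' : ∀ n, dPoly π n ⟶ N n} (h0 : (g 0).app ⊤ (dOne π) = (g' 0).app ⊤ (dOne π))
    (hg : IsMulHom (dPolyAlg π) A g) (hg' : IsMulHom (dPolyAlg π) A g') (h1 : g 1 = g' 1) :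
    g = g' := by
  have hn : ∀ n : ℕ, (1 : ℤ) + .ofNat n = .ofNat (n + 1) := fun n => by
    simp [add_comm]
  funext n
  refine hom_ext_sections fun U x => ?_
  rcases n with n | n
  swap
  · rw [dPoly_negSucc π x 0, map_zero, map_zero]
  induction n generalizing U with
  | zero =>
    refine dPoly_zero_induction (π := π) (motive := fun U x => (g 0).app U x = (g' 0).app U x)
      ?_ ?_ U x
    · intro U r
      rw [app_smul, app_smul, dOneOn, ← hom_res, ← hom_res, h0]
    · intro U x hx
      refine section_ext _ fun P hP => ?_
      obtain ⟨V, i, hPV, hz⟩ := hx P hP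
      exact ⟨V, i, hPV, by rw [hom_res, hom_res, hz]⟩
  | succ n ih =>
    refine dPoly_induction (π := π) (hn n) (motive := fun U x => (g (.ofNat (n + 1))).app U x =
      (g' (.ofNat (n + 1))).app U x) ?_ ?_ ?_ U x
    · intro U x y
      refine (hg _ _ _ (hn n) U x y).trans (Eq.trans ?_ (hg' _ _ _ (hn n) U x y).symm)
      rw [h1, ih]
    · intro U x x' hx hx'
      rw [map_add, map_add, hx, hx']
    · intro U x hx
      refine section_ext _ fun P hP => ?_
      obtain ⟨V, i, hPV, hz⟩ := hx P hP
      exact ⟨V, i, hPV, by rw [hom_res, hom_res, hz]⟩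

/-- A homomorphism of graded algebras commutes with the differentials if it does so in degree
one. -/
theorem mulHom_comm_d [Smooth π] [CharZero K] {B : DGAlg X}
    {g : ∀ n, dPoly π n ⟶ B.cx.obj.X n} (h0 : (g 0).app ⊤ (dOne π) = B.alg.one)
    (hg : IsMulHom (dPolyAlg π) B.alg g)
    (h1 : ∀ U x, (B.cx.obj.d 1 2).app U ((g 1).app U x) = (g 2).app U ((dDiff π 1 2).app U x))
    (n m : ℤ) (hm : n + 1 = m) (U : X.Opens) (x : Γ(dPoly π n, U)) :
    (B.cx.obj.d n m).app U ((g n).app U x) = (g m).app U ((dDiff π n m).app U x) := by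
  have hn : ∀ n : ℕ, (1 : ℤ) + .ofNat n = .ofNat (n + 1) := fun n => by
    simp [add_comm]
  rcases n with n | n
  swap
  · rw [dPoly_negSucc π x 0]
    simp only [map_zero]
  induction n generalizing m U with
  | zero =>
    obtain rfl : m = 1 := hm.symm
    refine dPoly_zero_induction (π := π) (motive := fun U x => (B.cx.obj.d 0 1).app U
      ((g 0).app U x) = (g 1).app U ((dDiff π 0 1).app U x)) ?_ ?_ U x
    · intro U r
      -- Both sides vanish, since the differentials are linear over functions and the unit is closed
      -- in both algebras.
      simp only [app_smul]
      rw [dOneOn, ← hom_res, ← hom_res, ← hom_res, h0, B.d_one, dPoly_d_one, map_zero, map_zero,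
        map_zero]
    · intro U x hx
      refine section_ext _ fun P hP => ?_
      obtain ⟨V, i, hPV, hz⟩ := hx P hP
      exact ⟨V, i, hPV, by rw [hom_res, hom_res, hom_res, hom_res, hz]⟩
  | succ n ih =>
    obtain rfl : m = .ofNat (n + 1 + 1) := hm.symm
    refine dPoly_induction (π := π) (hn n) (motive := fun U x => (B.cx.obj.d (.ofNat (n + 1))
      (.ofNat (n + 1 + 1))).app U ((g (.ofNat (n + 1))).app U x) = (g (.ofNat (n + 1 + 1))).app U
        ((dDiff π (.ofNat (n + 1)) (.ofNat (n + 1 + 1))).app U x)) ?_ ?_ ?_ U x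
    · intro U x y
      -- The Leibniz rules on the two sides match term by term: `h1` treats the differential of the
      -- degree one factor, the induction hypothesis that of the other.
      have l1 := hg 1 (.ofNat n) _ (hn n) U x y
      have l2 := B.leibniz 1 (.ofNat n) (.ofNat (n + 1)) 2 (.ofNat (n + 1)) (.ofNat (n + 1 + 1))
        (hn n) rfl rfl rfl U ((g 1).app U x) ((g (.ofNat n)).app U y)
      have l3 := dPoly_leibniz π 1 (.ofNat n) (.ofNat (n + 1)) 2 (.ofNat (n + 1)) (.ofNat (n + 1 + 1))
        (hn n) rfl rfl rfl U x y
      have l4 := hg 2 (.ofNat n) (.ofNat (n + 1 + 1)) (by simp; omega) U ((dDiff π 1 2).app U x) y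
      have l5 := hg 1 (.ofNat (n + 1)) (.ofNat (n + 1 + 1)) (by simp; omega) U x
        ((dDiff π (.ofNat n) (.ofNat (n + 1))).app U y)
      refine (congrArg (fun z => (B.cx.obj.d _ _).app U z) l1).trans (l2.trans ?_)
      rw [l3, map_add, app_units_smul]
      refine congrArg₂ (· + ·) ?_ (congrArg (_ • ·) ?_)
      · refine Eq.trans ?_ l4.symm
        rw [h1]
      · refine Eq.trans ?_ l5.symm
        rw [ih (.ofNat (n + 1)) U rfl y]
    · intro U x x' hx hx'
      simp only [map_add, hx, hx']
    · intro U x hx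
      refine section_ext _ fun P hP => ?_
      obtain ⟨V, i, hPV, hz⟩ := hx P hP
      exact ⟨V, i, hPV, by rw [hom_res, hom_res, hom_res, hom_res, hz]⟩

theorem IsMulHom.isGradedLieHom {M N : ℤ → X.Modules} {A : GradedAlg M} {B : GradedAlg N}
    {g : ∀ n, M n ⟶ N n} (hg : IsMulHom A B g) :
    IsGradedLieHom A.toGradedLie B.toGradedLie g := by
  intro p q n h U x y
  have h' : q + p = n := by omega
  change (g n).app U ((A.commutator p q n h).app U x y) = (B.commutator p q n h).app U _ _
  rw [A.commutator_app p q n h h', B.commutator_app p q n h h', map_sub, app_units_smul, hg, hg]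

theorem isUniversalEnveloping [Smooth π] [CharZero K] (hd : DStable (dPolyLie π)) :
    IsUniversalEnveloping (generatedDGLie (dPolyLie π) hd) (dPolyDG π)
      (generatedIncl (dPolyLie π) hd) := by
  refine ⟨fun p q n h U x y => lieIncl_bracket _ p q n h U x y, fun B f hf => ?_⟩
  obtain ⟨g, hg0, hg, hg1⟩ := exists_mulHom (π := π) B.alg
    (lieGenMap (dPolyLie π).lie ≫ f.hom.f 1)
  -- Both are Lie morphisms out of an algebra generated in degree one, where they agree by the
  -- choice of `g`.
  have hi : (fun n => lieIncl (dPolyLie π).lie n ≫ g n) = f.hom.f := by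
    refine IsGradedLieHom.ext_gen (B := (dPolyLie π).lie) (C := B.alg.toGradedLie) ?_ hf ?_
    · intro p q n h U x y
      exact hg.isGradedLieHom p q n h U _ _
    · intro U x
      exact congrArg (fun g : dPoly π 1 ⟶ B.cx.obj.X 1 => g.app U x) hg1
  have hin : ∀ n U x, (g n).app U ((lieIncl (dPolyLie π).lie n).app U x) = (f.hom.f n).app U x :=
    fun n U x => congrArg (fun k : ∀ n, lieObj (dPolyLie π).lie n ⟶ B.cx.obj.X n =>
      (k n).app U x) hi
  -- For x of degree one, d(g x) = d(f x) = f(dx) = g(dx); the last equality holds because dx lies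
  -- in the Lie subalgebra.
  have hcomm := mulHom_comm_d (π := π) (B := B) hg0 hg (fun U x => by
    have h1 := ConcreteCategory.congr_hom (congrArg (fun k => Scheme.Modules.Hom.app k U)
      (f.hom.comm 1 2)) ((lieGenMap (dPolyLie π).lie).app U x)
    refine Eq.trans ?_ (h1.trans ?_)
    · rw [hg1]
      rfl
    · exact (hin 2 U _).symm)
  let G : (dPolyDG π).cx ⟶ B.cx := ⟨{
    f := g
    comm' := fun n m hm => hom_ext_sections fun U x => hcomm n m hm U x }⟩
  refine ⟨G, ⟨⟨hg0, hg⟩, ?_⟩, fun G' hG' => ?_⟩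
  · refine ObjectProperty.hom_ext _ (HomologicalComplex.hom_ext _ _ fun n => ?_)
    exact congrFun hi n
  · refine ObjectProperty.hom_ext _ (HomologicalComplex.hom_ext _ _ fun n => ?_)
    refine congrFun (mulHom_ext (π := π) (A := B.alg) (g := G'.hom.f) (g' := g)
      (hG'.1.1.trans hg0.symm) hG'.1.2 hg ?_) n
    rw [hg1, ← hG'.2]
    rfl

end UniversalEnveloping

/-! ### Freeness by the Dynkin–Specht–Wever argument -/

section Freeness

variable {K : Type u} [Field K] {X : Scheme.{u}} {π : X ⟶ Spec (.of K)}

/-- The right-normed bracket map: the product of sections of degree one goes to their right-normed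
iterated bracket. -/
theorem exists_rightNormed [Smooth π] [CharZero K] {N : ℤ → X.Modules} (C : GradedLie N)
    (ψ : dPoly π 1 ⟶ N 1) : ∃ H : ∀ n, dPoly π n ⟶ N n, H 1 = ψ ∧
      ∀ (q n : ℤ) (h : 1 + q = n), 1 ≤ q → ∀ (U : X.Opens) (x : Γ(dPoly π 1, U))
        (t : Γ(dPoly π q, U)), (H n).app U ((dMul π 1 q n h).app U x t) =
          (C.bracket 1 q n h).app U (ψ.app U x) ((H q).app U t) := by
  have hn : ∀ n : ℕ, (1 : ℤ) + .ofNat n = .ofNat (n + 1) := fun n => by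
    simp [add_comm]
  -- The index is shifted by one: the recursion starts from ψ in degree one. Degrees at most zero
  -- are later filled with the zero map, on which the recursion rule puts no condition.
  let H : ∀ n : ℕ, dPoly π (.ofNat (n + 1)) ⟶ N (.ofNat (n + 1)) := fun n => n.rec ψ fun n g =>
    (exists_lift (π := π) (hn (n + 1)) ((C.bracket 1 (.ofNat (n + 1)) (.ofNat (n + 1 + 1))
      (hn (n + 1))).comp ψ g)).choose
  have hH : ∀ (n : ℕ) U x y, (H (n + 1)).app U
      ((dMul π 1 (.ofNat (n + 1)) (.ofNat (n + 1 + 1)) (hn (n + 1))).app U x y) =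
      (C.bracket 1 (.ofNat (n + 1)) (.ofNat (n + 1 + 1)) (hn (n + 1))).app U (ψ.app U x)
        ((H n).app U y) := fun n =>
    (exists_lift (π := π) (hn (n + 1)) ((C.bracket 1 (.ofNat (n + 1)) (.ofNat (n + 1 + 1))
      (hn (n + 1))).comp ψ (H n))).choose_spec
  refine ⟨fun n => match n with
    | .ofNat (n + 1) => H n
    | .ofNat 0 => 0
    | .negSucc _ => 0, rfl, ?_⟩
  intro q n h hq U x t
  obtain ⟨k, rfl⟩ : ∃ k : ℕ, q = .ofNat (k + 1) := ⟨(q - 1).toNat, by simp; omega⟩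
  obtain rfl : n = .ofNat (k + 1 + 1) := h.symm.trans (hn _)
  exact hH k U x t

variable (π) in
/-- A morphism multiplied by a constant. -/
noncomputable def scaleHom {M N : X.Modules} (c : K) (f : M ⟶ N) : M ⟶ N :=
  homMk (fun U => constants π U c • homLin f U) (fun {U V} i x => by
    change N.presheaf.map i.op (constants π U c • f.app U x) = constants π V c • f.app V _
    rw [Scheme.Modules.map_smul, hom_res]
    exact congrArg (· • f.app V (M.presheaf.map i.op x)) (fres_constants π i.le c))

theorem Bilin.app_units_smul_left {M N P : X.Modules} (b : Bilin M N P) (U : X.Opens) (r : ℤˣ)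
    (x : Γ(M, U)) (y : Γ(N, U)) : b.app U (r • x) y = r • b.app U x y := by
  rw [Units.smul_def, map_zsmul, LinearMap.smul_apply, Units.smul_def]

section Bracket

variable {N : ℤ → X.Modules} {C : GradedLie N} {H : ∀ n, dPoly π n ⟶ N n}

theorem lieIncl_lieBracket {p q n : ℤ} (h : p + q = n) (h' : q + p = n) {U : X.Opens}
    (x : Γ(lieObj (dPolyAlg π).toGradedLie p, U)) (y : Γ(lieObj (dPolyAlg π).toGradedLie q, U)) :
    (lieIncl (dPolyAlg π).toGradedLie n).app U
        ((lieBracket (dPolyAlg π).toGradedLie p q n h).app U x y) =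
      (dMul π p q n h).app U ((lieIncl _ p).app U x) ((lieIncl _ q).app U y) -
        (p * q).negOnePow •
          (dMul π q p n h').app U ((lieIncl _ q).app U y) ((lieIncl _ p).app U x) :=
  (dPolyAlg π).commutator_app p q n h h' U _ _

variable (C H) in
/-- Left multiplication by `x` corresponds to the bracket with the normalized image of `x`. -/
def IsAdjointCompatible (p : ℤ) (U : X.Opens) (x : Γ(lieObj (dPolyAlg π).toGradedLie p, U)) :
    Prop :=
  ∀ (q n : ℤ) (h : p + q = n), 1 ≤ q → ∀ t : Γ(dPoly π q, U),
    (H n).app U ((dMul π p q n h).app U ((lieIncl _ p).app U x) t) =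
      (C.bracket p q n h).app U (constants π U (p : K)⁻¹ • (H p).app U ((lieIncl _ p).app U x))
        ((H q).app U t)

theorem constants_smul_inv [CharZero K] {p : ℤ} (hp : 1 ≤ p) {U : X.Opens} {M : X.Modules}
    (y : Γ(M, U)) : constants π U (p : K) • constants π U (p : K)⁻¹ • y = y := by
  have : (p : K) ≠ 0 := Int.cast_ne_zero.2 (by omega)
  rw [smul_smul, ← map_mul, mul_inv_cancel₀ this, map_one, one_smul]

/-- Put a = H(x)/p and b = H(y)/q. Applying H to xy ∓ yx gives [a, q b] ∓ [b, p a], and graded skew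
symmetry turns this into (p + q)[a, b]. Hence the normalization by the degree. -/
theorem IsAdjointCompatible.map_bracket [CharZero K] {p q n : ℤ} (h : p + q = n) (hp : 1 ≤ p)
    (hq : 1 ≤ q) {U : X.Opens} {x : Γ(lieObj (dPolyAlg π).toGradedLie p, U)}
    {y : Γ(lieObj (dPolyAlg π).toGradedLie q, U)} (hx : IsAdjointCompatible C H p U x)
    (hy : IsAdjointCompatible C H q U y) :
    constants π U (n : K)⁻¹ • (H n).app U ((lieIncl _ n).app U
        ((lieBracket (dPolyAlg π).toGradedLie p q n h).app U x y)) =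
      (C.bracket p q n h).app U
        (constants π U (p : K)⁻¹ • (H p).app U ((lieIncl _ p).app U x))
        (constants π U (q : K)⁻¹ • (H q).app U ((lieIncl _ q).app U y)) := by
  have h' : q + p = n := by omega
  rw [lieIncl_lieBracket h h', map_sub, app_units_smul, hx q n h hq, hy p n h' hp]
  set a := constants π U (p : K)⁻¹ • (H p).app U ((lieIncl _ p).app U x)
  set b := constants π U (q : K)⁻¹ • (H q).app U ((lieIncl _ q).app U y)
  have ha : (H p).app U ((lieIncl _ p).app U x) = constants π U (p : K) • a :=
    (constants_smul_inv hp _).symm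
  have hb : (H q).app U ((lieIncl _ q).app U y) = constants π U (q : K) • b :=
    (constants_smul_inv hq _).symm
  clear_value a b
  have hs := C.skew p q n h h' U a b
  have hn0 : (n : K) ≠ 0 := Int.cast_ne_zero.2 (by omega)
  rw [ha, hb, map_smul, map_smul, smul_comm (p * q).negOnePow, sub_eq_add_neg, ← smul_neg, ← hs,
    ← add_smul, ← map_add, smul_smul, ← map_mul, add_comm (q : K), ← Int.cast_add, h,
    inv_mul_cancel₀ hn0, map_one, one_smul]

/-- On generators this is the recursion defining H. For a bracket, applying H to (xy ∓ yx)t gives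
[a, [b, Ht]] ∓ [b, [a, Ht]], which is [[a, b], Ht] by the Jacobi identity, and
`IsAdjointCompatible.map_bracket` identifies [a, b] with the normalized image of [x, y]. -/
theorem isAdjointCompatible [CharZero K] (hH : ∀ (q n : ℤ) (h : 1 + q = n), 1 ≤ q →
      ∀ (U : X.Opens) (x : Γ(dPoly π 1, U)) (t : Γ(dPoly π q, U)),
        (H n).app U ((dMul π 1 q n h).app U x t) =
          (C.bracket 1 q n h).app U ((H 1).app U x) ((H q).app U t)) (p : ℤ) (U : X.Opens)
    (x : Γ(lieObj (dPolyAlg π).toGradedLie p, U)) : IsAdjointCompatible C H p U x := by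
  refine lieObj_induction (motive := IsAdjointCompatible C H) ?_ ?_ ?_ ?_ ?_ ?_ p U x
  · intro U x q n h hq t
    rw [Int.cast_one, inv_one, map_one, one_smul]
    exact hH q n h hq U x t
  · intro p U q n h hq t
    simp only [map_zero, smul_zero, LinearMap.zero_apply]
  · intro p U x y hx hy q n h hq t
    simp only [map_add, smul_add, LinearMap.add_apply, hx q n h hq t, hy q n h hq t]
  · intro p U r x hx q n h hq t
    simp only [app_smul, map_smul, LinearMap.smul_apply]
    rw [hx q n h hq t, smul_comm, map_smul, LinearMap.smul_apply]
  · intro p q s h U x y hx hy r n hn hr t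
    -- In nonpositive degree the section is zero, so the default value of the inverse of 0 does no
    -- harm.
    by_cases hp : 1 ≤ p
    swap
    · rw [lieObj_eq_zero (by omega) x]
      simp only [map_zero, smul_zero, LinearMap.zero_apply]
    by_cases hq : 1 ≤ q
    swap
    · rw [lieObj_eq_zero (by omega) y]
      simp only [map_zero, smul_zero, LinearMap.zero_apply]
    rw [hx.map_bracket h hp hq hy, lieIncl_lieBracket h (by omega)]
    rw [map_sub, LinearMap.sub_apply, map_sub, Bilin.app_units_smul_left, app_units_smul]
    have h1 : q + p = s := by omega
    have h2 : q + r = q + r := rfl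
    have h3 : p + r = p + r := rfl
    have h4 : p + (q + r) = n := by omega
    have h5 : q + (p + r) = n := by omega
    have e1 := (dPolyAlg π).mul_assoc p q r s (q + r) n h h2 hn h4 U ((lieIncl _ p).app U x)
      ((lieIncl _ q).app U y) t
    have e2 := (dPolyAlg π).mul_assoc q p r s (p + r) n h1 h3 hn h5 U ((lieIncl _ q).app U y)
      ((lieIncl _ p).app U x) t
    have e3 := (congrArg (fun z => (H n).app U z) e1).trans
      ((hx (q + r) n h4 (by omega) _).trans (congrArg _ (hy r (q + r) h2 hr t)))
    have e4 := (congrArg (fun z => (H n).app U z) e2).trans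
      ((hy (p + r) n h5 (by omega) _).trans (congrArg _ (hx r (p + r) h3 hr t)))
    refine (congrArg₂ (fun a b => a - (p * q).negOnePow • b) e3 e4).trans ?_
    rw [sub_eq_iff_eq_add]
    exact C.jacobi p q r s (q + r) (p + r) n h h2 h3 hn h4 h5 U _ _ _
  · intro p U x hx q n h hq t
    refine section_ext _ fun P hP => ?_
    obtain ⟨V, i, hPV, hz⟩ := hx P hP
    refine ⟨V, i, hPV, ?_⟩
    have := hz q n h hq ((dPoly π q).presheaf.map i.op t)
    have hc : X.presheaf.map i.op (constants π U (p : K)⁻¹) = constants π V (p : K)⁻¹ :=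
      fres_constants π i.le _
    rw [hom_res, Bilin.map_app, Bilin.map_app, Scheme.Modules.map_smul, hc, hom_res, hom_res,
      hom_res, hom_res]
    exact this

end Bracket

theorem isFreeGradedLie [Smooth π] [CharZero K] :
    IsFreeGradedLie (generatedLie (dPolyAlg π).toGradedLie)
      (lieGenMap (dPolyAlg π).toGradedLie) := by
  intro N C ψ
  obtain ⟨H, rfl, hH⟩ := exists_rightNormed (π := π) C ψ
  have hc := isAdjointCompatible hH
  -- H multiplies the expected image of a Lie element of degree n by n, so dividing by the degree
  -- gives the Lie morphism. In degree one nothing changes, so F extends the given map.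
  let F : ∀ n, lieObj (dPolyAlg π).toGradedLie n ⟶ N n := fun n =>
    scaleHom π (n : K)⁻¹ (lieIncl (dPolyAlg π).toGradedLie n ≫ H n)
  have hF : IsGradedLieHom (generatedLie (dPolyAlg π).toGradedLie) C F := by
    intro p q n h U x y
    by_cases hp : 1 ≤ p
    swap
    · rw [lieObj_eq_zero (by omega) x]
      simp only [map_zero, LinearMap.zero_apply]
    by_cases hq : 1 ≤ q
    swap
    · rw [lieObj_eq_zero (by omega) y]
      simp only [map_zero]
    exact (hc p U x).map_bracket h hp hq (hc q U y)
  have hF1 : lieGenMap (dPolyAlg π).toGradedLie ≫ F 1 = H 1 := by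
    refine hom_ext_sections fun U x => ?_
    change constants π U ((1 : ℤ) : K)⁻¹ • (H 1).app U x = (H 1).app U x
    rw [Int.cast_one, inv_one, map_one, one_smul]
  refine ⟨F, ⟨hF, hF1⟩, ?_⟩
  rintro f ⟨hf, hf1⟩
  exact hf.ext_gen hF fun U x => congrArg (fun k => k.app U x) (hf1.trans hF1.symm)

end Freeness

end PolyDiff

theorem lemma2 {K : Type u} [Field K] [CharZero K] (X : Scheme.{u})
    (π : X ⟶ Spec (CommRingCat.of K)) [Smooth π] [IsSeparated π] :
    ∃ hd : PolyDiff.DStable (PolyDiff.dPolyLie π),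
      PolyDiff.IsFreeGradedLie (PolyDiff.generatedLie (PolyDiff.dPolyLie π).lie)
        (PolyDiff.lieGenMap (PolyDiff.dPolyLie π).lie) ∧
      PolyDiff.IsUniversalEnveloping (PolyDiff.generatedDGLie (PolyDiff.dPolyLie π) hd)
        (PolyDiff.dPolyDG π) (PolyDiff.generatedIncl (PolyDiff.dPolyLie π) hd) :=
  ⟨PolyDiff.dStable, PolyDiff.isFreeGradedLie, PolyDiff.isUniversalEnveloping _⟩
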